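/- Throughout, all Hilbert spaces $H,\tilde H,K_A,K_B,\dots$ are finite-dimensional and complex, and $X$, $\mathcal A$ are finite sets (of questions and answers). **Strategies.** A POVM on $H$ is a family $\{E_a\}_{a\in\mathcal A}$ of positive operators on $H$ with $\sum_a E_a=1$. A strategy $(|\psi\rangle,A,B)$ consists of a unit vector $|\psi\rangle\in H_A\otimes H_B$ and POVMs $\{A^x_a\}_a$ on $H_A$ and $\{B^y_b\}_b$ on $H_B$, for $x,y\in X$. An ME strategy is a triple $\mathcal S=(B(H),\tau,A)$ with $H\neq 0$, $\tau$ the normalised trace and $A=\{A^x_a\}$ a family of POVMs in $B(H)$. Given an orthonormal basis $\{u_i\}_{i=1}^d$ of $H$, it is also viewed as the strategy $(|\psi\rangle,A,A^T)$ on $H\otimes H$ with $|\psi\rangle=d^{-1/2}\sum_i|u_i\rangle\otimes|u_i\rangle$, the transpose being taken in the basis $\{u_i\}$. **Local dilation.** Let $\nu$ be a probability distribution on $X\times X$ with marginals $\nu_A,\nu_B$. The strategy $\tilde{\mathcal S}=(|\tilde\psi\rangle,\tilde A,\tilde B)$ is a local $(\epsilon,\nu)$-dilation of $\mathcal S=(|\psi\rangle,A,B)$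 if there are isometries $V_A:H_A\to\tilde H_A\otimes K_A$, $V_B:H_B\to\tilde H_B\otimes K_B$ and a unit vector $|aux\rangle\in K_A\otimes K_B$ such that, after the canonical reordering of tensor factors, $$\|(V_A\otimes V_B)|\psi\rangle-|\tilde\psi\rangle\otimes|aux\rangle\|\le\epsilon,$$ $$\Big(\mathbb E_{x\sim\nu_A}\sum_a\|(V_A\otimes V_B)(A^x_a\otimes 1)|\psi\rangle-((\tilde A^x_a\otimes 1)|\tilde\psi\rangle)\otimes|aux\rangle\|^2\Big)^{1/2}\le\epsilon,$$ $$\Big(\mathbb E_{y\sim\nu_B}\sum_b\|(V_A\otimes V_B)(1\otimes B^y_b)|\psi\rangle-((1\otimes\tilde B^y_b)|\tilde\psi\rangle)\otimes|aux\rangle\|^2\Big)^{1/2}\le\epsilon.$$ **Local vNA-dilation.** For a von Neumann algebra $Q$ with faithful tracial state $\tau^Q$, put $Q^\infty=Q\,\overline\otimes\,B(\ell^2(\mathbb N))$ with trace $\tau^\infty=\tau^Q\otimes\mathrm{Tr}$; identify $Q$ with $Q\otimes|e_0\rangle\langle e_0|\subset Q^\infty$, and let $I_Q=1\otimes|e_0\rangle\langle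 e_0|$; write $\|z\|_\tau^2=\tau(z^*z)$. Let $\mu$ be a probability distribution on $X$. The strategy $\tilde{\mathcal S}=(M,\tau^M,\tilde A)$ is a local $(\epsilon,\mu)$-vNA-dilation of $\mathcal S=(N,\tau^N,A)$ if there are a finite-dimensional von Neumann algebra $M_0$ with faithful tracial state $\tau^{M_0}$, a projection $P\in(M\otimes M_0)^\infty$ of finite trace, a $*$-isomorphism $N\cong P(M\otimes M_0)^\infty P$ (used to identify the two) under which $\tau^N=\tau^\infty/\tau^\infty(P)$, and a partial isometry $W\in P(M\otimes M_0)^\infty I_{M\otimes M_0}$, such that $$\mathbb E_{x\sim\mu}\sum_a\|\tilde A^x_a\otimes I_{M_0}-W^*A^x_aW\|^2_{\tau^{M\otimes M_0}}\le\epsilon,$$ $$\tau^N(P-WW^*)\le\epsilon,\qquad \tau^{M\otimes M_0}(I_{M\otimes M_0}-W^*W)\le\epsilon .$$ **Lemma.** Let $\hat\nu$ be a symmetric probability distribution on $X\times X$ with marginal $\hat\nu_A$ on $X$, let $\tilde{\mathcal S}=(B(\tilde H),\tau^{B(\tilde H)},\tilde A)$ and $\mathcal S=(B(H),\tau^{B(H)},A)$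 be two ME strategies with question set $X$ and answer set $\mathcal A$, and let $\epsilon\ge 0$. Then, for any choice of the orthonormal bases of $\tilde H$ and $H$ by which they are viewed as strategies on $\tilde H\otimes\tilde H$ and $H\otimes H$: (a) If $\tilde{\mathcal S}$ is a local $(\epsilon,\hat\nu)$-dilation of $\mathcal S$, then $\tilde{\mathcal S}$ is a local $(1700\epsilon^2,\hat\nu_A)$-vNA-dilation of $\mathcal S$. (b) If $\tilde{\mathcal S}$ is a local $(\epsilon,\hat\nu_A)$-vNA-dilation of $\mathcal S$, then $\tilde{\mathcal S}$ is a local $((4+\sqrt2)\sqrt\epsilon,\hat\nu)$-dilation of $\mathcal S$. -/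

import Mathlib

open scoped TensorProduct

set_option linter.unusedSectionVars false

noncomputable section

namespace SelfTesting

/-! ### Probability distributions, measurements and strategies -/

/-- `p` is a probability distribution on the finite set `ι`. -/
def IsProbDist {ι : Type*} [Fintype ι] (p : ι → ℝ) : Prop :=
  (∀ i, 0 ≤ p i) ∧ ∑ i, p i = 1

/-- The marginal distribution on the first factor. -/
def marginalFst {X Y : Type*} [Fintype Y] (ν : X × Y → ℝ) (x : X) : ℝ := ∑ y, ν (x, y)

/-- The marginal distribution on the second factor. -/
def marginalSnd {X Y : Type*} [Fintype X] (ν : X × Y → ℝ) (y : Y) : ℝ := ∑ x, ν (x, y)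

/-- Finite-dimensional Hilbert spaces are complete. -/
instance hilbertComplete {H : Type*} [NormedAddCommGroup H] [InnerProductSpace ℂ H]
    [FiniteDimensional ℂ H] : CompleteSpace H :=
  FiniteDimensional.complete ℂ H

/-- A finite family of operators is a POVM: all of them are positive, and they add up to `1`. -/
def IsPOVM {𝒜 H : Type*} [Fintype 𝒜] [NormedAddCommGroup H] [InnerProductSpace ℂ H]
    (E : 𝒜 → (H →L[ℂ] H)) : Prop :=
  (∀ a, (E a).IsPositive) ∧ ∑ a, E a = 1

/-- A (finite-dimensional) quantum strategy `(|ψ⟩, A, B)` with question sets `X`, `Y` and answer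
sets `𝒜`, `ℬ`: a unit vector of `H_A ⊗ H_B` and families of POVMs on `H_A` and on `H_B`. -/
structure Strategy (X Y 𝒜 ℬ HA HB : Type*) [Fintype 𝒜] [Fintype ℬ]
    [NormedAddCommGroup HA] [InnerProductSpace ℂ HA]
    [NormedAddCommGroup HB] [InnerProductSpace ℂ HB] where
  state : HA ⊗[ℂ] HB
  norm_state : ‖state‖ = 1
  A : X → 𝒜 → (HA →L[ℂ] HA)
  B : Y → ℬ → (HB →L[ℂ] HB)
  povm_A : ∀ x, IsPOVM (A x)
  povm_B : ∀ y, IsPOVM (B y)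

section LocalDilation

variable {X Y 𝒜 ℬ HA HB HA' HB' : Type*} [Fintype X] [Fintype Y] [Fintype 𝒜] [Fintype ℬ]
  [NormedAddCommGroup HA] [InnerProductSpace ℂ HA] [NormedAddCommGroup HB] [InnerProductSpace ℂ HB]
  [NormedAddCommGroup HA'] [InnerProductSpace ℂ HA']
  [NormedAddCommGroup HB'] [InnerProductSpace ℂ HB']

/-- `S'` is a local `(ε, ν)`-dilation of `S`. The canonical unitary
`tensorTensorTensorComm : (H'_A ⊗ H'_B) ⊗ (K_A ⊗ K_B) ≃ (H'_A ⊗ K_A) ⊗ (H'_B ⊗ K_B)`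
reorders the tensor factors. -/
def IsLocalDilation (S' : Strategy X Y 𝒜 ℬ HA' HB') (S : Strategy X Y 𝒜 ℬ HA HB)
    (ε : ℝ) (ν : X × Y → ℝ) : Prop :=
  ∃ (KA : Type) (_ : NormedAddCommGroup KA) (_ : InnerProductSpace ℂ KA)
    (_ : FiniteDimensional ℂ KA)
    (KB : Type) (_ : NormedAddCommGroup KB) (_ : InnerProductSpace ℂ KB)
    (_ : FiniteDimensional ℂ KB)
    (VA : HA →ₗᵢ[ℂ] HA' ⊗[ℂ] KA) (VB : HB →ₗᵢ[ℂ] HB' ⊗[ℂ] KB) (aux : KA ⊗[ℂ] KB),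
    ‖aux‖ = 1 ∧
    ‖TensorProduct.map VA.toLinearMap VB.toLinearMap S.state
        - TensorProduct.tensorTensorTensorComm ℂ HA' HB' KA KB (S'.state ⊗ₜ[ℂ] aux)‖ ≤ ε ∧
    √(∑ x, marginalFst ν x * ∑ a,
        ‖TensorProduct.map VA.toLinearMap VB.toLinearMap
            (TensorProduct.mapL (S.A x a) (1 : HB →L[ℂ] HB) S.state)
          - TensorProduct.tensorTensorTensorComm ℂ HA' HB' KA KB
            (TensorProduct.mapL (S'.A x a) (1 : HB' →L[ℂ] HB') S'.state ⊗ₜ[ℂ] aux)‖ ^ 2) ≤ ε ∧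
    √(∑ y, marginalSnd ν y * ∑ b,
        ‖TensorProduct.map VA.toLinearMap VB.toLinearMap
            (TensorProduct.mapL (1 : HA →L[ℂ] HA) (S.B y b) S.state)
          - TensorProduct.tensorTensorTensorComm ℂ HA' HB' KA KB
            (TensorProduct.mapL (1 : HA' →L[ℂ] HA') (S'.B y b) S'.state ⊗ₜ[ℂ] aux)‖ ^ 2) ≤ ε

end LocalDilation

/-! ### Von Neumann algebras -/

section VNA

variable {G : Type*} [NormedAddCommGroup G] [InnerProductSpace ℂ G] [CompleteSpace G]

/-- The von Neumann algebra generated by a set of operators: the double commutant of `S ∪ S*`. -/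
def generated (S : Set (G →L[ℂ] G)) : VonNeumannAlgebra G where
  toStarSubalgebra := StarSubalgebra.centralizer ℂ
    (StarSubalgebra.centralizer ℂ S : Set (G →L[ℂ] G))
  centralizer_centralizer' := by
    change Set.centralizer (Set.centralizer (Set.centralizer _)) = Set.centralizer _
    exact Set.centralizer_centralizer_centralizer _

theorem subset_generated (S : Set (G →L[ℂ] G)) : S ⊆ generated S := by
  intro x hx
  change x ∈ StarSubalgebra.centralizer ℂ (StarSubalgebra.centralizer ℂ S : Set (G →L[ℂ] G))
  rw [StarSubalgebra.mem_centralizer_iff]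
  intro g hg
  have hg' : g ∈ StarSubalgebra.centralizer ℂ S := hg
  have hs : star g ∈ StarSubalgebra.centralizer ℂ S := star_mem hg'
  rw [StarSubalgebra.mem_centralizer_iff] at hg' hs
  exact ⟨(hg' x hx).1.symm, (hs x hx).1.symm⟩

theorem mem_generated_comm {S : Set (G →L[ℂ] G)} {T : G →L[ℂ] G} (hT : T ∈ generated S)
    (z : G →L[ℂ] G) (hz : z ∈ StarSubalgebra.centralizer ℂ S) : z * T = T * z := by
  have hT' : T ∈ StarSubalgebra.centralizer ℂ
    (StarSubalgebra.centralizer ℂ S : Set (G →L[ℂ] G)) := hT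
  rw [StarSubalgebra.mem_centralizer_iff] at hT'
  exact (hT' z hz).1

/-- `B(G)` as a von Neumann algebra. -/
def fullAlgebra (G : Type*) [NormedAddCommGroup G] [InnerProductSpace ℂ G] [CompleteSpace G] :
    VonNeumannAlgebra G where
  toStarSubalgebra := ⊤
  centralizer_centralizer' := by
    apply Set.Subset.antisymm
    · exact fun _ _ => trivial
    · exact Set.subset_centralizer_centralizer

/-- A faithful tracial state on a von Neumann algebra on a finite-dimensional space
(where normality is automatic). -/
structure IsTracialState {M : VonNeumannAlgebra G} (τ : M.toStarSubalgebra →ₗ[ℂ] ℂ) : Prop where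
  map_one : τ 1 = 1
  map_mul_comm : ∀ x y, τ (x * y) = τ (y * x)
  nonneg : ∀ x, (τ (star x * x)).im = 0 ∧ 0 ≤ (τ (star x * x)).re
  faithful : ∀ x, τ (star x * x) = 0 → x = 0

/-! ### The amplification `M^∞ = M ⊗̄ B(ℓ²(ℕ))`, acting on `G ⊗ ℓ²(ℕ) = ℓ²(ℕ; G)` -/

/-- The Hilbert space `ℓ²(ℕ; G)`, that is, the Hilbert space tensor product `G ⊗ ℓ²(ℕ)`;
here `v ⊗ e_i` is `lp.single 2 i v`. -/
abbrev L2 (G : Type*) [NormedAddCommGroup G] : Type _ := lp (fun _ : ℕ => G) 2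

/-- The isometry `v ↦ v ⊗ e_i`. -/
def incl (G : Type*) [NormedAddCommGroup G] [InnerProductSpace ℂ G] (i : ℕ) : G →L[ℂ] L2 G :=
  lp.singleContinuousLinearMap ℂ (fun _ : ℕ => G) 2 i

/-- The `i`-th coordinate map, the adjoint of `incl G i`. -/
def coord (G : Type*) [NormedAddCommGroup G] [InnerProductSpace ℂ G] (i : ℕ) : L2 G →L[ℂ] G :=
  lp.evalCLM ℂ (fun _ : ℕ => G) 2 i

/-- The `(i, j)` entry of an operator on `ℓ²(ℕ; G)`, viewed as an infinite matrix of operators. -/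
def entry (i j : ℕ) (T : L2 G →L[ℂ] L2 G) : G →L[ℂ] G := coord G i ∘L T ∘L incl G j

/-- The operator `T` on `G ⊗ ℓ²(ℕ)` is the elementary tensor `x ⊗ b` (which has the matrix
`(⟨e_i| b |e_j⟩ x)_{i j}`). -/
def IsElementaryTensor (T : L2 G →L[ℂ] L2 G) (x : G →L[ℂ] G) (b : L2 ℂ →L[ℂ] L2 ℂ) : Prop :=
  ∀ i j, entry i j T = (entry i j b 1) • x

/-- The von Neumann algebra `M^∞ = M ⊗̄ B(ℓ²(ℕ))`, generated by all `x ⊗ b` with `x ∈ M` and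
`b ∈ B(ℓ²(ℕ))`. -/
def amplification (M : VonNeumannAlgebra G) : VonNeumannAlgebra (L2 G) :=
  generated {T | ∃ x ∈ M, ∃ b : L2 ℂ →L[ℂ] L2 ℂ, IsElementaryTensor T x b}

/-- The operator `z ⊗ 1` on `G ⊗ ℓ²(ℕ)`. -/
def diag (z : G →L[ℂ] G) : L2 G →L[ℂ] L2 G :=
  lp.mapCLM 2 (fun _ : ℕ => z) (norm_nonneg z) fun _ => le_rfl

theorem diag_incl (z : G →L[ℂ] G) (j : ℕ) (v : G) : diag z (incl G j v) = incl G j (z v) := by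
  refine lp.ext (funext fun i => ?_)
  change z ((lp.single 2 j v : L2 G) i) = (lp.single 2 j (z v) : L2 G) i
  by_cases h : i = j
  · subst h; simp
  · simp [lp.single_apply, Pi.single_eq_of_ne h]

theorem star_diag (z : G →L[ℂ] G) : star (diag z) = diag (star z) := by
  rw [ContinuousLinearMap.star_eq_adjoint]
  symm
  rw [ContinuousLinearMap.eq_adjoint_iff]
  intro f g
  rw [lp.inner_eq_tsum, lp.inner_eq_tsum]
  refine tsum_congr fun i => ?_
  change inner ℂ (star z (f i)) (g i) = inner ℂ (f i) (z (g i))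
  rw [ContinuousLinearMap.star_eq_adjoint, ContinuousLinearMap.adjoint_inner_left]

theorem entry_mem_of_mem_amplification {M : VonNeumannAlgebra G} {T : L2 G →L[ℂ] L2 G}
    (hT : T ∈ amplification M) (i j : ℕ) : entry i j T ∈ M := by
  have hcomm : ∀ z ∈ M.commutant, ∀ T : L2 G →L[ℂ] L2 G,
      (∃ x ∈ M, ∃ b : L2 ℂ →L[ℂ] L2 ℂ, IsElementaryTensor T x b) →
      T * diag z = diag z * T := by
    rintro z hz T ⟨x, hx, b, hT⟩
    have hxz : ∀ v, x (z v) = z (x v) := fun v =>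
      DFunLike.congr_fun (VonNeumannAlgebra.mem_commutant_iff.1 hz x hx) v
    refine lp.ext_continuousLinearMap (by simp) fun j => ?_
    ext v : 1
    refine lp.ext (funext fun i => ?_)
    have h1 : ∀ w, (T (incl G j w)) i = entry i j b 1 • x w := fun w =>
      DFunLike.congr_fun (hT i j) w
    change (T (diag z (incl G j v))) i = z ((T (incl G j v)) i)
    rw [diag_incl, h1, h1, map_smul, hxz]
  have hdiag : ∀ z ∈ M.commutant, T * diag z = diag z * T := by
    intro z hz
    refine (mem_generated_comm hT (diag z) ?_).symm
    rw [StarSubalgebra.mem_centralizer_iff]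
    intro S hS
    refine ⟨hcomm z hz S hS, ?_⟩
    have h := congrArg star (hcomm (star z) (star_mem hz) S hS)
    rw [star_mul, star_mul, star_diag, star_star] at h
    exact h.symm
  rw [← SetLike.mem_coe, ← VonNeumannAlgebra.commutant_commutant M, SetLike.mem_coe,
    VonNeumannAlgebra.mem_commutant_iff]
  intro z hz
  ext v
  have h := DFunLike.congr_fun (hdiag z hz) (incl G j v)
  have h2 : T (diag z (incl G j v)) = diag z (T (incl G j v)) := h
  rw [diag_incl] at h2
  change z ((T (incl G j v)) i) = (T (incl G j (z v))) i
  rw [h2]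
  rfl

theorem isElementaryTensor_corner (x : G →L[ℂ] G) :
    IsElementaryTensor (incl G 0 ∘L x ∘L coord G 0) x (incl ℂ 0 ∘L coord ℂ 0) := by
  intro i j
  ext v
  change (lp.single 2 0 (x ((lp.single 2 j v : L2 G) 0)) : L2 G) i
    = ((lp.single 2 0 ((lp.single 2 j (1 : ℂ) : L2 ℂ) 0) : L2 ℂ) i) • x v
  by_cases hi : i = 0
  · subst hi
    by_cases hj : j = 0
    · subst hj; simp
    · simp [lp.single_apply, Pi.single_eq_of_ne (Ne.symm hj)]
  · simp [lp.single_apply, Pi.single_eq_of_ne hi]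

theorem corner_mem_amplification {M : VonNeumannAlgebra G} {x : G →L[ℂ] G} (hx : x ∈ M) :
    incl G 0 ∘L x ∘L coord G 0 ∈ amplification M := by
  have h : incl G 0 ∘L x ∘L coord G 0 ∈
      {T | ∃ x ∈ M, ∃ b : L2 ℂ →L[ℂ] L2 ℂ, IsElementaryTensor T x b} :=
    ⟨x, hx, _, isElementaryTensor_corner x⟩
  exact subset_generated _ h

/-- The element `x ⊗ |e_0⟩⟨e_0|` of `M^∞`: the identification of `M` with a corner of `M^∞`. -/
def corner (M : VonNeumannAlgebra G) (x : M.toStarSubalgebra) :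
    (amplification M).toStarSubalgebra :=
  ⟨incl G 0 ∘L (x : G →L[ℂ] G) ∘L coord G 0,
    corner_mem_amplification x.2⟩

/-- The trace `τ^∞ = τ ⊗ Tr` on `M^∞`: the sum of the traces of the diagonal entries.
It is used for elements of the corner `P M^∞ P` of a projection `P` of finite trace and for elements
of the corner `M ⊆ M^∞`; on these the series converges absolutely. -/
def traceInf {M : VonNeumannAlgebra G} (τ : M.toStarSubalgebra →ₗ[ℂ] ℂ)
    (T : (amplification M).toStarSubalgebra) : ℂ :=
  ∑' i, τ ⟨entry i i (T : L2 G →L[ℂ] L2 G), entry_mem_of_mem_amplification T.2 i i⟩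

/-- The positive operator `T` in `M^∞` satisfies `τ^∞(T) < ∞`. -/
def HasFiniteTrace {M : VonNeumannAlgebra G} (τ : M.toStarSubalgebra →ₗ[ℂ] ℂ)
    (T : (amplification M).toStarSubalgebra) : Prop :=
  Summable fun i => τ ⟨entry i i (T : L2 G →L[ℂ] L2 G), entry_mem_of_mem_amplification T.2 i i⟩

end VNA

/-! ### Tensor products of von Neumann algebras on finite-dimensional spaces -/

section Tensor

variable {G K : Type*} [NormedAddCommGroup G] [InnerProductSpace ℂ G] [FiniteDimensional ℂ G]
  [NormedAddCommGroup K] [InnerProductSpace ℂ K] [FiniteDimensional ℂ K]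

/-- The von Neumann algebra `M ⊗ M₀` on `G ⊗ K`, generated by all `x ⊗ y`. -/
def tensorAlgebra (M : VonNeumannAlgebra G) (M₀ : VonNeumannAlgebra K) :
    VonNeumannAlgebra (G ⊗[ℂ] K) :=
  generated {T | ∃ x ∈ M, ∃ y ∈ M₀, T = TensorProduct.mapL x y}

/-- The element `x ⊗ y` of `M ⊗ M₀`. -/
def tensorElem {M : VonNeumannAlgebra G} {M₀ : VonNeumannAlgebra K}
    (x : M.toStarSubalgebra) (y : M₀.toStarSubalgebra) :
    (tensorAlgebra M M₀).toStarSubalgebra :=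
  ⟨TensorProduct.mapL (x : G →L[ℂ] G) (y : K →L[ℂ] K),
    subset_generated _ ⟨x, x.2, y, y.2, rfl⟩⟩

theorem exists_extension {M : VonNeumannAlgebra G} (τ : M.toStarSubalgebra →ₗ[ℂ] ℂ) :
    ∃ f : (G →ₗ[ℂ] G) →ₗ[ℂ] ℂ,
      ∀ x : M.toStarSubalgebra, f ((x : G →L[ℂ] G) : G →ₗ[ℂ] G) = τ x := by
  obtain ⟨g, hg⟩ := LinearMap.exists_extend
    (p := Subalgebra.toSubmodule M.toStarSubalgebra.toSubalgebra) τ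
  refine ⟨g ∘ₗ (LinearMap.toContinuousLinearMap (𝕜 := ℂ) (E := G) (F' := G)).toLinearMap, ?_⟩
  intro x
  exact DFunLike.congr_fun hg x

/-- A linear extension to all operators on `G` of a functional on `M ⊆ B(G)`. -/
def extension {M : VonNeumannAlgebra G} (τ : M.toStarSubalgebra →ₗ[ℂ] ℂ) :
    (G →ₗ[ℂ] G) →ₗ[ℂ] ℂ :=
  (exists_extension τ).choose

/-- The product functional `τ ⊗ τ₀` on `M ⊗ M₀`. It is the restriction to `M ⊗ M₀` of the product of
linear extensions of `τ` and `τ₀`; it is determined by `tensorTrace_tensorElem`, so it does not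
depend on the choice of the extensions. -/
def tensorTrace {M : VonNeumannAlgebra G} {M₀ : VonNeumannAlgebra K}
    (τ : M.toStarSubalgebra →ₗ[ℂ] ℂ) (τ₀ : M₀.toStarSubalgebra →ₗ[ℂ] ℂ) :
    (tensorAlgebra M M₀).toStarSubalgebra →ₗ[ℂ] ℂ where
  toFun T := TensorProduct.lid ℂ ℂ (TensorProduct.map (extension τ) (extension τ₀)
    ((homTensorHomEquiv ℂ G K G K).symm
      ((T : (G ⊗[ℂ] K) →L[ℂ] (G ⊗[ℂ] K)) : (G ⊗[ℂ] K) →ₗ[ℂ] (G ⊗[ℂ] K))))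
  map_add' S T := by simp
  map_smul' c T := by simp

theorem tensorTrace_tensorElem {M : VonNeumannAlgebra G} {M₀ : VonNeumannAlgebra K}
    (τ : M.toStarSubalgebra →ₗ[ℂ] ℂ) (τ₀ : M₀.toStarSubalgebra →ₗ[ℂ] ℂ)
    (x : M.toStarSubalgebra) (y : M₀.toStarSubalgebra) :
    tensorTrace τ τ₀ (tensorElem x y) = τ x * τ₀ y := by
  have h : (homTensorHomEquiv ℂ G K G K).symm
      (((tensorElem x y : (tensorAlgebra M M₀).toStarSubalgebra) :
        (G ⊗[ℂ] K) →L[ℂ] (G ⊗[ℂ] K)) : (G ⊗[ℂ] K) →ₗ[ℂ] (G ⊗[ℂ] K))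
      = ((x : G →L[ℂ] G) : G →ₗ[ℂ] G) ⊗ₜ[ℂ] ((y : K →L[ℂ] K) : K →ₗ[ℂ] K) := by
    rw [LinearEquiv.symm_apply_eq, homTensorHomEquiv_apply,
      TensorProduct.homTensorHomMap_apply]
    exact TensorProduct.toLinearMap_mapL _ _
  change TensorProduct.lid ℂ ℂ (TensorProduct.map (extension τ) (extension τ₀) _) = _
  rw [h, TensorProduct.map_tmul, TensorProduct.lid_tmul, smul_eq_mul]
  rw [extension, extension, (exists_extension τ).choose_spec, (exists_extension τ₀).choose_spec]

end Tensor

/-! ### Strategies in terms of tracial von Neumann algebras -/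

/-- A strategy `(M, τ, A)`: a (finite-dimensional) tracial von Neumann algebra `(M, τ)` together
with POVMs `A x` in `M`. -/
structure TracialStrategy (X 𝒜 G : Type*) [Fintype 𝒜] [NormedAddCommGroup G]
    [InnerProductSpace ℂ G] [FiniteDimensional ℂ G] where
  alg : VonNeumannAlgebra G
  trace : alg.toStarSubalgebra →ₗ[ℂ] ℂ
  isTracialState : IsTracialState trace
  A : X → 𝒜 → alg.toStarSubalgebra
  povm : ∀ x, IsPOVM fun a => (A x a : G →L[ℂ] G)

section VNADilation

variable {X 𝒜 H' H : Type*} [Fintype X] [Fintype 𝒜]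
  [NormedAddCommGroup H'] [InnerProductSpace ℂ H'] [FiniteDimensional ℂ H']
  [NormedAddCommGroup H] [InnerProductSpace ℂ H] [FiniteDimensional ℂ H]

/-- `S' = (M, τ^M, A')` is a local `(ε, ν)`-vNA-dilation of `S = (N, τ^N, A)`. Here `Q = M ⊗ M₀`
has the trace `τ = τ^M ⊗ τ^{M₀}`, the \*-isomorphism `π` identifies `N` with the corner
`P Q^∞ P`, and `corner Q` identifies `Q` with `I Q^∞ I`, so that `τ^Q` is `τ^∞` there and `τ^N` is
`τ^∞ / τ^∞(P)`. -/
def IsVNADilation (S' : TracialStrategy X 𝒜 H') (S : TracialStrategy X 𝒜 H)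
    (ε : ℝ) (ν : X → ℝ) : Prop :=
  ∃ (K : Type) (_ : NormedAddCommGroup K) (_ : InnerProductSpace ℂ K)
    (_ : FiniteDimensional ℂ K)
    (M₀ : VonNeumannAlgebra K) (τ₀ : M₀.toStarSubalgebra →ₗ[ℂ] ℂ),
    IsTracialState τ₀ ∧
    let Q := tensorAlgebra S'.alg M₀
    let τ := tensorTrace S'.trace τ₀
    let I := corner Q 1
    ∃ (P : (amplification Q).toStarSubalgebra)
      (π : S.alg.toStarSubalgebra →⋆ₙₐ[ℂ] (amplification Q).toStarSubalgebra)
      (W : (amplification Q).toStarSubalgebra),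
      IsStarProjection P ∧ HasFiniteTrace τ P ∧
      Function.Injective π ∧ (∀ T, T ∈ Set.range π ↔ P * T * P = T) ∧
      (∀ x, S.trace x = traceInf τ (π x) / traceInf τ P) ∧
      W * star W * W = W ∧ P * W * I = W ∧
      ∑ x, ν x * ∑ a,
        (traceInf τ
          (star (corner Q (tensorElem (S'.A x a) 1) - star W * π (S.A x a) * W) *
            (corner Q (tensorElem (S'.A x a) 1) - star W * π (S.A x a) * W))).re ≤ ε ∧
      (traceInf τ (P - W * star W) / traceInf τ P).re ≤ ε ∧
      (traceInf τ (I - star W * W)).re ≤ ε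

end VNADilation

/-! ### ME strategies -/

/-- The data of an ME strategy `(B(H), τ, A)`, where `τ` is the normalised trace: POVMs `A x` in
`B(H)`, for a finite-dimensional Hilbert space `H`. -/
structure MEStrategy (X 𝒜 H : Type*) [Fintype 𝒜] [NormedAddCommGroup H]
    [InnerProductSpace ℂ H] where
  A : X → 𝒜 → (H →L[ℂ] H)
  povm : ∀ x, IsPOVM (A x)

section ME

variable {X 𝒜 H : Type*} [Fintype 𝒜] [NormedAddCommGroup H] [InnerProductSpace ℂ H]
  [FiniteDimensional ℂ H]

/-- The normalised trace on `B(H)`. -/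
def normalizedTrace (H : Type*) [NormedAddCommGroup H] [InnerProductSpace ℂ H]
    [FiniteDimensional ℂ H] : (fullAlgebra H).toStarSubalgebra →ₗ[ℂ] ℂ where
  toFun x := (Module.finrank ℂ H : ℂ)⁻¹ * LinearMap.trace ℂ H ((x : H →L[ℂ] H) : H →ₗ[ℂ] H)
  map_add' x y := by simp [mul_add]
  map_smul' c x := by simp; ring

theorem isTracialState_normalizedTrace [Nontrivial H] : IsTracialState (normalizedTrace H) := by
  have hd : (0 : ℝ) < Module.finrank ℂ H := by exact_mod_cast Module.finrank_pos
  have key : ∀ x : (fullAlgebra H).toStarSubalgebra, normalizedTrace H (star x * x)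
      = (((Module.finrank ℂ H : ℝ)⁻¹ *
        ∑ i, ‖(x : H →L[ℂ] H) (stdOrthonormalBasis ℂ H i)‖ ^ 2 : ℝ) : ℂ) := by
    intro x
    change (Module.finrank ℂ H : ℂ)⁻¹ * LinearMap.trace ℂ H
      (((star (x : H →L[ℂ] H) * (x : H →L[ℂ] H) : H →L[ℂ] H)) : H →ₗ[ℂ] H) = _
    rw [LinearMap.trace_eq_sum_inner _ (stdOrthonormalBasis ℂ H)]
    push_cast
    congr 1
    refine Finset.sum_congr rfl fun i _ => ?_
    change inner ℂ _ ((star (x : H →L[ℂ] H)) ((x : H →L[ℂ] H) _)) = _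
    rw [ContinuousLinearMap.star_eq_adjoint, ContinuousLinearMap.adjoint_inner_right,
      inner_self_eq_norm_sq_to_K]
    rfl
  refine ⟨?_, ?_, ?_, ?_⟩
  · change (Module.finrank ℂ H : ℂ)⁻¹ * LinearMap.trace ℂ H (1 : H →ₗ[ℂ] H) = 1
    rw [LinearMap.trace_one]
    exact inv_mul_cancel₀ (by exact_mod_cast hd.ne')
  · intro x y
    change _ * LinearMap.trace ℂ H
      (((x : H →L[ℂ] H) : H →ₗ[ℂ] H) * ((y : H →L[ℂ] H) : H →ₗ[ℂ] H)) = _ * LinearMap.trace ℂ H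
      (((y : H →L[ℂ] H) : H →ₗ[ℂ] H) * ((x : H →L[ℂ] H) : H →ₗ[ℂ] H))
    rw [LinearMap.trace_mul_comm]
  · intro x
    rw [key]
    exact ⟨Complex.ofReal_im _, by rw [Complex.ofReal_re]; positivity⟩
  · intro x hx
    rw [key, Complex.ofReal_eq_zero, mul_eq_zero, inv_eq_zero] at hx
    have hs := hx.resolve_left hd.ne'
    rw [Finset.sum_eq_zero_iff_of_nonneg fun i _ => by positivity] at hs
    refine Subtype.ext (ContinuousLinearMap.coe_injective ?_)
    refine (stdOrthonormalBasis ℂ H).toBasis.ext fun i => ?_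
    have := hs i (Finset.mem_univ i)
    simpa using this

/-- The von Neumann algebraic form `(B(H), τ, A)` of an ME strategy. -/
def MEStrategy.toTracial [Nontrivial H] (S : MEStrategy X 𝒜 H) : TracialStrategy X 𝒜 H where
  alg := fullAlgebra H
  trace := normalizedTrace H
  isTracialState := isTracialState_normalizedTrace
  A x a := ⟨S.A x a, trivial⟩
  povm := S.povm

variable {ι : Type*} [Fintype ι]

/-- The maximally entangled state `∑ i, d^{-1/2} |u i⟩ ⊗ |u i⟩`, where `d = dim H`. -/
def maxEntangled (u : OrthonormalBasis ι ℂ H) : H ⊗[ℂ] H :=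
  ((√(Module.finrank ℂ H : ℝ))⁻¹ : ℂ) • ∑ i, u i ⊗ₜ[ℂ] u i

theorem norm_maxEntangled [Nontrivial H] (u : OrthonormalBasis ι ℂ H) : ‖maxEntangled u‖ = 1 := by
  classical
  have hd : (0 : ℝ) < Module.finrank ℂ H := by exact_mod_cast Module.finrank_pos
  have hc : Fintype.card ι = Module.finrank ℂ H :=
    (Module.finrank_eq_card_basis u.toBasis).symm
  have h : ‖∑ i, u i ⊗ₜ[ℂ] u i‖ ^ 2 = (Module.finrank ℂ H : ℝ) := by
    have : inner ℂ (∑ i, u i ⊗ₜ[ℂ] u i) (∑ i, u i ⊗ₜ[ℂ] u i) = (Module.finrank ℂ H : ℂ) := by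
      simp [sum_inner, inner_sum, orthonormal_iff_ite.1 u.orthonormal, hc]
    have h2 := inner_self_eq_norm_sq_to_K (𝕜 := ℂ) (∑ i, u i ⊗ₜ[ℂ] u i)
    rw [this] at h2
    have h3 : ((Module.finrank ℂ H : ℝ) : ℂ) = ((‖∑ i, u i ⊗ₜ[ℂ] u i‖ ^ 2 : ℝ) : ℂ) := by
      push_cast
      exact h2
    exact (Complex.ofReal_injective h3).symm
  have h' : ‖∑ i, u i ⊗ₜ[ℂ] u i‖ = √(Module.finrank ℂ H : ℝ) := by
    rw [← h, Real.sqrt_sq (norm_nonneg _)]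
  rw [maxEntangled, norm_smul, h', norm_inv, Complex.norm_real, Real.norm_eq_abs,
    abs_of_nonneg (Real.sqrt_nonneg _)]
  exact inv_mul_cancel₀ (Real.sqrt_pos.2 hd).ne'

open scoped Classical in
/-- The transpose of an operator with respect to an orthonormal basis. -/
def transpose (u : OrthonormalBasis ι ℂ H) (T : H →L[ℂ] H) : H →L[ℂ] H :=
  LinearMap.toContinuousLinearMap
    (Matrix.toLin u.toBasis u.toBasis
      (LinearMap.toMatrix u.toBasis u.toBasis (T : H →ₗ[ℂ] H)).transpose)

open scoped Classical ComplexOrder in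
theorem isPOVM_transpose (u : OrthonormalBasis ι ℂ H) {E : 𝒜 → (H →L[ℂ] H)} (hE : IsPOVM E) :
    IsPOVM fun a => transpose u (E a) := by
  refine ⟨fun a => ?_, ?_⟩
  · rw [← ContinuousLinearMap.isPositive_toLinearMap_iff, ← LinearMap.posSemidef_toMatrix_iff u]
    change (LinearMap.toMatrix u.toBasis u.toBasis (Matrix.toLin u.toBasis u.toBasis _)).PosSemidef
    rw [LinearMap.toMatrix_toLin]
    exact ((LinearMap.posSemidef_toMatrix_iff u).2 (hE.1 a).toLinearMap).transpose
  · refine ContinuousLinearMap.coe_injective ?_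
    have h : ∑ a, ((E a : H →L[ℂ] H) : H →ₗ[ℂ] H) = 1 := by
      rw [← ContinuousLinearMap.toLinearMap_sum, hE.2]; rfl
    rw [ContinuousLinearMap.toLinearMap_sum]
    change ∑ a, Matrix.toLin u.toBasis u.toBasis
      (LinearMap.toMatrix u.toBasis u.toBasis ((E a : H →L[ℂ] H) : H →ₗ[ℂ] H)).transpose = 1
    rw [← map_sum, ← Matrix.transpose_sum, ← map_sum, h]
    simp
    rfl

/-- The Hilbert space form `(|ψ⟩, A, Aᵀ)` on `H ⊗ H` of an ME strategy, where both the maximally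
entangled state `|ψ⟩` and the transpose are taken with respect to the orthonormal basis `u`. -/
def MEStrategy.toStrategy [Nontrivial H] (S : MEStrategy X 𝒜 H) (u : OrthonormalBasis ι ℂ H) :
    Strategy X X 𝒜 𝒜 H H where
  state := maxEntangled u
  norm_state := norm_maxEntangled u
  A := S.A
  B x a := transpose u (S.A x a)
  povm_A := S.povm
  povm_B x := isPOVM_transpose u (S.povm x)

end ME

end SelfTesting

end

open scoped TensorProduct

set_option linter.unusedSectionVars false

noncomputable section

namespace SelfTesting

/-! Both kinds of dilation are statements about one matrix. In orthonormal bases the maximally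
entangled vector has coefficient matrix `d^{-1/2} • 1`, so `(V_A ⊗ V_B)(A ⊗ 1)|ψ⟩` becomes `d^{-1/2}
V_A A V_Bᵀ`, while `(A' ⊗ 1)|ψ'⟩ ⊗ |aux⟩` becomes `d'^{-1/2} A' ⊗ a`, with `a` the coefficient
matrix of `aux`; norms of vectors become Hilbert–Schmidt norms (`norm_dilation_sq`). Bob's
inequality is Alice's, since `(1 ⊗ Aᵀ)|ψ⟩ = (A ⊗ 1)|ψ⟩` and the two marginals agree. On the other
side, a vNA-dilation with `M₀ = B(ℂ^κ)` amounts to a partial isometry `W` from `H' ⊗ ℂ^κ` to `H`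
with `W* A W ≈ A' ⊗ 1` and with almost full initial and final spaces, in normalised Hilbert–Schmidt
norm.

Part (a): with `c = √(d/d')`, the operators `V_A V_Bᵀ` and `c (1 ⊗ a)` are within `δ = d ε²` in
squared norm. Since `V_A`, `V_B` are isometries, the singular values of `c a` must cluster near `1`
or `0`. Keeping the singular vectors with value above `1/2` replaces `a` by a flat operator of rank
`κ` at cost `O(δ)` (`rounding`); compressing `V_A*` to the kept vectors gives an almost isometric
`Z`, and the polar part of `Z` is `W` (`exists_partialIsometry_of_close`). An embedding of `H` into
`ℓ²(ℕ; H' ⊗ ℂ^κ)` then realises `B(H)` as a corner of the amplification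
(`isVNADilation_of_partialIsometry`). The trivial choice `W = 0` settles the range `1700 ε² ≥ 1`.

Part (b): here `M₀`, `P` and `W` are abstract, and a matrix must be extracted. The corner `P Q^∞ P`
is `B(H)`, so the image `f` of a rank-one projection is a minimal projection of `Q^∞`. Hence `Q^∞ f`
is a Hilbert space, realised as the orbit of a unit vector `ξ` in the range of `f`. Its part in `H'
⊗ K ⊗ e_0` is invariant under `B(H') ⊗ 1`, so it is `H' ⊗ K₁`, and `W` acts between it and a copy of
`H` as a finite matrix. With `C = τ^∞(f)`, the traces in the definition are `C` times
Hilbert–Schmidt norms of that matrix, or bound them from above (`exists_trace_bounds`). The adjoint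
of the matrix extends to an isometry `V` by sending the complement of its range to fresh dimensions
of the auxiliary space, and `V` with its complex conjugate are the two local isometries
(`famNorm_extendIsometry_le`, `isLocalDilation_of_partialIsometry`). -/

open Matrix
open scoped Kronecker ComplexOrder InnerProduct

/-! ### The Hilbert–Schmidt norm of a matrix -/

section HilbertSchmidt

variable {l m n p q : Type*} [Fintype l] [Fintype m] [Fintype n] [Fintype p] [Fintype q]

/-- The square of the Hilbert–Schmidt norm. -/
def hs (M : Matrix m n ℂ) : ℝ := ∑ i, ∑ j, ‖M i j‖ ^ 2

theorem hs_nonneg (M : Matrix m n ℂ) : 0 ≤ hs M := by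
  unfold hs; positivity

theorem hs_zero : hs (0 : Matrix m n ℂ) = 0 := by simp [hs]

theorem hs_conjTranspose (M : Matrix m n ℂ) : hs Mᴴ = hs M := by
  unfold hs
  rw [Finset.sum_comm]
  simp

theorem hs_neg (M : Matrix m n ℂ) : hs (-M) = hs M := by simp [hs]

theorem hs_sub_comm (M N : Matrix m n ℂ) : hs (M - N) = hs (N - M) := by
  rw [← hs_neg, neg_sub]

theorem hs_smul (c : ℂ) (M : Matrix m n ℂ) : hs (c • M) = ‖c‖ ^ 2 * hs M := by
  simp [hs, mul_pow, Finset.mul_sum]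

theorem hs_add_le (M N : Matrix m n ℂ) : hs (M + N) ≤ 2 * hs M + 2 * hs N := by
  simp only [hs, Finset.mul_sum, ← Finset.sum_add_distrib]
  gcongr with i _ j _
  have h := norm_add_le (M i j) (N i j)
  have h2 : ‖M i j + N i j‖ ^ 2 ≤ (‖M i j‖ + ‖N i j‖) ^ 2 := by gcongr
  rw [Matrix.add_apply]
  nlinarith [sq_nonneg (‖M i j‖ - ‖N i j‖)]

theorem hs_sub_le (M N : Matrix m n ℂ) : hs (M - N) ≤ 2 * hs M + 2 * hs N := by
  rw [sub_eq_add_neg, ← hs_neg N]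
  exact hs_add_le _ _

theorem trace_conjTranspose_mul_self (M : Matrix m n ℂ) : (Mᴴ * M).trace = (hs M : ℂ) := by
  rw [hs, Finset.sum_comm]
  simp only [Matrix.trace, Matrix.diag_apply, Matrix.mul_apply, Matrix.conjTranspose_apply]
  push_cast
  refine Finset.sum_congr rfl fun i _ => Finset.sum_congr rfl fun j _ => ?_
  rw [← Complex.conj_mul']
  rfl

theorem hs_eq_re_trace (M : Matrix m n ℂ) : hs M = (Mᴴ * M).trace.re := by
  rw [trace_conjTranspose_mul_self, Complex.ofReal_re]

theorem hs_eq_re_trace' (M : Matrix m n ℂ) : hs M = (M * Mᴴ).trace.re := by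
  rw [← hs_conjTranspose, hs_eq_re_trace, conjTranspose_conjTranspose]

theorem hs_one [DecidableEq n] : hs (1 : Matrix n n ℂ) = Fintype.card n := by
  rw [hs_eq_re_trace]; simp

theorem hs_mul_of_isometry [DecidableEq n] {V : Matrix m n ℂ} (hV : Vᴴ * V = 1)
    (M : Matrix n p ℂ) : hs (V * M) = hs M := by
  rw [hs_eq_re_trace, hs_eq_re_trace, conjTranspose_mul, Matrix.mul_assoc, ← Matrix.mul_assoc Vᴴ,
    hV, Matrix.one_mul]

theorem hs_mul_of_coisometry [DecidableEq m] {V : Matrix m n ℂ} (hV : V * Vᴴ = 1)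
    (M : Matrix p m ℂ) : hs (M * V) = hs M := by
  rw [← hs_conjTranspose, conjTranspose_mul, hs_mul_of_isometry (by simpa using hV),
    hs_conjTranspose]

/-- A quantitative form of `∑ w t • (A t)ᴴ * A t ≤ 1`. -/
theorem sum_hs_mul_le {T : Type*} [Fintype T] [DecidableEq m] {w : T → ℝ}
    {A : T → Matrix l m ℂ}
    (hA : (1 - ∑ t, (w t : ℂ) • ((A t)ᴴ * A t)).PosSemidef) (M : Matrix m n ℂ) :
    ∑ t, w t * hs (A t * M) ≤ hs M := by
  have h := (hA.conjTranspose_mul_mul_same M).trace_nonneg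
  have h2 := (Complex.le_def.1 h).1
  have h3 : (Mᴴ * (1 - ∑ t, (w t : ℂ) • ((A t)ᴴ * A t)) * M).trace
      = (hs M : ℂ) - ∑ t, (w t : ℂ) * hs (A t * M) := by
    rw [Matrix.mul_sub, Matrix.sub_mul, Matrix.trace_sub, Matrix.mul_one,
      trace_conjTranspose_mul_self, Matrix.mul_sum, Matrix.sum_mul, Matrix.trace_sum]
    congr 1
    refine Finset.sum_congr rfl fun t _ => ?_
    rw [← trace_conjTranspose_mul_self, conjTranspose_mul, Matrix.mul_smul, Matrix.smul_mul,
      Matrix.trace_smul, smul_eq_mul]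
    simp only [Matrix.mul_assoc]
  rw [h3] at h2
  have h4 : ((hs M : ℂ) - ∑ t, (w t : ℂ) * hs (A t * M)).re
      = hs M - ∑ t, w t * hs (A t * M) := by
    rw [← Complex.ofReal_re (hs M - _)]
    congr 1
    push_cast
    rfl
  rw [h4] at h2
  simpa using h2

theorem posSemidef_one_sub_of_partialIsometry [DecidableEq n] {V : Matrix m n ℂ}
    (hV : V * Vᴴ * V = V) : (1 - Vᴴ * V).PosSemidef := by
  have h : 1 - Vᴴ * V = (1 - Vᴴ * V)ᴴ * (1 - Vᴴ * V) := by
    have : Vᴴ * V * (Vᴴ * V) = Vᴴ * V := by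
      rw [Matrix.mul_assoc, ← Matrix.mul_assoc V, hV]
    simp [Matrix.mul_sub, Matrix.sub_mul, this]
  rw [h]
  exact posSemidef_conjTranspose_mul_self _

theorem hs_mul_le_of_partialIsometry {V : Matrix m n ℂ}
    (hV : V * Vᴴ * V = V) (M : Matrix n p ℂ) : hs (V * M) ≤ hs M := by
  classical
  have := sum_hs_mul_le (T := Unit) (w := fun _ => 1) (A := fun _ => V)
    (by simpa using posSemidef_one_sub_of_partialIsometry hV) M
  simpa using this

theorem partialIsometry_conjTranspose {V : Matrix m n ℂ}
    (hV : V * Vᴴ * V = V) : Vᴴ * Vᴴᴴ * Vᴴ = Vᴴ := by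
  have := congrArg conjTranspose hV
  simpa [Matrix.mul_assoc] using this

theorem mul_hs_le_of_partialIsometry {V : Matrix m n ℂ}
    (hV : V * Vᴴ * V = V) (M : Matrix p m ℂ) : hs (M * V) ≤ hs M := by
  rw [← hs_conjTranspose, conjTranspose_mul, ← hs_conjTranspose M]
  exact hs_mul_le_of_partialIsometry (partialIsometry_conjTranspose hV) _

theorem partialIsometry_of_isometry [DecidableEq n] {V : Matrix m n ℂ} (hV : Vᴴ * V = 1) :
    V * Vᴴ * V = V := by
  rw [Matrix.mul_assoc, hV, Matrix.mul_one]

theorem hs_kronecker (M : Matrix l m ℂ) (N : Matrix p q ℂ) : hs (M ⊗ₖ N) = hs M * hs N := by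
  simp only [hs, Fintype.sum_prod_type, Matrix.kroneckerMap_apply, norm_mul, mul_pow]
  rw [Finset.sum_mul_sum]
  refine Finset.sum_congr rfl fun i _ => Finset.sum_congr rfl fun j _ => ?_
  rw [Finset.sum_mul_sum]

end HilbertSchmidt

/-! ### Singular value decomposition and polar decomposition -/

section SVD

variable {m n : Type*} [Fintype m] [Fintype n] [DecidableEq n]

theorem exists_unitary_diagonal {B : Matrix n n ℂ} (hB : B.PosSemidef) :
    ∃ (U : Matrix n n ℂ) (e : n → ℝ), Uᴴ * U = 1 ∧ U * Uᴴ = 1 ∧ (∀ j, 0 ≤ e j) ∧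
      B = U * diagonal (fun j => (e j : ℂ)) * Uᴴ := by
  have hA := hB.isHermitian
  refine ⟨hA.eigenvectorUnitary, hA.eigenvalues, (Unitary.mem_iff.1 hA.eigenvectorUnitary.2).1,
    (Unitary.mem_iff.1 hA.eigenvectorUnitary.2).2, hB.eigenvalues_nonneg, ?_⟩
  have h := hA.spectral_theorem
  rw [Unitary.conjStarAlgAut_apply] at h
  exact h

/-- Diagonalise `aᴴ * a` and normalise the columns of `a * U`. Columns with singular value `0` stay
zero, so `F` is only a partial isometry; this lets `m` and `n` have different sizes. -/
theorem exists_svd (a : Matrix m n ℂ) :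
    ∃ (U : Matrix n n ℂ) (s : n → ℝ) (F : Matrix m n ℂ), Uᴴ * U = 1 ∧ U * Uᴴ = 1 ∧
      (∀ j, 0 ≤ s j) ∧ Fᴴ * F = diagonal (fun j => if s j = 0 then 0 else 1) ∧
      a * U = F * diagonal (fun j => (s j : ℂ)) := by
  obtain ⟨U, e, hU1, hU2, hpos, h⟩ :=
    exists_unitary_diagonal (posSemidef_conjTranspose_mul_self a)
  have hdiag : (a * U)ᴴ * (a * U) = diagonal (fun j => (e j : ℂ)) := by
    calc (a * U)ᴴ * (a * U) = Uᴴ * (aᴴ * a) * U := by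
          rw [conjTranspose_mul]; simp only [Matrix.mul_assoc]
      _ = (Uᴴ * U) * diagonal (fun j => (e j : ℂ)) * (Uᴴ * U) := by
          rw [h]; simp only [Matrix.mul_assoc]
      _ = _ := by rw [hU1, Matrix.one_mul, Matrix.mul_one]
  set s : n → ℝ := fun j => √(e j) with hs
  have hs2 : ∀ j, (e j : ℂ) = (s j : ℂ) * s j := fun j => by
    rw [← Complex.ofReal_mul, Real.mul_self_sqrt (hpos j)]
  refine ⟨U, s, a * U * diagonal (fun j => ((s j)⁻¹ : ℂ)), hU1, hU2,
    fun j => Real.sqrt_nonneg _, ?_, ?_⟩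
  · rw [conjTranspose_mul, Matrix.mul_assoc, ← Matrix.mul_assoc (a * U)ᴴ, hdiag,
      diagonal_conjTranspose, diagonal_mul_diagonal, diagonal_mul_diagonal]
    congr 1
    ext j
    simp only [hs2, Pi.star_apply, star_inv₀, Complex.star_def, Complex.conj_ofReal]
    by_cases h : s j = 0
    · simp [h]
    · have : (s j : ℂ) ≠ 0 := by exact_mod_cast h
      simp only [h, if_false]
      field_simp
  · rw [Matrix.mul_assoc, diagonal_mul_diagonal]
    ext i j
    rw [mul_diagonal]
    by_cases h : s j = 0
    · have h0 := congrFun (congrFun hdiag j) j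
      rw [diagonal_apply_eq, hs2, h, Matrix.mul_apply] at h0
      -- A vanishing singular value forces its column of `a * U` to vanish, so the default `0⁻¹ = 0`
      -- does no harm.
      have h1 : ∑ i, ‖(a * U) i j‖ ^ 2 = 0 := by
        have : ((∑ i, ‖(a * U) i j‖ ^ 2 : ℝ) : ℂ) = 0 := by
          push_cast
          simp only [← Complex.conj_mul']
          simpa using h0
        exact_mod_cast this
      have h2 := (Finset.sum_eq_zero_iff_of_nonneg (fun i _ => by positivity)).1 h1 i
        (Finset.mem_univ i)
      have h3 : (a * U) i j = 0 := by simpa using h2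
      rw [h3]; simp
    · have : (s j : ℂ) ≠ 0 := by exact_mod_cast h
      rw [inv_mul_cancel₀ this, mul_one]

/-- The Gram matrix of `F * (1 - Fᴴ * F)` vanishes because `Fᴴ * F` is a projection. -/
theorem partialIsometry_of_conjTranspose_mul {F : Matrix m n ℂ} {s : n → ℝ}
    (h : Fᴴ * F = diagonal (fun j => if s j = 0 then 0 else 1)) : F * Fᴴ * F = F := by
  have hz : F * (1 - Fᴴ * F) = 0 := by
    rw [← Matrix.conjTranspose_mul_self_eq_zero]
    rw [conjTranspose_mul, Matrix.mul_assoc, ← Matrix.mul_assoc Fᴴ, h, ← diagonal_one,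
      diagonal_sub, diagonal_mul_diagonal]
    rw [diagonal_conjTranspose, diagonal_mul_diagonal]
    ext i j
    rw [diagonal_apply]
    split_ifs <;> simp_all
  rw [Matrix.mul_sub, Matrix.mul_one, sub_eq_zero] at hz
  rw [Matrix.mul_assoc, ← hz]

/-- The partial isometry in the polar decomposition of a contraction is close to it. -/
theorem exists_partialIsometry_near (Z : Matrix m n ℂ)
    (hZ : ∀ M : Matrix n Unit ℂ, hs (Z * M) ≤ hs M) :
    ∃ W : Matrix m n ℂ, W * Wᴴ * W = W ∧ hs (W - Z) ≤ Fintype.card n - hs Z ∧ hs Z ≤ hs W := by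
  obtain ⟨U, s, F, hU1, hU2, hs0, hF, hZU⟩ := exists_svd Z
  have hFp := partialIsometry_of_conjTranspose_mul hF
  have hs1 : ∀ j, s j ^ 2 ≤ 1 := by
    -- Test the contraction `Z` on the `j`-th right singular vector.
    intro j
    have h := hZ (U * (Matrix.of fun i _ => if i = j then 1 else 0 : Matrix n Unit ℂ))
    rw [hs_mul_of_isometry hU1, ← Matrix.mul_assoc, hZU, hs_eq_re_trace, conjTranspose_mul,
      conjTranspose_mul, Matrix.mul_assoc, Matrix.mul_assoc, Matrix.mul_assoc F, ← Matrix.mul_assoc Fᴴ, hF] at h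
    by_cases hj : s j = 0
    · simp [hj]
    · simpa [hs, Matrix.trace, Matrix.mul_apply, diagonal_apply, Finset.sum_ite_eq, hj, ← sq,
        ← Complex.ofReal_pow, apply_ite] using h
  have hhs : ∀ t : n → ℝ, hs (F * (diagonal fun j => (t j : ℂ) : Matrix n n ℂ))
      = ∑ j, if s j = 0 then 0 else t j ^ 2 := by
    intro t
    rw [hs_eq_re_trace, conjTranspose_mul, Matrix.mul_assoc, ← Matrix.mul_assoc Fᴴ, hF,
      diagonal_mul_diagonal, diagonal_conjTranspose, diagonal_mul_diagonal, trace_diagonal,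
      Complex.re_sum]
    refine Finset.sum_congr rfl fun j _ => ?_
    split_ifs <;> simp [sq]
  have hZs : hs Z = ∑ j, if s j = 0 then 0 else s j ^ 2 := by
    rw [← hs_mul_of_coisometry hU2, hZU, hhs]
  have hUU : Uᴴ * Uᴴᴴ = 1 := by simpa using hU1
  have hone : F = F * (diagonal fun _ => ((1 : ℝ) : ℂ) : Matrix n n ℂ) := by
    simp
  refine ⟨F * Uᴴ, ?_, ?_, ?_⟩
  · rw [conjTranspose_mul, conjTranspose_conjTranspose]
    calc F * Uᴴ * (U * Fᴴ) * (F * Uᴴ) = F * (Uᴴ * U) * Fᴴ * F * Uᴴ := by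
          simp only [Matrix.mul_assoc]
      _ = F * Uᴴ := by rw [hU1, Matrix.mul_one, hFp]
  · rw [← hs_mul_of_coisometry hU2, Matrix.sub_mul, hZU, Matrix.mul_assoc, hU1, Matrix.mul_one]
    have : F - F * (diagonal fun j => (s j : ℂ) : Matrix n n ℂ)
        = F * (diagonal fun j => ((1 - s j : ℝ) : ℂ) : Matrix n n ℂ) := by
      ext i j
      simp [mul_diagonal, mul_sub]
    rw [this, hhs, hZs]
    have : (Fintype.card n : ℝ) = ∑ _j : n, (1 : ℝ) := by simp
    rw [this, ← Finset.sum_sub_distrib]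
    -- `(1 - s)² ≤ 1 - s²` for `0 ≤ s ≤ 1`; a zero singular value contributes `0` on the left and
    -- `1` on the right.
    refine Finset.sum_le_sum fun j _ => ?_
    have h1 := hs1 j
    have h0 := hs0 j
    have h2 : s j ≤ 1 := by nlinarith
    split_ifs
    · norm_num
    · nlinarith
  · rw [hs_mul_of_coisometry hUU, hZs, hone, hhs]
    refine Finset.sum_le_sum fun j _ => ?_
    split_ifs
    · rfl
    · simpa using hs1 j

end SVD

/-! ### Rounding: an isometry close to a diagonal operator is close to a flat one -/

section Rounding

/-- The square of the norm of a column. -/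
def colSq {m n : Type*} [Fintype m] (M : Matrix m n ℂ) (l : n) : ℝ := ∑ i, ‖M i l‖ ^ 2

variable {ι p q m n L κ : Type*} [Fintype ι] [Fintype p] [Fintype q] [Fintype m] [Fintype n]
  [Fintype L] [Fintype κ]

theorem colSq_nonneg (M : Matrix m n ℂ) (l : n) : 0 ≤ colSq M l := by
  unfold colSq; positivity

/-- Here `x = ‖R_l‖²`, `y = ‖Z_l‖²` and `g = Re ⟨Z_l, R_l⟩` for columns of two contractions. The
right side minus `x` is `(x + 4s² - 4sg) + (x + y - 4sg)`: the first bracket is nonnegative by `‖R_l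
- 2s Z_l‖² ≥ 0` and `y ≤ 1`, the second by `‖R_l - Z_l‖² ≥ 0` and `2s ≤ 1`. -/
theorem colSq_le_of_small {s x y g : ℝ} (hs : 0 ≤ s) (hs2 : s ≤ 1 / 2) (hx : 0 ≤ x) (hy : 0 ≤ y)
    (hy1 : y ≤ 1) (h1 : 0 ≤ x - 2 * 1 * g + 1 ^ 2 * y)
    (h2 : 0 ≤ x - 2 * (2 * s) * g + (2 * s) ^ 2 * y) :
    x ≤ 2 * (x - 2 * s * g + s ^ 2) + ((x - 2 * s * g + s ^ 2) + (y - 2 * s * g + s ^ 2)) := by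
  have h3 : s ^ 2 * y ≤ s ^ 2 := mul_le_of_le_one_right (sq_nonneg s) hy1
  have h4 : 4 * s * g ≤ x + y := by
    rcases le_total 0 g with h | h
    · nlinarith
    · nlinarith [mul_nonneg hs (neg_nonneg.2 h)]
  nlinarith

theorem hs_eq_sum_colSq (M : Matrix m n ℂ) : hs M = ∑ l, colSq M l := Finset.sum_comm

theorem colSq_eq_hs (M : Matrix m n ℂ) (l : n) :
    colSq M l = hs (M.submatrix id (fun _ : Unit => l)) := by
  simp [colSq, hs]

theorem colSq_eq_re (M : Matrix m n ℂ) (l : n) : colSq M l = ((Mᴴ * M) l l).re := by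
  simp only [colSq, Matrix.mul_apply, Matrix.conjTranspose_apply, Complex.re_sum]
  refine Finset.sum_congr rfl fun i _ => ?_
  rw [Complex.star_def, Complex.conj_mul', ← Complex.ofReal_pow, Complex.ofReal_re]

theorem colSq_mul_le_of_partialIsometry {V : Matrix m n ℂ} (hV : V * Vᴴ * V = V)
    (M : Matrix n L ℂ) (l : L) : colSq (V * M) l ≤ colSq M l := by
  rw [colSq_eq_hs, colSq_eq_hs]
  exact hs_mul_le_of_partialIsometry hV (M.submatrix id fun _ : Unit => l)

theorem colSq_sub_smul (R Z : Matrix m n ℂ) (l : n) (t : ℝ) :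
    colSq R l - 2 * t * ((Zᴴ * R) l l).re + t ^ 2 * colSq Z l
      = ∑ i, ‖R i l - t * Z i l‖ ^ 2 := by
  simp only [colSq, Matrix.mul_apply, Matrix.conjTranspose_apply, Complex.re_sum, Finset.mul_sum,
    ← Finset.sum_sub_distrib, ← Finset.sum_add_distrib]
  refine Finset.sum_congr rfl fun i _ => ?_
  simp only [Complex.sq_norm, Complex.normSq_apply, Complex.sub_re, Complex.sub_im,
    Complex.mul_re, Complex.mul_im, Complex.ofReal_re, Complex.ofReal_im, Complex.star_def,
    Complex.conj_re, Complex.conj_im]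
  ring

theorem sum_comp_eq_sum_ite {e : κ → L} (he : Function.Injective e) (P : L → Prop)
    [DecidablePred P] (hP : ∀ l, l ∈ Set.range e ↔ P l) (f : L → ℝ) :
    ∑ k, f (e k) = ∑ l, if P l then f l else 0 := by
  classical
  rw [← Finset.sum_filter, ← Finset.sum_image (s := Finset.univ) (g := e) (f := f)
    (fun x _ y _ h => he h)]
  refine Finset.sum_congr ?_ fun _ _ => rfl
  ext l
  simp [← hP, Set.mem_range]

variable [DecidableEq ι] [DecidableEq L]

/-- The hypothesis `hδ` is read twice, by columns after multiplying by `T` and by rows after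
multiplying by `Gᴴ`. With `Z = VAᴴ * G` and `R = VBᵀ * T`, this bounds by `δ` each of the sums over
`l` of `c l = ‖R_l‖² - 2 σ_l g_l + σ_l²` and `r l = ‖Z_l‖² - 2 σ_l g_l + σ_l²`. All four conclusions
follow from pointwise bounds by `c` and `r`, because `R_l` and `Z_l` have norm at most `1`. -/
theorem rounding {VA : Matrix p ι ℂ} {VB : Matrix q ι ℂ} (hVA : VAᴴ * VA = 1) (hVB : VBᴴ * VB = 1)
    {G : Matrix p L ℂ} {T : Matrix q L ℂ} {σ : L → ℝ} {S : Matrix p q ℂ} [DecidableEq q]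
    (hG : Gᴴ * G = diagonal (fun l => if σ l = 0 then 0 else 1))
    (hT : Tᴴ * T = 1) (hT' : T * Tᴴ = 1) (hσ : ∀ l, 0 ≤ σ l)
    (hS : S * T = G * diagonal (fun l => (σ l : ℂ))) {δ : ℝ}
    (hδ : hs (VA * VBᵀ - S) ≤ δ) {e : κ → L} (he : Function.Injective e)
    (heσ : ∀ l, l ∈ Set.range e ↔ 1 / 2 < σ l) :
    hs ((VAᴴ * G).submatrix id e - (VBᵀ * T).submatrix id e) ≤ 2 * δ ∧
    ∑ k, (1 - σ (e k)) ^ 2 ≤ δ ∧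
    (Fintype.card κ : ℝ) - hs ((VAᴴ * G).submatrix id e) ≤ 4 * δ ∧
    (Fintype.card ι : ℝ) ≤ Fintype.card κ + 4 * δ := by
  set Z := VAᴴ * G with hZ
  set R := VBᵀ * T with hR
  set D : Matrix L L ℂ := diagonal (fun l => (σ l : ℂ)) with hD
  have hDD : Dᴴ = D := by
    rw [hD, diagonal_conjTranspose]
    congr 1
    ext l
    simp
  have hVBt : VBᵀ * VBᵀᴴ = 1 := by
    have := congrArg Matrix.transpose hVB
    rw [transpose_mul, transpose_one] at this
    exact this
  have hGD : Gᴴ * G * D = D := by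
    rw [hG, hD, diagonal_mul_diagonal]
    congr 1
    ext l
    by_cases h : σ l = 0 <;> simp [h]
  have hZt : Zᴴ = Gᴴ * VA := by rw [hZ, conjTranspose_mul, conjTranspose_conjTranspose]
  have hRt : Rᴴ = Tᴴ * VBᵀᴴ := by rw [hR, conjTranspose_mul]
  let g : L → ℝ := fun l => ((Zᴴ * R) l l).re
  -- `c l` is the squared norm of column `l` of `VA * R - G * D`, and `r l` that of row `l` of `Zᴴ *
  -- VBᵀ - D * Tᴴ`.
  let c : L → ℝ := fun l => colSq R l - 2 * σ l * g l + σ l ^ 2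
  let r : L → ℝ := fun l => colSq Z l - 2 * σ l * g l + σ l ^ 2
  have hgD : ∀ l, ((D * (Zᴴ * R)) l l).re = σ l * g l := fun l => by
    rw [hD, diagonal_mul, Complex.re_ofReal_mul]
  have hgD' : ∀ l, ((Rᴴ * Z * D) l l).re = σ l * g l := fun l => by
    rw [hD, mul_diagonal, mul_comm, Complex.re_ofReal_mul]
    congr 1
    have : Rᴴ * Z = (Zᴴ * R)ᴴ := by simp
    rw [this, conjTranspose_apply]
    simp [g]
  have hc : ∑ l, c l ≤ δ := by
    have h1 : (VA * VBᵀ - S) * T = VA * R - G * D := by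
      rw [Matrix.sub_mul, hS, hR, Matrix.mul_assoc]
    have h2 : (VA * R - G * D)ᴴ * (VA * R - G * D)
        = Rᴴ * R - Rᴴ * Z * D - D * (Zᴴ * R) + D * D := by
      rw [conjTranspose_sub, conjTranspose_mul VA R, conjTranspose_mul G D, hDD, Matrix.sub_mul,
        Matrix.mul_sub, Matrix.mul_sub]
      have e1 : Rᴴ * VAᴴ * (VA * R) = Rᴴ * R := by
        rw [Matrix.mul_assoc, ← Matrix.mul_assoc VAᴴ, hVA, Matrix.one_mul]
      have e2 : D * Gᴴ * (G * D) = D * D := by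
        rw [Matrix.mul_assoc, ← Matrix.mul_assoc Gᴴ, hGD]
      rw [e1, e2, hZt, hZ]
      simp only [Matrix.mul_assoc]
      abel
    rw [← hs_mul_of_coisometry hT', h1, hs_eq_re_trace, h2] at hδ
    refine le_trans (le_of_eq ?_) hδ
    rw [Matrix.trace, Complex.re_sum]
    refine Finset.sum_congr rfl fun l _ => ?_
    simp only [Matrix.diag_apply, Matrix.add_apply, Matrix.sub_apply, Complex.add_re,
      Complex.sub_re, hgD, hgD', ← colSq_eq_re]
    have : ((D * D) l l).re = σ l ^ 2 := by
      rw [hD, diagonal_mul_diagonal, diagonal_apply_eq, ← Complex.ofReal_mul, Complex.ofReal_re, sq]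
    rw [this]
    simp only [c]
    ring
  have hr : ∑ l, r l ≤ δ := by
    have h1 : Gᴴ * (VA * VBᵀ - S) = Zᴴ * VBᵀ - D * Tᴴ := by
      have : S = G * D * Tᴴ := by rw [← hS, Matrix.mul_assoc, hT', Matrix.mul_one]
      rw [Matrix.mul_sub, hZt, Matrix.mul_assoc, this, ← Matrix.mul_assoc Gᴴ (G * D),
        ← Matrix.mul_assoc Gᴴ G, hGD]
    have h2 : (Zᴴ * VBᵀ - D * Tᴴ) * (Zᴴ * VBᵀ - D * Tᴴ)ᴴ
        = Zᴴ * Z - Zᴴ * R * D - D * (Rᴴ * Z) + D * D := by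
      rw [conjTranspose_sub, conjTranspose_mul Zᴴ, conjTranspose_mul D, hDD,
        conjTranspose_conjTranspose, conjTranspose_conjTranspose, Matrix.sub_mul, Matrix.mul_sub,
        Matrix.mul_sub]
      have e1 : Zᴴ * VBᵀ * (VBᵀᴴ * Z) = Zᴴ * Z := by
        rw [Matrix.mul_assoc, ← Matrix.mul_assoc VBᵀ, hVBt, Matrix.one_mul]
      have e2 : D * Tᴴ * (T * D) = D * D := by
        rw [Matrix.mul_assoc, ← Matrix.mul_assoc Tᴴ, hT, Matrix.one_mul]
      rw [e1, e2, hRt, hR]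
      simp only [Matrix.mul_assoc]
      abel
    have hGp : Gᴴ * Gᴴᴴ * Gᴴ = Gᴴ :=
      partialIsometry_conjTranspose (partialIsometry_of_conjTranspose_mul hG)
    have h3 := (hs_mul_le_of_partialIsometry hGp (VA * VBᵀ - S)).trans hδ
    rw [h1, hs_eq_re_trace', h2] at h3
    refine le_trans (le_of_eq ?_) h3
    rw [Matrix.trace, Complex.re_sum]
    refine Finset.sum_congr rfl fun l _ => ?_
    have e1 : ((Zᴴ * R * D) l l).re = σ l * g l := by
      rw [hD, mul_diagonal, mul_comm, Complex.re_ofReal_mul]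
    have e2 : ((D * (Rᴴ * Z)) l l).re = σ l * g l := by
      rw [← hgD', hD, mul_diagonal, diagonal_mul, mul_comm]
    simp only [Matrix.diag_apply, Matrix.add_apply, Matrix.sub_apply, Complex.add_re,
      Complex.sub_re, e1, e2, ← colSq_eq_re]
    have : ((D * D) l l).re = σ l ^ 2 := by
      rw [hD, diagonal_mul_diagonal, diagonal_apply_eq, ← Complex.ofReal_mul, Complex.ofReal_re, sq]
    rw [this]
    simp only [r]
    ring
  have hp1 : ∀ l, colSq R l ≤ 1 := fun l => by
    have hVp : VBᵀ * VBᵀᴴ * VBᵀ = VBᵀ := by rw [hVBt, Matrix.one_mul]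
    refine (colSq_mul_le_of_partialIsometry hVp T l).trans (le_of_eq ?_)
    rw [colSq_eq_re, hT]; simp
  have hp2 : ∀ l, colSq Z l ≤ 1 := fun l => by
    have hVp := partialIsometry_conjTranspose (partialIsometry_of_isometry hVA)
    refine (colSq_mul_le_of_partialIsometry hVp G l).trans ?_
    rw [colSq_eq_re, hG, diagonal_apply_eq]; split_ifs <;> simp
  have hQ : ∀ l (t : ℝ), 0 ≤ colSq R l - 2 * t * g l + t ^ 2 * colSq Z l := fun l t => by
    rw [colSq_sub_smul]; positivity
  have hc0 : ∀ l, 0 ≤ c l := fun l => by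
    have h1 := hQ l (σ l)
    have h2 := mul_le_of_le_one_right (sq_nonneg (σ l)) (hp2 l)
    simp only [c]
    linarith
  have hr0 : ∀ l, 0 ≤ r l := fun l => by
    by_cases h : σ l = 0
    · simp only [r, h]; have : 0 ≤ colSq Z l := by unfold colSq; positivity
      simpa using this
    · have hs := (lt_of_le_of_ne (hσ l) (Ne.symm h))
      -- This is `‖σ R_l - Z_l‖² ≥ 0` after multiplication by `σ²`.
      have h1 := hQ l (σ l)⁻¹
      have h2 : 0 ≤ σ l ^ 2 * (colSq R l - 2 * (σ l)⁻¹ * g l + (σ l)⁻¹ ^ 2 * colSq Z l) := by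
        positivity
      have h3 : σ l ^ 2 * (colSq R l - 2 * (σ l)⁻¹ * g l + (σ l)⁻¹ ^ 2 * colSq Z l)
          = σ l ^ 2 * colSq R l - 2 * σ l * g l + colSq Z l := by field_simp
      have h4 := mul_le_of_le_one_right (sq_nonneg (σ l)) (hp1 l)
      simp only [r]
      linarith
  have hcr : ∑ l, (c l + r l) ≤ 2 * δ := by rw [Finset.sum_add_distrib]; linarith
  have key : ∀ (f h : L → ℝ), (∀ l, 0 ≤ h l) → (∀ l, 1 / 2 < σ l → f l ≤ h l) →
      ∑ k, f (e k) ≤ ∑ l, h l := fun f h h0 hfh => by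
    rw [sum_comp_eq_sum_ite he _ heσ]
    refine Finset.sum_le_sum fun l _ => ?_
    split_ifs with hl
    exacts [hfh l hl, h0 l]
  refine ⟨?_, ?_, ?_, ?_⟩
  · have : hs (Z.submatrix id e - R.submatrix id e)
        = ∑ k, (fun l => colSq R l - 2 * 1 * g l + 1 ^ 2 * colSq Z l) (e k) := by
      rw [hs_sub_comm, hs_eq_sum_colSq]
      refine Finset.sum_congr rfl fun k _ => ?_
      simp only
      rw [colSq_sub_smul R Z (e k) 1]
      simp [colSq]
    rw [this]
    refine (key (fun l => colSq R l - 2 * 1 * g l + 1 ^ 2 * colSq Z l) (fun l => c l + r l)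
      (fun l => add_nonneg (hc0 l) (hr0 l))
      fun l hl => ?_).trans hcr
    simp only [c, r]
    -- `c + r - ‖R_l - Z_l‖² = 2σ² - 2g(2σ - 1) ≥ 2(1 - σ)²`, because `g ≤ 1` and `2σ > 1`. The same
    -- computation gives the second conclusion.
    nlinarith [hQ l 1, hp1 l, hp2 l, sq_nonneg (1 - σ l)]
  · have : ∑ k, (2 * (1 - σ (e k)) ^ 2) ≤ 2 * δ := by
      refine (key (fun l => 2 * (1 - σ l) ^ 2) (fun l => c l + r l)
        (fun l => add_nonneg (hc0 l) (hr0 l)) fun l hl => ?_).trans hcr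
      simp only [c, r]
      nlinarith [hQ l 1, hp1 l, hp2 l, sq_nonneg (1 - σ l)]
    rw [← Finset.mul_sum] at this
    linarith
  · have : (Fintype.card κ : ℝ) - hs (Z.submatrix id e) = ∑ k, (fun l => 1 - colSq Z l) (e k) := by
      rw [Finset.sum_sub_distrib, hs_eq_sum_colSq]
      simp [colSq]
    rw [this]
    refine (key (fun l => 1 - colSq Z l) (fun l => 4 * c l)
      (fun l => mul_nonneg (by norm_num) (hc0 l))
      fun l hl => ?_).trans (by rw [← Finset.mul_sum]; linarith)
    have h1 := hQ l (σ l)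
    have h2 := hp2 l
    -- `‖R_l - σ Z_l‖² ≥ 0` gives `c ≥ σ² (1 - ‖Z_l‖²)`, and `σ² ≥ 1/4` produces the factor `4`.
    have h3 : (1 : ℝ) / 4 ≤ σ l ^ 2 := by nlinarith
    simp only [c]
    nlinarith
  · have hd : (Fintype.card ι : ℝ) = ∑ l, colSq R l := by
      rw [← hs_eq_sum_colSq, hR, hs_mul_of_coisometry hT', ← hs_one (n := ι), hs_eq_re_trace',
        hs_eq_re_trace', hVBt, conjTranspose_one, Matrix.mul_one]
    have hk : (Fintype.card κ : ℝ) = ∑ l, if 1 / 2 < σ l then 1 else 0 := by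
      rw [← sum_comp_eq_sum_ite he _ heσ (fun _ => 1)]; simp
    rw [hd, hk]
    -- A kept column has norm at most `1`; a discarded one has `σ ≤ 1/2` and is paid for by `2c + (c
    -- + r)`, in total at most `4δ`.
    calc ∑ l, colSq R l ≤ ∑ l, ((if 1 / 2 < σ l then (1 : ℝ) else 0) + (2 * c l + (c l + r l))) := by
          refine Finset.sum_le_sum fun l _ => ?_
          have h1 := hc0 l
          have h2 := hr0 l
          split_ifs with hl
          · have := hp1 l; linarith
          · have h3 := colSq_le_of_small (hσ l) (not_lt.1 hl) (colSq_nonneg R l) (colSq_nonneg Z l)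
              (hp2 l) (hQ l 1) (hQ l (2 * σ l))
            simp only [c, r]
            linarith
      _ ≤ _ := by
          rw [Finset.sum_add_distrib, Finset.sum_add_distrib, ← Finset.mul_sum]
          linarith

end Rounding

/-- The factor `1 ⊗ a` has singular vectors that are products, so the kept ones span `ℂ^ι' ⊗ ℂ^κ`
and the tensor structure `A' ⊗ 1` survives the rounding. `W` is the polar part of the compression
`Z` of `VAᴴ` to the kept left vectors. Passing from `A' ⊗ 1` to `Wᴴ A W` goes through `A' ⊗ D`, `Zᴴ
A R` and `Zᴴ A W`, where `D` is the diagonal matrix of kept singular values. -/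
theorem exists_partialIsometry_of_close {ι ι' m T : Type*} {n : Type} [Fintype ι] [Fintype ι']
    [Fintype m] [Fintype n] [Fintype T] [DecidableEq ι] [DecidableEq ι'] [DecidableEq n]
    [Nonempty ι] [Nonempty ι']
    {VA : Matrix (ι' × m) ι ℂ} {VB : Matrix (ι' × n) ι ℂ} (hVA : VAᴴ * VA = 1)
    (hVB : VBᴴ * VB = 1) {a : Matrix m n ℂ} {w : T → ℝ} (hw : ∀ t, 0 ≤ w t)
    {A : T → Matrix ι ι ℂ} {A' : T → Matrix ι' ι' ℂ} (hAh : ∀ t, (A t).IsHermitian)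
    (hA : (1 - ∑ t, (w t : ℂ) • ((A t)ᴴ * A t)).PosSemidef)
    (hA' : (1 - ∑ t, (w t : ℂ) • ((A' t)ᴴ * A' t)).PosSemidef)
    {c δ : ℝ} (hc : 0 < c) (hδ : 4 * δ < Fintype.card ι)
    (h0 : hs (VA * VBᵀ - (c : ℂ) • ((1 : Matrix ι' ι' ℂ) ⊗ₖ a)) ≤ δ)
    (h1 : ∑ t, w t * hs (VA * A t * VBᵀ - (c : ℂ) • (A' t ⊗ₖ a)) ≤ δ) :
    ∃ (κ : Type) (_ : Fintype κ) (_ : DecidableEq κ) (_ : Nonempty κ)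
      (W : Matrix ι (ι' × κ) ℂ), W * Wᴴ * W = W ∧
      ∑ t, w t * hs (A' t ⊗ₖ (1 : Matrix κ κ ℂ) - Wᴴ * A t * W) ≤ 72 * δ ∧
      Fintype.card ι - hs W ≤ 8 * δ ∧
      (Fintype.card ι' * Fintype.card κ : ℝ) - hs W ≤ 4 * δ ∧
      (Fintype.card ι : ℝ) ≤ Fintype.card ι' * Fintype.card κ + 4 * δ := by
  obtain ⟨U, s, F, hU1, hU2, hs0, hF, haU⟩ := exists_svd a
  let κ := {j : n // 1 / 2 < c * s j}
  let G : Matrix (ι' × m) (ι' × n) ℂ := (1 : Matrix ι' ι' ℂ) ⊗ₖ F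
  let T' : Matrix (ι' × n) (ι' × n) ℂ := (1 : Matrix ι' ι' ℂ) ⊗ₖ U
  let σ : ι' × n → ℝ := fun l => c * s l.2
  let e : ι' × κ → ι' × n := Prod.map id Subtype.val
  have hG : Gᴴ * G = diagonal (fun l => if σ l = 0 then 0 else 1) := by
    have h : Gᴴ * G = (1 : Matrix ι' ι' ℂ) ⊗ₖ (Fᴴ * F) := by
      simp only [G, conjTranspose_kronecker, conjTranspose_one, ← mul_kronecker_mul, Matrix.mul_one]
    rw [h, hF, ← diagonal_one, diagonal_kronecker_diagonal]
    congr 1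
    ext l
    simp [σ, hc.ne']
  have hT1 : T'ᴴ * T' = 1 := by
    simp only [T', conjTranspose_kronecker, conjTranspose_one, ← mul_kronecker_mul, Matrix.mul_one,
      hU1, one_kronecker_one]
  have hT2 : T' * T'ᴴ = 1 := by
    simp only [T', conjTranspose_kronecker, conjTranspose_one, ← mul_kronecker_mul, Matrix.mul_one,
      hU2, one_kronecker_one]
  have hS : ((c : ℂ) • ((1 : Matrix ι' ι' ℂ) ⊗ₖ a)) * T' = G * diagonal (fun l => (σ l : ℂ)) := by
    have : diagonal (fun l => (σ l : ℂ))
        = (c : ℂ) • ((1 : Matrix ι' ι' ℂ) ⊗ₖ diagonal (fun j => (s j : ℂ))) := by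
      rw [← diagonal_one, diagonal_kronecker_diagonal, ← diagonal_smul]
      congr 1
      ext l
      simp [σ]
    rw [this, Matrix.mul_smul, Matrix.smul_mul, ← mul_kronecker_mul, ← mul_kronecker_mul, haU,
      Matrix.one_mul]
  have he : Function.Injective e := Function.injective_id.prodMap Subtype.val_injective
  have heσ : ∀ l, l ∈ Set.range e ↔ 1 / 2 < σ l := by
    rintro ⟨i, j⟩
    constructor
    · rintro ⟨⟨i', j'⟩, h⟩
      cases h
      exact j'.2
    · intro h
      exact ⟨(i, ⟨j, h⟩), rfl⟩
  obtain ⟨r1, r2, r3, r4⟩ := rounding hVA hVB hG hT1 hT2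
    (fun l => mul_nonneg hc.le (hs0 l.2)) hS h0 he heσ
  set Z := (VAᴴ * G).submatrix id e with hZ
  set R := (VBᵀ * T').submatrix id e with hR
  let FJ : Matrix m κ ℂ := F.submatrix id Subtype.val
  let UJ : Matrix n κ ℂ := U.submatrix id Subtype.val
  let GJ : Matrix (ι' × m) (ι' × κ) ℂ := (1 : Matrix ι' ι' ℂ) ⊗ₖ FJ
  let TJ : Matrix (ι' × n) (ι' × κ) ℂ := (1 : Matrix ι' ι' ℂ) ⊗ₖ UJ
  have hZJ : Z = VAᴴ * GJ := rfl
  have hRJ : R = VBᵀ * TJ := rfl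
  have hFJ : FJᴴ * FJ = 1 := by
    have : FJᴴ * FJ = (Fᴴ * F).submatrix Subtype.val Subtype.val := rfl
    rw [this, hF, submatrix_diagonal _ _ Subtype.val_injective, ← diagonal_one]
    congr 1
    ext j
    have h : s j.1 ≠ 0 := fun h => by
      have := j.2
      rw [h, mul_zero] at this
      norm_num at this
    simp [h]
  have hUJ : UJᴴ * UJ = 1 := by
    have : UJᴴ * UJ = (Uᴴ * U).submatrix Subtype.val Subtype.val := rfl
    rw [this, hU1, submatrix_one _ Subtype.val_injective]
  have hGJ : GJᴴ * GJ = 1 := by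
    simp only [GJ, conjTranspose_kronecker, conjTranspose_one, ← mul_kronecker_mul, Matrix.mul_one,
      hFJ, one_kronecker_one]
  have hTJ : TJᴴ * TJ = 1 := by
    simp only [TJ, conjTranspose_kronecker, conjTranspose_one, ← mul_kronecker_mul, Matrix.mul_one,
      hUJ, one_kronecker_one]
  let D : Matrix κ κ ℂ := diagonal (fun j => ((c * s j : ℝ) : ℂ))
  have hD : (c : ℂ) • (FJᴴ * a * UJ) = D := by
    have : FJᴴ * a * UJ = (Fᴴ * (a * U)).submatrix Subtype.val Subtype.val := by
      rw [← Matrix.mul_assoc]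
      rfl
    rw [this, haU, ← Matrix.mul_assoc, hF, diagonal_mul_diagonal,
      submatrix_diagonal _ _ Subtype.val_injective, ← diagonal_smul]
    congr 1
    ext j
    by_cases h : s j = 0 <;> simp [h]
  have hVAp := partialIsometry_conjTranspose (partialIsometry_of_isometry hVA)
  have hGp := partialIsometry_of_isometry hGJ
  have hTp := partialIsometry_of_isometry hTJ
  have hZc : ∀ M : Matrix (ι' × κ) Unit ℂ, hs (Z * M) ≤ hs M := fun M => by
    rw [hZJ, Matrix.mul_assoc]
    exact (hs_mul_le_of_partialIsometry hVAp _).trans (hs_mul_le_of_partialIsometry hGp _)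
  obtain ⟨W, hW, hWZ, hWn⟩ := exists_partialIsometry_near Z hZc
  have hWZ' : hs (W - Z) ≤ 4 * δ := hWZ.trans r3
  have hcard : (Fintype.card (ι' × κ) : ℝ) = Fintype.card ι' * Fintype.card κ := by
    rw [Fintype.card_prod]; push_cast; rfl
  rw [hcard] at r3 r4
  have hne : Nonempty κ := by
    -- Without kept singular values, `d ≤ 4δ`, against `hδ`.
    by_contra h
    have : Fintype.card κ = 0 := by
      rw [Fintype.card_eq_zero_iff]; exact not_nonempty_iff.1 h
    rw [this] at r4
    norm_num at r4
    linarith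
  have hδ0 : 0 ≤ δ := (hs_nonneg _).trans h0
  have b1 : ∑ t, w t * hs (A' t ⊗ₖ (1 : Matrix κ κ ℂ) - A' t ⊗ₖ D) ≤ δ := by
    have e1 : ∀ t, hs (A' t ⊗ₖ (1 : Matrix κ κ ℂ) - A' t ⊗ₖ D) = hs (A' t * 1) * hs (1 - D) := by
      intro t
      rw [Matrix.mul_one, ← hs_kronecker]
      congr 1
      ext i j
      simp [mul_sub]
    have e2 : hs (1 - D) = ∑ j : κ, (1 - c * s j) ^ 2 := by
      rw [hs_eq_sum_colSq]
      refine Finset.sum_congr rfl fun j _ => ?_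
      rw [colSq, Finset.sum_eq_single j]
      · simp only [D, Matrix.sub_apply, one_apply_eq, diagonal_apply_eq]
        rw [← Complex.ofReal_one, ← Complex.ofReal_sub, Complex.norm_real, Real.norm_eq_abs, sq_abs]
      · intro i _ hij
        simp [D, one_apply_ne hij, diagonal_apply_ne _ hij]
      · simp
    simp only [e1, ← mul_assoc, ← Finset.sum_mul]
    have e3 := sum_hs_mul_le hA' (1 : Matrix ι' ι' ℂ)
    refine (mul_le_mul_of_nonneg_right e3 (hs_nonneg _)).trans ?_
    refine le_trans (le_of_eq ?_) r2
    rw [hs_one, e2, Fintype.sum_prod_type]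
    simp [e, σ]
  -- Compress the hypothesis `h1` by the isometries `GJ` on the left and `TJ` on the right.
  have b2 : ∑ t, w t * hs (A' t ⊗ₖ D - Zᴴ * A t * R) ≤ δ := by
    refine le_trans (Finset.sum_le_sum fun t _ => mul_le_mul_of_nonneg_left ?_ (hw t)) h1
    have : A' t ⊗ₖ D - Zᴴ * A t * R
        = -(GJᴴ * (VA * A t * VBᵀ - (c : ℂ) • (A' t ⊗ₖ a)) * TJ) := by
      have e1 : GJᴴ * ((c : ℂ) • (A' t ⊗ₖ a)) * TJ = A' t ⊗ₖ D := by
        rw [← hD, kronecker_smul, Matrix.mul_smul, Matrix.smul_mul]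
        simp only [GJ, TJ, conjTranspose_kronecker, conjTranspose_one, ← mul_kronecker_mul,
          Matrix.mul_one, Matrix.one_mul]
      rw [Matrix.mul_sub, Matrix.sub_mul, e1, hZJ, hRJ, conjTranspose_mul,
        conjTranspose_conjTranspose, neg_sub]
      simp only [Matrix.mul_assoc]
    rw [this, hs_neg]
    exact (mul_hs_le_of_partialIsometry hTp _).trans
      (hs_mul_le_of_partialIsometry (partialIsometry_conjTranspose hGp) _)
  -- `12 = 2 · 2 + 2 · 4`, from `‖R - Z‖² ≤ 2δ` and `‖W - Z‖² ≤ 4δ`.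
  have hRW : hs (R - W) ≤ 12 * δ := by
    have e1 : R - W = (R - Z) - (W - Z) := by abel
    rw [e1]
    refine (hs_sub_le _ _).trans ?_
    rw [hs_sub_comm R Z]
    linarith
  have b3 : ∑ t, w t * hs (Zᴴ * A t * R - Zᴴ * A t * W) ≤ 12 * δ := by
    refine le_trans (Finset.sum_le_sum fun t _ => mul_le_mul_of_nonneg_left ?_ (hw t))
      ((sum_hs_mul_le hA (R - W)).trans hRW)
    rw [← Matrix.mul_sub, Matrix.mul_assoc, hZJ, conjTranspose_mul, Matrix.mul_assoc]
    exact (hs_mul_le_of_partialIsometry (partialIsometry_conjTranspose hGp) _).trans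
      (hs_mul_le_of_partialIsometry (by simpa using partialIsometry_of_isometry hVA) _)
  have b4 : ∑ t, w t * hs (Zᴴ * A t * W - Wᴴ * A t * W) ≤ 4 * δ := by
    refine le_trans (Finset.sum_le_sum fun t _ => mul_le_mul_of_nonneg_left ?_ (hw t))
      ((sum_hs_mul_le hA (W - Z)).trans hWZ')
    rw [← Matrix.sub_mul, ← Matrix.sub_mul, ← conjTranspose_sub]
    refine (mul_hs_le_of_partialIsometry hW _).trans ?_
    rw [← hs_conjTranspose, conjTranspose_mul, conjTranspose_conjTranspose, (hAh t).eq,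
      ← neg_sub W Z, Matrix.mul_neg, hs_neg]
  refine ⟨κ, inferInstance, inferInstance, hne, W, hW, ?_, ?_, ?_, r4⟩
  -- Four summands cost a factor `4` in squared norm: `72 = 4 (1 + 1 + 12 + 4)`.
  · have key : ∀ t, w t * hs (A' t ⊗ₖ (1 : Matrix κ κ ℂ) - Wᴴ * A t * W)
        ≤ 4 * (w t * hs (A' t ⊗ₖ (1 : Matrix κ κ ℂ) - A' t ⊗ₖ D))
          + 4 * (w t * hs (A' t ⊗ₖ D - Zᴴ * A t * R))
          + 4 * (w t * hs (Zᴴ * A t * R - Zᴴ * A t * W))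
          + 4 * (w t * hs (Zᴴ * A t * W - Wᴴ * A t * W)) := by
      intro t
      have e1 : A' t ⊗ₖ (1 : Matrix κ κ ℂ) - Wᴴ * A t * W
          = ((A' t ⊗ₖ (1 : Matrix κ κ ℂ) - A' t ⊗ₖ D) + (A' t ⊗ₖ D - Zᴴ * A t * R))
            + ((Zᴴ * A t * R - Zᴴ * A t * W) + (Zᴴ * A t * W - Wᴴ * A t * W)) := by abel
      have e2 := hs_add_le ((A' t ⊗ₖ (1 : Matrix κ κ ℂ) - A' t ⊗ₖ D)
        + (A' t ⊗ₖ D - Zᴴ * A t * R))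
        ((Zᴴ * A t * R - Zᴴ * A t * W) + (Zᴴ * A t * W - Wᴴ * A t * W))
      have e3 := hs_add_le (A' t ⊗ₖ (1 : Matrix κ κ ℂ) - A' t ⊗ₖ D) (A' t ⊗ₖ D - Zᴴ * A t * R)
      have e4 := hs_add_le (Zᴴ * A t * R - Zᴴ * A t * W) (Zᴴ * A t * W - Wᴴ * A t * W)
      rw [← e1] at e2
      have := mul_le_mul_of_nonneg_left (e2.trans (by linarith :
        _ ≤ 4 * hs (A' t ⊗ₖ (1 : Matrix κ κ ℂ) - A' t ⊗ₖ D) + 4 * hs (A' t ⊗ₖ D - Zᴴ * A t * R)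
          + 4 * hs (Zᴴ * A t * R - Zᴴ * A t * W) + 4 * hs (Zᴴ * A t * W - Wᴴ * A t * W))) (hw t)
      linarith
    refine (Finset.sum_le_sum fun t _ => key t).trans ?_
    simp only [Finset.sum_add_distrib, ← Finset.mul_sum]
    linarith
  · linarith
  · linarith

/-! ### Extending a partial isometry to an isometry -/

section Extending

variable {T m n p r ι : Type*} [Fintype T] [Fintype m] [Fintype n] [Fintype p] [Fintype r]
  [Fintype ι]

/-- The weighted `ℓ²`-norm of a family of matrices. -/
def famNorm (w : T → ℝ) (F : T → Matrix m n ℂ) : ℝ := √(∑ t, w t * hs (F t))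

/-- Exhibits the weighted norm as a Euclidean norm, whence the triangle inequality. Adding norms
instead of squared norms is what yields the constant `4 + √2`. -/
theorem famNorm_eq {w : T → ℝ} (hw : ∀ t, 0 ≤ w t) (F : T → Matrix m n ℂ) :
    famNorm w F
      = ‖WithLp.toLp 2 (fun x : T × m × n => ((√(w x.1) : ℝ) : ℂ) * F x.1 x.2.1 x.2.2)‖ := by
  rw [EuclideanSpace.norm_eq, famNorm]
  congr 1
  simp only [Fintype.sum_prod_type, hs, Finset.mul_sum, norm_mul, mul_pow, Complex.norm_real,
    Real.norm_eq_abs, sq_abs, Real.sq_sqrt (hw _)]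

theorem famNorm_add_le {w : T → ℝ} (hw : ∀ t, 0 ≤ w t) (F G : T → Matrix m n ℂ) :
    famNorm w (fun t => F t + G t) ≤ famNorm w F + famNorm w G := by
  rw [famNorm_eq hw, famNorm_eq hw, famNorm_eq hw]
  refine le_trans (le_of_eq ?_) (norm_add_le _ _)
  congr 1
  ext x
  simp [mul_add]

theorem famNorm_neg (w : T → ℝ) (F : T → Matrix m n ℂ) :
    famNorm w (fun t => -F t) = famNorm w F := by
  simp [famNorm, hs_neg]

theorem famNorm_smul_le {w : T → ℝ} (x : ℝ) {F : T → Matrix m n ℂ} {b c : ℝ}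
    (h : ∑ t, w t * hs (F t) ≤ b) (hc : x ^ 2 * b ≤ c) :
    famNorm w (fun t => (x : ℂ) • F t) ≤ √c := by
  rw [famNorm]
  refine Real.sqrt_le_sqrt (le_trans ?_ hc)
  refine le_trans (le_of_eq ?_) (mul_le_mul_of_nonneg_left h (sq_nonneg x))
  rw [Finset.mul_sum]
  refine Finset.sum_congr rfl fun t _ => ?_
  rw [hs_smul, Complex.norm_real, Real.norm_eq_abs, sq_abs]
  ring

variable [DecidableEq ι] [DecidableEq r]

theorem hs_one_sub_of_partialIsometry {W : Matrix ι r ℂ} (hW : W * Wᴴ * W = W) :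
    hs (1 - W * Wᴴ) = Fintype.card ι - hs W := by
  have h : (1 - W * Wᴴ)ᴴ * (1 - W * Wᴴ) = 1 - W * Wᴴ := by
    have : W * Wᴴ * (W * Wᴴ) = W * Wᴴ := by rw [← Matrix.mul_assoc, hW]
    simp [Matrix.mul_sub, Matrix.sub_mul, this]
  rw [hs_eq_re_trace, h, trace_sub, trace_one, Complex.sub_re, ← hs_eq_re_trace', Complex.natCast_re]

theorem hs_le_card_of_partialIsometry {W : Matrix ι r ℂ} (hW : W * Wᴴ * W = W) :
    hs W ≤ Fintype.card ι := by
  have := hs_nonneg (1 - W * Wᴴ)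
  rw [hs_one_sub_of_partialIsometry hW] at this
  linarith

/-- The extension of `Wᴴ` to an isometry, where `P` and `Q` embed the space of `W` and the
complement of the range of `W` into orthogonal subspaces. -/
def extendIsometry (P : Matrix p r ℂ) (Q : Matrix p ι ℂ) (W : Matrix ι r ℂ) : Matrix p ι ℂ :=
  P * Wᴴ + Q * (1 - W * Wᴴ)

variable {P : Matrix p r ℂ} {Q : Matrix p ι ℂ} {W : Matrix ι r ℂ}

theorem extendIsometry_isometry (hP : Pᴴ * P = 1) (hQ : Qᴴ * Q = 1) (hPQ : Pᴴ * Q = 0)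
    (hW : W * Wᴴ * W = W) : (extendIsometry P Q W)ᴴ * extendIsometry P Q W = 1 := by
  have hQP : Qᴴ * P = 0 := by
    have := congrArg conjTranspose hPQ
    simpa using this
  set E := 1 - W * Wᴴ with hE
  have hEh : Eᴴ = E := by simp [hE]
  have hEE : E * E = E := by
    have : W * Wᴴ * (W * Wᴴ) = W * Wᴴ := by rw [← Matrix.mul_assoc, hW]
    simp [hE, Matrix.mul_sub, Matrix.sub_mul, this]
  rw [extendIsometry, ← hE, conjTranspose_add, conjTranspose_mul, conjTranspose_mul,
    conjTranspose_conjTranspose, hEh, Matrix.add_mul, Matrix.mul_add, Matrix.mul_add]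
  have e1 : W * Pᴴ * (P * Wᴴ) = W * Wᴴ := by
    rw [Matrix.mul_assoc, ← Matrix.mul_assoc Pᴴ, hP, Matrix.one_mul]
  have e2 : W * Pᴴ * (Q * E) = 0 := by
    rw [Matrix.mul_assoc, ← Matrix.mul_assoc Pᴴ, hPQ, Matrix.zero_mul, Matrix.mul_zero]
  have e3 : E * Qᴴ * (P * Wᴴ) = 0 := by
    rw [Matrix.mul_assoc, ← Matrix.mul_assoc Qᴴ, hQP, Matrix.zero_mul, Matrix.mul_zero]
  have e4 : E * Qᴴ * (Q * E) = E := by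
    rw [Matrix.mul_assoc, ← Matrix.mul_assoc Qᴴ, hQ, Matrix.one_mul, hEE]
  rw [e1, e2, e3, e4, hE]
  abel

variable {w : T → ℝ} {A : T → Matrix ι ι ℂ} {B : T → Matrix r r ℂ}

theorem sq_inv_sqrt_card [Nonempty ι] : ((√(Fintype.card ι : ℝ))⁻¹) ^ 2 * Fintype.card ι = 1 := by
  have : (0 : ℝ) < Fintype.card ι := by exact_mod_cast Fintype.card_pos
  rw [inv_pow, Real.sq_sqrt this.le, inv_mul_cancel₀ this.ne']

/-- Each of the two families has norm at most `1`. This covers large `ε`, where the partial isometry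
gives no information. -/
theorem famNorm_extendIsometry_le_two [Nonempty ι] [Nonempty r] (hw : ∀ t, 0 ≤ w t)
    (hP : Pᴴ * P = 1) (hQ : Qᴴ * Q = 1) (hPQ : Pᴴ * Q = 0) (hW : W * Wᴴ * W = W)
    (hA : (1 - ∑ t, (w t : ℂ) • ((A t)ᴴ * A t)).PosSemidef)
    (hB : (1 - ∑ t, (w t : ℂ) • ((B t)ᴴ * B t)).PosSemidef) :
    famNorm w (fun t => (((√(Fintype.card ι : ℝ))⁻¹ : ℝ) : ℂ) •
        (extendIsometry P Q W * A t * (extendIsometry P Q W)ᴴ)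
      - (((√(Fintype.card r : ℝ))⁻¹ : ℝ) : ℂ) • (P * B t * Pᴴ)) ≤ 2 := by
  have hV := partialIsometry_of_isometry (extendIsometry_isometry hP hQ hPQ hW)
  have hPp := partialIsometry_of_isometry hP
  set V := extendIsometry P Q W
  simp only [sub_eq_add_neg]
  refine (famNorm_add_le hw _ _).trans ?_
  rw [famNorm_neg]
  have h1 : ∑ t, w t * hs (V * A t * Vᴴ) ≤ Fintype.card ι := by
    refine le_trans (Finset.sum_le_sum fun t _ => mul_le_mul_of_nonneg_left ?_ (hw t))
      ((sum_hs_mul_le hA 1).trans_eq hs_one)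
    rw [Matrix.mul_one]
    exact (mul_hs_le_of_partialIsometry (partialIsometry_conjTranspose hV) _).trans
      (hs_mul_le_of_partialIsometry hV _)
  have h2 : ∑ t, w t * hs (P * B t * Pᴴ) ≤ Fintype.card r := by
    refine le_trans (Finset.sum_le_sum fun t _ => mul_le_mul_of_nonneg_left ?_ (hw t))
      ((sum_hs_mul_le hB 1).trans_eq hs_one)
    rw [Matrix.mul_one]
    exact (mul_hs_le_of_partialIsometry (partialIsometry_conjTranspose hPp) _).trans
      (hs_mul_le_of_partialIsometry hPp _)
  have h3 := famNorm_smul_le (w := w) _ h1 sq_inv_sqrt_card.le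
  have h4 := famNorm_smul_le (w := w) _ h2 sq_inv_sqrt_card.le
  rw [Real.sqrt_one] at h3 h4
  linarith

/-- With `V = P Wᴴ + Q E`, where `E = 1 - W Wᴴ`, `x = d^{-1/2}` and `y = r^{-1/2}`, the difference
is a sum of four families: `x V A (Q E)ᴴ` and `x Q E A (P Wᴴ)ᴴ`, each of norm at most `√ε` because
`‖E‖² = d - ‖W‖²`; the change of normalisation `(x - y) P Wᴴ A W Pᴴ`, at most `√(2ε)`; and `-y P (B
- Wᴴ A W) Pᴴ`, at most `2√ε`. -/
theorem famNorm_extendIsometry_le [Nonempty ι] [Nonempty r] (hw : ∀ t, 0 ≤ w t)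
    (hP : Pᴴ * P = 1) (hQ : Qᴴ * Q = 1) (hPQ : Pᴴ * Q = 0) (hW : W * Wᴴ * W = W)
    (hAh : ∀ t, (A t).IsHermitian)
    (hA : (1 - ∑ t, (w t : ℂ) • ((A t)ᴴ * A t)).PosSemidef) {ε : ℝ}
    (h1 : Fintype.card ι - hs W ≤ ε * Fintype.card ι)
    (h2 : Fintype.card r - hs W ≤ ε * Fintype.card r)
    (h3 : ∑ t, w t * hs (B t - Wᴴ * A t * W) ≤ 4 * ε * Fintype.card r) :
    famNorm w (fun t => (((√(Fintype.card ι : ℝ))⁻¹ : ℝ) : ℂ) •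
        (extendIsometry P Q W * A t * (extendIsometry P Q W)ᴴ)
      - (((√(Fintype.card r : ℝ))⁻¹ : ℝ) : ℂ) • (P * B t * Pᴴ)) ≤ (4 + √2) * √ε := by
  have hV := partialIsometry_of_isometry (extendIsometry_isometry hP hQ hPQ hW)
  have hPp := partialIsometry_of_isometry hP
  have hQp := partialIsometry_of_isometry hQ
  have hPc := partialIsometry_conjTranspose hPp
  have hd : (0 : ℝ) < Fintype.card ι := by exact_mod_cast Fintype.card_pos
  have hr : (0 : ℝ) < Fintype.card r := by exact_mod_cast Fintype.card_pos
  have hx := sq_inv_sqrt_card (ι := ι)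
  have hy := sq_inv_sqrt_card (ι := r)
  have hx0 : 0 ≤ (√(Fintype.card ι : ℝ))⁻¹ := by positivity
  have hy0 : 0 ≤ (√(Fintype.card r : ℝ))⁻¹ := by positivity
  have hWd := hs_le_card_of_partialIsometry hW
  have hWr : hs W ≤ Fintype.card r := by
    rw [← hs_conjTranspose]
    exact hs_le_card_of_partialIsometry (partialIsometry_conjTranspose hW)
  set x := (√(Fintype.card ι : ℝ))⁻¹
  set y := (√(Fintype.card r : ℝ))⁻¹
  set V := extendIsometry P Q W with hVd
  set E := 1 - W * Wᴴ with hE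
  have hEh : Eᴴ = E := by simp [hE]
  have hEn : hs E = Fintype.card ι - hs W := hs_one_sub_of_partialIsometry hW
  have hEE : E * E = E := by
    have : W * Wᴴ * (W * Wᴴ) = W * Wᴴ := by rw [← Matrix.mul_assoc, hW]
    simp [hE, Matrix.mul_sub, Matrix.sub_mul, this]
  have hAE : ∑ t, w t * hs (A t * E) ≤ ε * Fintype.card ι :=
    (sum_hs_mul_le hA E).trans (by rw [hEn]; exact h1)
  have hε : x ^ 2 * (ε * Fintype.card ι) ≤ ε := by
    rw [mul_left_comm, hx, mul_one]
  have b1 : famNorm w (fun t => (x : ℂ) • (V * A t * (Q * E)ᴴ)) ≤ √ε := by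
    refine famNorm_smul_le x (le_trans (Finset.sum_le_sum fun t _ =>
      mul_le_mul_of_nonneg_left ?_ (hw t)) hAE) hε
    rw [conjTranspose_mul, hEh, ← Matrix.mul_assoc, Matrix.mul_assoc V]
    exact (mul_hs_le_of_partialIsometry (partialIsometry_conjTranspose hQp) _).trans
      (hs_mul_le_of_partialIsometry hV _)
  have b2 : famNorm w (fun t => (x : ℂ) • (Q * E * A t * (P * Wᴴ)ᴴ)) ≤ √ε := by
    refine famNorm_smul_le x (le_trans (Finset.sum_le_sum fun t _ =>
      mul_le_mul_of_nonneg_left ?_ (hw t)) hAE) hε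
    rw [conjTranspose_mul, conjTranspose_conjTranspose, ← Matrix.mul_assoc]
    refine (mul_hs_le_of_partialIsometry hPc _).trans ?_
    refine (mul_hs_le_of_partialIsometry hW _).trans ?_
    rw [Matrix.mul_assoc]
    refine (hs_mul_le_of_partialIsometry hQp _).trans ?_
    rw [← hs_conjTranspose, conjTranspose_mul, hEh, (hAh t).eq]
  have b3 : famNorm w (fun t => ((x - y : ℝ) : ℂ) • (P * (Wᴴ * A t * W) * Pᴴ)) ≤ √(2 * ε) := by
    refine famNorm_smul_le (x - y) (b := hs W) (le_trans (Finset.sum_le_sum fun t _ =>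
      mul_le_mul_of_nonneg_left ?_ (hw t)) (sum_hs_mul_le hA W)) ?_
    · refine (mul_hs_le_of_partialIsometry hPc _).trans ?_
      refine (hs_mul_le_of_partialIsometry hPp _).trans ?_
      rw [Matrix.mul_assoc]
      exact hs_mul_le_of_partialIsometry (partialIsometry_conjTranspose hW) _
    -- `(x - y)² ‖W‖² ≤ 1 + 1 - 2 (1 - ε) = 2ε`, where `x y ‖W‖²` is the geometric mean of two
    -- numbers that are at least `1 - ε`.
    · have hx1 : x ^ 2 * hs W ≤ 1 := by
        rw [← hx]; exact mul_le_mul_of_nonneg_left hWd (sq_nonneg x)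
      have hy1 : y ^ 2 * hs W ≤ 1 := by
        rw [← hy]; exact mul_le_mul_of_nonneg_left hWr (sq_nonneg y)
      have hx2 : 1 - ε ≤ x ^ 2 * hs W := by
        have := mul_le_mul_of_nonneg_left h1 (sq_nonneg x)
        rw [mul_sub, mul_left_comm, hx] at this
        linarith
      have hy2 : 1 - ε ≤ y ^ 2 * hs W := by
        have := mul_le_mul_of_nonneg_left h2 (sq_nonneg y)
        rw [mul_sub, mul_left_comm, hy] at this
        linarith
      have hxy : 1 - ε ≤ x * y * hs W := by
        rcases le_total (1 - ε) 0 with h | h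
        · exact h.trans (mul_nonneg (mul_nonneg hx0 hy0) (hs_nonneg W))
        · refine abs_le_of_sq_le_sq' ?_ (mul_nonneg (mul_nonneg hx0 hy0) (hs_nonneg W)) |>.2
          calc (1 - ε) ^ 2 = (1 - ε) * (1 - ε) := sq _
            _ ≤ (x ^ 2 * hs W) * (y ^ 2 * hs W) := mul_le_mul hx2 hy2 h (h.trans hx2)
            _ = _ := by ring
      nlinarith
  have b4 : famNorm w (fun t => ((-y : ℝ) : ℂ) • (P * (B t - Wᴴ * A t * W) * Pᴴ))
      ≤ √(2 ^ 2 * ε) := by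
    refine famNorm_smul_le (-y) (le_trans (Finset.sum_le_sum fun t _ =>
      mul_le_mul_of_nonneg_left ?_ (hw t)) h3) ?_
    · exact (mul_hs_le_of_partialIsometry hPc _).trans (hs_mul_le_of_partialIsometry hPp _)
    · rw [neg_sq, mul_left_comm, hy]
      linarith
  rw [Real.sqrt_mul (by norm_num), Real.sqrt_sq (by norm_num)] at b4
  rw [Real.sqrt_mul (by norm_num)] at b3
  have key : (fun t => (x : ℂ) • (V * A t * Vᴴ) - (y : ℂ) • (P * B t * Pᴴ))
      = fun t => ((x : ℂ) • (V * A t * (Q * E)ᴴ) + (x : ℂ) • (Q * E * A t * (P * Wᴴ)ᴴ))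
        + (((x - y : ℝ) : ℂ) • (P * (Wᴴ * A t * W) * Pᴴ)
          + ((-y : ℝ) : ℂ) • (P * (B t - Wᴴ * A t * W) * Pᴴ)) := by
    funext t
    have e1 : V * A t * Vᴴ = V * A t * (Q * E)ᴴ + Q * E * A t * (P * Wᴴ)ᴴ
        + P * (Wᴴ * A t * W) * Pᴴ := by
      have e2 : Vᴴ = (P * Wᴴ)ᴴ + (Q * E)ᴴ := by rw [← conjTranspose_add]; rfl
      have e3 : V = P * Wᴴ + Q * E := rfl
      have e4 : P * Wᴴ * A t * (P * Wᴴ)ᴴ = P * (Wᴴ * A t * W) * Pᴴ := by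
        rw [conjTranspose_mul, conjTranspose_conjTranspose]
        simp only [Matrix.mul_assoc]
      rw [e2, Matrix.mul_add, ← e4]
      nth_rw 1 [e3]
      rw [Matrix.add_mul, Matrix.add_mul]
      abel
    have e5 : P * (B t - Wᴴ * A t * W) * Pᴴ = P * B t * Pᴴ - P * (Wᴴ * A t * W) * Pᴴ := by
      rw [Matrix.mul_sub, Matrix.sub_mul]
    rw [e1, e5]
    push_cast
    module
  rw [key]
  refine (famNorm_add_le hw _ _).trans ?_
  refine (add_le_add (famNorm_add_le hw _ _) (famNorm_add_le hw _ _)).trans ?_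
  linarith

end Extending

/-! ### Strategies in coordinates -/

section Coordinates

variable {H H' K KA KB ι ι' m n : Type*} [Fintype ι] [Fintype ι'] [Fintype m] [Fintype n]
  [NormedAddCommGroup H] [InnerProductSpace ℂ H] [FiniteDimensional ℂ H]
  [NormedAddCommGroup H'] [InnerProductSpace ℂ H'] [FiniteDimensional ℂ H']
  [NormedAddCommGroup K] [InnerProductSpace ℂ K] [FiniteDimensional ℂ K]
  [NormedAddCommGroup KA] [InnerProductSpace ℂ KA] [FiniteDimensional ℂ KA]
  [NormedAddCommGroup KB] [InnerProductSpace ℂ KB] [FiniteDimensional ℂ KB]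

/-- The matrix of an operator in an orthonormal basis. -/
def opMat (u : OrthonormalBasis ι ℂ H) (T : H →L[ℂ] H) : Matrix ι ι ℂ :=
  Matrix.of fun i j => inner ℂ (u i) (T (u j))

/-- The matrix of a linear map from `H` to `H' ⊗ K` in product bases. -/
def tensorMat (u : OrthonormalBasis ι ℂ H) (u' : OrthonormalBasis ι' ℂ H')
    (b : OrthonormalBasis m ℂ K) (V : H →ₗ[ℂ] H' ⊗[ℂ] K) : Matrix (ι' × m) ι ℂ :=
  Matrix.of fun p i => inner ℂ (u' p.1 ⊗ₜ[ℂ] b p.2) (V (u i))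

/-- The coefficient matrix of a vector in a tensor product. -/
def vecMat (b : OrthonormalBasis m ℂ KA) (c : OrthonormalBasis n ℂ KB) (v : KA ⊗[ℂ] KB) :
    Matrix m n ℂ :=
  Matrix.of fun i j => inner ℂ (b i ⊗ₜ[ℂ] c j) v

variable (u : OrthonormalBasis ι ℂ H) (u' : OrthonormalBasis ι' ℂ H')

theorem vecMat_add (b : OrthonormalBasis m ℂ KA) (c : OrthonormalBasis n ℂ KB)
    (v w : KA ⊗[ℂ] KB) : vecMat b c (v + w) = vecMat b c v + vecMat b c w := by
  ext i j
  exact inner_add_right (𝕜 := ℂ) (b i ⊗ₜ[ℂ] c j) v w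

theorem vecMat_sub (b : OrthonormalBasis m ℂ KA) (c : OrthonormalBasis n ℂ KB)
    (v w : KA ⊗[ℂ] KB) : vecMat b c (v - w) = vecMat b c v - vecMat b c w := by
  ext i j
  exact inner_sub_right (𝕜 := ℂ) (b i ⊗ₜ[ℂ] c j) v w

theorem vecMat_smul (b : OrthonormalBasis m ℂ KA) (c : OrthonormalBasis n ℂ KB)
    (z : ℂ) (v : KA ⊗[ℂ] KB) : vecMat b c (z • v) = z • vecMat b c v := by
  ext i j
  exact inner_smul_right (𝕜 := ℂ) (b i ⊗ₜ[ℂ] c j) v z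

theorem vecMat_sum {T : Type*} [Fintype T] (b : OrthonormalBasis m ℂ KA)
    (c : OrthonormalBasis n ℂ KB) (v : T → KA ⊗[ℂ] KB) :
    vecMat b c (∑ t, v t) = ∑ t, vecMat b c (v t) := by
  ext i j
  rw [Matrix.sum_apply]
  exact inner_sum (𝕜 := ℂ) Finset.univ v (b i ⊗ₜ[ℂ] c j)

theorem vecMat_tmul (b : OrthonormalBasis m ℂ KA) (c : OrthonormalBasis n ℂ KB)
    (x : KA) (y : KB) (i : m) (j : n) :
    vecMat b c (x ⊗ₜ[ℂ] y) i j = inner ℂ (b i) x * inner ℂ (c j) y :=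
  TensorProduct.inner_tmul (𝕜 := ℂ) (b i) x (c j) y

theorem opMat_eq_toMatrix [DecidableEq ι] (T : H →L[ℂ] H) :
    opMat u T = LinearMap.toMatrix u.toBasis u.toBasis (T : H →ₗ[ℂ] H) := by
  ext i j
  simp [opMat, LinearMap.toMatrix_apply, u.repr_apply_apply]

theorem opMat_one [DecidableEq ι] : opMat u (1 : H →L[ℂ] H) = 1 := by
  ext i j
  simp [opMat, Matrix.one_apply, orthonormal_iff_ite.1 u.orthonormal]

theorem opMat_sum {T : Type*} [Fintype T] (E : T → (H →L[ℂ] H)) :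
    opMat u (∑ t, E t) = ∑ t, opMat u (E t) := by
  ext i j
  simp [opMat, Matrix.sum_apply]

theorem posSemidef_opMat {T : H →L[ℂ] H} (hT : T.IsPositive) : (opMat u T).PosSemidef := by
  classical
  rw [opMat_eq_toMatrix, LinearMap.posSemidef_toMatrix_iff]
  exact hT.toLinearMap

/-- `E - E² = E (1 - E) E + (1 - E) E (1 - E)` is positive for every element of a POVM, because `1 -
E` is the sum of the others. -/
theorem posSemidef_one_sub_sum_sq [DecidableEq ι] {𝒜 : Type*} [Fintype 𝒜]
    {E : 𝒜 → Matrix ι ι ℂ} (hE : ∀ a, (E a).PosSemidef) (h1 : ∑ a, E a = 1) :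
    (1 - ∑ a, (E a)ᴴ * E a).PosSemidef := by
  classical
  have : 1 - ∑ a, (E a)ᴴ * E a = ∑ a, (E a - (E a)ᴴ * E a) := by
    rw [Finset.sum_sub_distrib, h1]
  rw [this]
  refine posSemidef_sum _ fun a _ => ?_
  have hc : (1 - E a).PosSemidef := by
    rw [← h1, ← Finset.add_sum_erase _ _ (Finset.mem_univ a), add_sub_cancel_left]
    exact posSemidef_sum _ fun b _ => hE b
  have e1 : E a - (E a)ᴴ * E a
      = (E a)ᴴ * (1 - E a) * E a + (1 - E a)ᴴ * E a * (1 - E a) := by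
    rw [(hE a).isHermitian.eq, hc.isHermitian.eq]
    noncomm_ring
  rw [e1]
  exact (hc.conjTranspose_mul_mul_same _).add ((hE a).conjTranspose_mul_mul_same _)

theorem posSemidef_one_sub_weighted [DecidableEq ι] {X 𝒜 : Type*} [Fintype X] [Fintype 𝒜]
    {p : X → ℝ} (hp : IsProbDist p) {A : X → 𝒜 → (H →L[ℂ] H)} (hA : ∀ x, IsPOVM (A x)) :
    (1 - ∑ t : X × 𝒜, (p t.1 : ℂ) •
      ((opMat u (A t.1 t.2))ᴴ * opMat u (A t.1 t.2))).PosSemidef := by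
  have : 1 - ∑ t : X × 𝒜, (p t.1 : ℂ) • ((opMat u (A t.1 t.2))ᴴ * opMat u (A t.1 t.2))
      = ∑ x, (p x : ℂ) • (1 - ∑ a, (opMat u (A x a))ᴴ * opMat u (A x a)) := by
    rw [Fintype.sum_prod_type]
    simp only [smul_sub, Finset.sum_sub_distrib, Finset.smul_sum, ← Finset.sum_smul]
    rw [← Complex.ofReal_sum, hp.2, Complex.ofReal_one, one_smul]
  rw [this]
  refine posSemidef_sum _ fun x _ => ?_
  refine (posSemidef_one_sub_sum_sq (fun a => posSemidef_opMat u ((hA x).1 a)) ?_).smul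
    (Complex.zero_le_real.2 (hp.1 x))
  rw [← opMat_sum, (hA x).2, opMat_one]

theorem norm_sq_eq_hs_vecMat (b : OrthonormalBasis m ℂ KA) (c : OrthonormalBasis n ℂ KB)
    (v : KA ⊗[ℂ] KB) : ‖v‖ ^ 2 = hs (vecMat b c v) := by
  rw [← (b.tensorProduct c).sum_sq_norm_inner_right v, Fintype.sum_prod_type]
  simp [hs, vecMat, OrthonormalBasis.tensorProduct_apply]

/-- The transpose trick, by which Bob's measurements turn into Alice's. -/
theorem mapL_one_transpose_maxEntangled (T : H →L[ℂ] H) :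
    TensorProduct.mapL (1 : H →L[ℂ] H) (transpose u T) (maxEntangled u)
      = TensorProduct.mapL T (1 : H →L[ℂ] H) (maxEntangled u) := by
  classical
  have h1 : ∀ i, transpose u T (u i) = ∑ k, opMat u T i k • u k := fun i => by
    have := Matrix.toLin_self u.toBasis u.toBasis
      (LinearMap.toMatrix u.toBasis u.toBasis (T : H →ₗ[ℂ] H)).transpose i
    rw [← opMat_eq_toMatrix] at this
    rw [OrthonormalBasis.coe_toBasis] at this
    rw [← OrthonormalBasis.coe_toBasis] at this ⊢
    rw [transpose]
    convert this using 1
    · rw [opMat_eq_toMatrix]; rfl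
    · rfl
  have h2 : ∀ i, T (u i) = ∑ k, opMat u T k i • u k := fun i => (u.sum_repr' (T (u i))).symm
  rw [maxEntangled, map_smul, map_smul]
  congr 1
  rw [map_sum, map_sum]
  simp only [TensorProduct.mapL_tmul, h1, h2, one_apply_eq_self, TensorProduct.tmul_sum,
    TensorProduct.sum_tmul, TensorProduct.tmul_smul, TensorProduct.smul_tmul']
  rw [Finset.sum_comm]

/-- The tensor product is bilinear, so Bob's isometry enters through its transpose, not through its
adjoint. -/
theorem vecMat_map_maxEntangled (b : OrthonormalBasis m ℂ KA) (c : OrthonormalBasis n ℂ KB)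
    (VA : H →ₗ[ℂ] H' ⊗[ℂ] KA) (VB : H →ₗ[ℂ] H' ⊗[ℂ] KB) (T : H →L[ℂ] H) :
    vecMat (u'.tensorProduct b) (u'.tensorProduct c)
        (TensorProduct.map VA VB (TensorProduct.mapL T (1 : H →L[ℂ] H) (maxEntangled u)))
      = (((√(Fintype.card ι : ℝ))⁻¹ : ℝ) : ℂ) •
        (tensorMat u u' b VA * opMat u T * (tensorMat u u' c VB)ᵀ) := by
  have h2 : ∀ i, T (u i) = ∑ k, opMat u T k i • u k := fun i => (u.sum_repr' (T (u i))).symm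
  have hc : Module.finrank ℂ H = Fintype.card ι := Module.finrank_eq_card_basis u.toBasis
  rw [maxEntangled, map_smul, map_smul, vecMat_smul, map_sum, map_sum, vecMat_sum, hc]
  push_cast
  congr 1
  ext p q
  rw [Matrix.sum_apply, Matrix.mul_apply]
  refine Finset.sum_congr rfl fun i _ => ?_
  rw [TensorProduct.mapL_tmul, TensorProduct.map_tmul, vecMat_tmul, one_apply_eq_self, h2,
    OrthonormalBasis.tensorProduct_apply', OrthonormalBasis.tensorProduct_apply', map_sum,
    inner_sum, Matrix.mul_apply]
  refine congrArg₂ _ (Finset.sum_congr rfl fun k _ => ?_) rfl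
  rw [map_smul, inner_smul_right, mul_comm]
  rfl

theorem vecMat_comm_maxEntangled (b : OrthonormalBasis m ℂ KA) (c : OrthonormalBasis n ℂ KB)
    (T : H' →L[ℂ] H') (aux : KA ⊗[ℂ] KB) :
    vecMat (u'.tensorProduct b) (u'.tensorProduct c)
        (TensorProduct.tensorTensorTensorComm ℂ H' H' KA KB
          (TensorProduct.mapL T (1 : H' →L[ℂ] H') (maxEntangled u') ⊗ₜ[ℂ] aux))
      = (((√(Fintype.card ι' : ℝ))⁻¹ : ℝ) : ℂ) • (opMat u' T ⊗ₖ vecMat b c aux) := by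
  classical
  have hc : Module.finrank ℂ H' = Fintype.card ι' := Module.finrank_eq_card_basis u'.toBasis
  rw [maxEntangled, map_smul, ← TensorProduct.smul_tmul', map_smul, vecMat_smul, map_sum, hc]
  push_cast
  congr 1
  induction aux using TensorProduct.induction_on with
  | zero =>
    ext p q
    simp [vecMat]
  | tmul k l =>
    rw [TensorProduct.sum_tmul, map_sum, vecMat_sum]
    ext p q
    rw [Matrix.sum_apply, Finset.sum_eq_single q.1]
    · rw [TensorProduct.mapL_tmul, TensorProduct.tensorTensorTensorComm_tmul, vecMat_tmul,
        OrthonormalBasis.tensorProduct_apply', OrthonormalBasis.tensorProduct_apply',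
        TensorProduct.inner_tmul, TensorProduct.inner_tmul, Matrix.kroneckerMap_apply, vecMat_tmul,
        one_apply_eq_self, orthonormal_iff_ite.1 u'.orthonormal, if_pos rfl, one_mul, mul_assoc]
      rfl
    · intro i _ hi
      rw [TensorProduct.mapL_tmul, TensorProduct.tensorTensorTensorComm_tmul, vecMat_tmul,
        OrthonormalBasis.tensorProduct_apply' _ _ q, TensorProduct.inner_tmul ℂ (u' q.1),
        one_apply_eq_self, orthonormal_iff_ite.1 u'.orthonormal, if_neg hi.symm, zero_mul,
        mul_zero]
    · simp
  | add x y hx hy =>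
    rw [TensorProduct.tmul_add, map_add, vecMat_add, hx, hy, vecMat_add, kronecker_add]

theorem norm_dilation_sq (b : OrthonormalBasis m ℂ KA) (c : OrthonormalBasis n ℂ KB)
    (VA : H →ₗ[ℂ] H' ⊗[ℂ] KA) (VB : H →ₗ[ℂ] H' ⊗[ℂ] KB) (T : H →L[ℂ] H) (T' : H' →L[ℂ] H')
    (aux : KA ⊗[ℂ] KB) :
    ‖TensorProduct.map VA VB (TensorProduct.mapL T (1 : H →L[ℂ] H) (maxEntangled u))
        - TensorProduct.tensorTensorTensorComm ℂ H' H' KA KB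
          (TensorProduct.mapL T' (1 : H' →L[ℂ] H') (maxEntangled u') ⊗ₜ[ℂ] aux)‖ ^ 2
      = hs ((((√(Fintype.card ι : ℝ))⁻¹ : ℝ) : ℂ) •
          (tensorMat u u' b VA * opMat u T * (tensorMat u u' c VB)ᵀ)
        - (((√(Fintype.card ι' : ℝ))⁻¹ : ℝ) : ℂ) • (opMat u' T' ⊗ₖ vecMat b c aux)) := by
  rw [norm_sq_eq_hs_vecMat (u'.tensorProduct b) (u'.tensorProduct c), ← vecMat_map_maxEntangled,
    ← vecMat_comm_maxEntangled, ← vecMat_sub]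

theorem tensorMat_isometry [DecidableEq ι] (b : OrthonormalBasis m ℂ K) (V : H →ₗᵢ[ℂ] H' ⊗[ℂ] K) :
    (tensorMat u u' b V.toLinearMap)ᴴ * tensorMat u u' b V.toLinearMap = 1 := by
  ext i j
  have h := (u'.tensorProduct b).sum_inner_mul_inner (V (u i)) (V (u j))
  rw [V.inner_map_map, orthonormal_iff_ite.1 u.orthonormal] at h
  rw [Matrix.one_apply, ← h, Matrix.mul_apply]
  refine Finset.sum_congr rfl fun p _ => ?_
  rw [Matrix.conjTranspose_apply, tensorMat, Matrix.of_apply, Matrix.of_apply,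
    OrthonormalBasis.tensorProduct_apply']
  exact congrArg (· * _) (inner_conj_symm (𝕜 := ℂ) (V (u i)) (u' p.1 ⊗ₜ[ℂ] b p.2))

theorem exists_isometry_of_tensorMat [DecidableEq ι] (b : OrthonormalBasis m ℂ K)
    {M : Matrix (ι' × m) ι ℂ} (hM : Mᴴ * M = 1) :
    ∃ V : H →ₗᵢ[ℂ] H' ⊗[ℂ] K, tensorMat u u' b V.toLinearMap = M := by
  classical
  let v : ι → H' ⊗[ℂ] K := fun i => ∑ p, M p i • (u'.tensorProduct b) p
  have hin : ∀ p i, inner ℂ ((u'.tensorProduct b) p) (v i) = M p i := fun p i => by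
    simp only [v]
    exact (u'.tensorProduct b).orthonormal.inner_right_fintype (fun p => M p i) p
  have hv : Orthonormal ℂ v := by
    rw [orthonormal_iff_ite]
    intro i j
    rw [← (u'.tensorProduct b).sum_inner_mul_inner, ← Matrix.one_apply, ← hM, Matrix.mul_apply]
    refine Finset.sum_congr rfl fun p _ => ?_
    rw [hin, ← inner_conj_symm, hin]
    rfl
  have hf : ∀ i, u.toBasis.constr ℂ v (u i) = v i := fun i => by
    rw [← u.coe_toBasis, Module.Basis.constr_basis]
  have hf' : Orthonormal ℂ (u.toBasis.constr ℂ v ∘ u.toBasis) := by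
    convert hv using 1
    ext i
    rw [Function.comp_apply, u.coe_toBasis, hf]
  refine ⟨(u.toBasis.constr ℂ v).isometryOfOrthonormal (v := u.toBasis)
    (by rw [u.coe_toBasis]; exact u.orthonormal) hf', ?_⟩
  ext p i
  rw [tensorMat, Matrix.of_apply]
  change inner ℂ _ (u.toBasis.constr ℂ v (u i)) = _
  rw [hf, ← hin, OrthonormalBasis.tensorProduct_apply']

theorem exists_vec_of_matrix (b : OrthonormalBasis m ℂ KA) (c : OrthonormalBasis n ℂ KB)
    (M : Matrix m n ℂ) : ∃ v : KA ⊗[ℂ] KB, vecMat b c v = M := by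
  classical
  refine ⟨∑ p : m × n, M p.1 p.2 • (b.tensorProduct c) p, ?_⟩
  ext i j
  rw [vecMat, Matrix.of_apply, ← OrthonormalBasis.tensorProduct_apply b c,
    (b.tensorProduct c).orthonormal.inner_right_fintype (fun p => M p.1 p.2)]

end Coordinates

/-! ### Matrices of linear maps in orthonormal bases -/

section MatOf

variable {G H K ι r κ : Type*} [Fintype ι] [Fintype r] [Fintype κ]
  [NormedAddCommGroup G] [InnerProductSpace ℂ G] [FiniteDimensional ℂ G]
  [NormedAddCommGroup H] [InnerProductSpace ℂ H] [FiniteDimensional ℂ H]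
  [NormedAddCommGroup K] [InnerProductSpace ℂ K] [FiniteDimensional ℂ K]

/-- The matrix of a linear map in orthonormal bases. -/
def matOf (e : OrthonormalBasis r ℂ G) (u : OrthonormalBasis ι ℂ H) (T : G →L[ℂ] H) :
    Matrix ι r ℂ :=
  Matrix.of fun i p => inner ℂ (u i) (T (e p))

variable (e : OrthonormalBasis r ℂ G) (u : OrthonormalBasis ι ℂ H) (v : OrthonormalBasis κ ℂ K)

theorem matOf_comp (S : H →L[ℂ] K) (T : G →L[ℂ] H) :
    matOf e v (S ∘L T) = matOf u v S * matOf e u T := by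
  ext i p
  rw [Matrix.mul_apply, matOf, Matrix.of_apply, ContinuousLinearMap.comp_apply,
    ← ContinuousLinearMap.adjoint_inner_left, ← u.sum_inner_mul_inner]
  simp only [ContinuousLinearMap.adjoint_inner_left]
  rfl

theorem matOf_adjoint (T : G →L[ℂ] H) :
    matOf u e (ContinuousLinearMap.adjoint T) = (matOf e u T)ᴴ := by
  ext i p
  rw [matOf, Matrix.of_apply, ContinuousLinearMap.adjoint_inner_right, Matrix.conjTranspose_apply,
    ← inner_conj_symm]
  rfl

theorem matOf_sub (S T : G →L[ℂ] H) : matOf e u (S - T) = matOf e u S - matOf e u T := by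
  ext i p
  simp [matOf]

theorem matOf_one [DecidableEq r] : matOf e e (1 : G →L[ℂ] G) = 1 := opMat_one e

theorem matOf_injective : Function.Injective (matOf e u) := by
  intro S T h
  refine ContinuousLinearMap.coe_injective (e.toBasis.ext fun p => ?_)
  rw [e.coe_toBasis]
  rw [ContinuousLinearMap.coe_coe, ContinuousLinearMap.coe_coe, ← u.sum_repr' (S (e p)),
    ← u.sum_repr' (T (e p))]
  exact Finset.sum_congr rfl fun i _ => congrArg (· • u i) (congrFun (congrFun h i) p)

theorem exists_matOf_eq (M : Matrix ι r ℂ) : ∃ T : G →L[ℂ] H, matOf e u T = M := by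
  classical
  refine ⟨LinearMap.toContinuousLinearMap (e.toBasis.constr ℂ fun p => ∑ i, M i p • u i), ?_⟩
  ext i p
  rw [matOf, Matrix.of_apply, LinearMap.coe_toContinuousLinearMap']
  conv_lhs => rw [← e.coe_toBasis]
  rw [Module.Basis.constr_basis]
  exact u.orthonormal.inner_right_fintype _ _

theorem trace_eq_trace_matOf (T : G →L[ℂ] G) :
    LinearMap.trace ℂ G (T : G →ₗ[ℂ] G) = (matOf e e T).trace :=
  LinearMap.trace_eq_sum_inner _ e

theorem trace_star_mul_self (T : G →L[ℂ] G) :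
    LinearMap.trace ℂ G ((star T * T : G →L[ℂ] G) : G →ₗ[ℂ] G) = (hs (matOf e e T) : ℂ) := by
  rw [trace_eq_trace_matOf e, ← trace_conjTranspose_mul_self, ← matOf_adjoint, ← matOf_comp]
  rfl

end MatOf

/-! ### The amplification of a von Neumann algebra -/

section Amplification

variable {G : Type*} [NormedAddCommGroup G] [InnerProductSpace ℂ G] [CompleteSpace G]

theorem coord_incl_self (i : ℕ) (v : G) : coord G i (incl G i v) = v := by
  change (lp.single 2 i v : L2 G) i = v
  simp

theorem coord_incl_of_ne {i j : ℕ} (h : i ≠ j) (v : G) : coord G i (incl G j v) = 0 := by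
  change (lp.single 2 j v : L2 G) i = 0
  simp [lp.single_apply, Pi.single_eq_of_ne h]

theorem inner_incl_left (i : ℕ) (v : G) (f : L2 G) :
    inner ℂ (incl G i v) f = inner ℂ v (coord G i f) :=
  lp.inner_single_left i v f

theorem adjoint_incl (i : ℕ) : ContinuousLinearMap.adjoint (incl G i) = coord G i := by
  symm
  rw [ContinuousLinearMap.eq_adjoint_iff]
  intro f v
  rw [← inner_conj_symm, ← inner_incl_left, inner_conj_symm]

theorem adjoint_coord (i : ℕ) : ContinuousLinearMap.adjoint (coord G i) = incl G i := by
  rw [← adjoint_incl, ContinuousLinearMap.adjoint_adjoint]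

theorem ext_L2 {f g : L2 G} (h : ∀ i, coord G i f = coord G i g) : f = g :=
  lp.ext (funext h)

/-- An operator commuting with `|v⟩⟨w|` for `v`, `w` in a family spanning a dense subspace is
scalar. -/
theorem eq_smul_of_commute_rankOne {E : Type*} [NormedAddCommGroup E] [InnerProductSpace ℂ E]
    [CompleteSpace E] {S : Set E} (hS : ∀ T : E →L[ℂ] E, (∀ v ∈ S, T v = 0) → T = 0)
    {Z : E →L[ℂ] E}
    (hZ : ∀ v ∈ S, ∀ w ∈ S,
      Z * InnerProductSpace.rankOne ℂ v w = InnerProductSpace.rankOne ℂ v w * Z) :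
    ∃ c : ℂ, Z = c • 1 := by
  by_cases h : ∃ w ∈ S, w ≠ 0
  · obtain ⟨w, hw, hw0⟩ := h
    refine ⟨inner ℂ w (Z w) / inner ℂ w w, ?_⟩
    rw [← sub_eq_zero]
    refine hS _ fun v hv => ?_
    have h1 := DFunLike.congr_fun (hZ v hv w hw) w
    have h2 : inner ℂ w w • Z v = inner ℂ w (Z w) • v := by simpa using h1
    have h3 : (inner ℂ w w : ℂ) ≠ 0 := inner_self_ne_zero.2 hw0
    simp only [_root_.sub_apply, _root_.smul_apply, one_apply_eq_self]
    rw [div_eq_inv_mul, mul_smul, ← h2, smul_smul, inv_mul_cancel₀ h3, one_smul, sub_self]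
  · push Not at h
    exact ⟨0, by rw [zero_smul]; exact hS _ fun v hv => by rw [h v hv, map_zero]⟩

/-- A trivial commutant has everything as its commutant. -/
theorem mem_generated_of_scalar {S : Set (G →L[ℂ] G)}
    (h : ∀ Z : G →L[ℂ] G, (∀ T ∈ S, Z * T = T * Z) → ∃ c : ℂ, Z = c • 1) (T : G →L[ℂ] G) :
    T ∈ generated S := by
  change T ∈ StarSubalgebra.centralizer ℂ (StarSubalgebra.centralizer ℂ S : Set (G →L[ℂ] G))
  rw [StarSubalgebra.mem_centralizer_iff]
  intro Z hZ
  have hZ' : Z ∈ StarSubalgebra.centralizer ℂ S := hZ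
  rw [StarSubalgebra.mem_centralizer_iff] at hZ'
  obtain ⟨c, rfl⟩ := h Z fun T hT => (hZ' T hT).1.symm
  constructor <;> simp

theorem isElementaryTensor_shift (x : G →L[ℂ] G) (i j : ℕ) :
    IsElementaryTensor (incl G i ∘L x ∘L coord G j) x (incl ℂ i ∘L coord ℂ j) := by
  intro k l
  ext v
  change coord G k (incl G i (x (coord G j (incl G l v))))
    = (coord ℂ k (incl ℂ i (coord ℂ j (incl ℂ l 1)))) • x v
  by_cases hk : k = i
  · subst hk
    by_cases hl : j = l
    · subst hl; simp only [coord_incl_self, one_smul]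
    · rw [coord_incl_of_ne hl, coord_incl_of_ne hl]; simp
  · rw [coord_incl_of_ne hk, coord_incl_of_ne hk, zero_smul]

theorem shift_mem_amplification {M : VonNeumannAlgebra G} {x : G →L[ℂ] G} (hx : x ∈ M) (i j : ℕ) :
    incl G i ∘L x ∘L coord G j ∈ amplification M :=
  subset_generated _ (show _ ∈ {T | ∃ x ∈ M, ∃ b : L2 ℂ →L[ℂ] L2 ℂ, IsElementaryTensor T x b} from
    ⟨x, hx, _, isElementaryTensor_shift x i j⟩)

/-- The rank-one operators between the vectors `v ⊗ e_i` are elementary tensors, and only scalars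
commute with all of them. -/
theorem mem_amplification_of_full {M : VonNeumannAlgebra G} (hM : ∀ x, x ∈ M)
    (T : L2 G →L[ℂ] L2 G) : T ∈ amplification M := by
  refine mem_generated_of_scalar (fun Z hZ => ?_) T
  refine eq_smul_of_commute_rankOne (S := {f | ∃ i v, f = incl G i v}) ?_ ?_
  · intro T hT
    refine lp.ext_continuousLinearMap (by simp) fun j => ?_
    ext v : 1
    exact (hT _ ⟨j, v, rfl⟩).trans (by simp)
  · rintro _ ⟨i, v, rfl⟩ _ ⟨j, w, rfl⟩
    have h : InnerProductSpace.rankOne ℂ (incl G i v) (incl G j w)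
        = incl G i ∘L InnerProductSpace.rankOne ℂ v w ∘L coord G j := by
      ext1 f
      simp [inner_incl_left]
    rw [h]
    exact hZ _ ⟨_, hM _, _, isElementaryTensor_shift _ i j⟩

theorem mem_tensorAlgebra_of_full {G K : Type*} [NormedAddCommGroup G] [InnerProductSpace ℂ G]
    [FiniteDimensional ℂ G] [NormedAddCommGroup K] [InnerProductSpace ℂ K] [FiniteDimensional ℂ K]
    (T : (G ⊗[ℂ] K) →L[ℂ] (G ⊗[ℂ] K)) :
    T ∈ tensorAlgebra (fullAlgebra G) (fullAlgebra K) := by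
  refine mem_generated_of_scalar (fun Z hZ => ?_) T
  refine eq_smul_of_commute_rankOne (S := {f | ∃ v w, f = v ⊗ₜ[ℂ] w}) ?_ ?_
  · intro T hT
    refine ContinuousLinearMap.coe_injective (TensorProduct.ext' fun v w => ?_)
    exact hT _ ⟨v, w, rfl⟩
  · rintro _ ⟨v, w, rfl⟩ _ ⟨v', w', rfl⟩
    have h : InnerProductSpace.rankOne ℂ (v ⊗ₜ[ℂ] w) (v' ⊗ₜ[ℂ] w')
        = TensorProduct.mapL (InnerProductSpace.rankOne ℂ v v')
          (InnerProductSpace.rankOne ℂ w w') := by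
      refine ContinuousLinearMap.coe_injective (TensorProduct.ext' fun x y => ?_)
      simp [← TensorProduct.smul_tmul', smul_smul, mul_comm]
    rw [h]
    exact hZ _ ⟨_, trivial, _, trivial, rfl⟩

theorem extension_normalizedTrace {E : Type*} [NormedAddCommGroup E] [InnerProductSpace ℂ E]
    [FiniteDimensional ℂ E] (x : E →ₗ[ℂ] E) :
    extension (normalizedTrace E) x = (Module.finrank ℂ E : ℂ)⁻¹ * LinearMap.trace ℂ E x :=
  (exists_extension (normalizedTrace E)).choose_spec ⟨LinearMap.toContinuousLinearMap x, trivial⟩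

/-- Both sides are linear, hence it suffices to compare them on elementary tensors, where traces and
dimensions multiply. -/
theorem tensorTrace_normalizedTrace {G K : Type*} [NormedAddCommGroup G] [InnerProductSpace ℂ G]
    [FiniteDimensional ℂ G] [NormedAddCommGroup K] [InnerProductSpace ℂ K] [FiniteDimensional ℂ K]
    (T : (tensorAlgebra (fullAlgebra G) (fullAlgebra K)).toStarSubalgebra) :
    tensorTrace (normalizedTrace G) (normalizedTrace K) T
      = (Module.finrank ℂ (G ⊗[ℂ] K) : ℂ)⁻¹ * LinearMap.trace ℂ (G ⊗[ℂ] K)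
        ((T : (G ⊗[ℂ] K) →L[ℂ] (G ⊗[ℂ] K)) : (G ⊗[ℂ] K) →ₗ[ℂ] (G ⊗[ℂ] K)) := by
  obtain ⟨x, hx⟩ := (homTensorHomEquiv ℂ G K G K).surjective
    ((T : (G ⊗[ℂ] K) →L[ℂ] (G ⊗[ℂ] K)) : (G ⊗[ℂ] K) →ₗ[ℂ] (G ⊗[ℂ] K))
  change TensorProduct.lid ℂ ℂ (TensorProduct.map _ _ ((homTensorHomEquiv ℂ G K G K).symm _)) = _
  rw [← hx, LinearEquiv.symm_apply_apply]
  clear hx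
  induction x using TensorProduct.induction_on with
  | zero => simp
  | tmul a b =>
    rw [TensorProduct.map_tmul, TensorProduct.lid_tmul, extension_normalizedTrace,
      extension_normalizedTrace, homTensorHomEquiv_apply,
      TensorProduct.homTensorHomMap_apply, LinearMap.trace_tensorProduct', Module.finrank_tensorProduct]
    push_cast
    rw [mul_inv, smul_eq_mul]
    ring
  | add x y hx hy => simp only [map_add, hx, hy, mul_add]

end Amplification

/-! ### A tracial dilation from a partial isometry -/

section Construction

/-- `J` sends the `j`-th basis vector to `g ⊗ e_{n j}`, using a separate copy of `G` for each `j`.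
The diagonal entry of `J X J*` in that copy is `⟨u_j, X u_j⟩ |g⟩⟨g|`, so `J` preserves traces. As
`ℓ²(ℕ)` is infinite-dimensional, the dimensions of `G` and `H` need not be compared. -/
theorem exists_embedding {G H ι : Type*} [NormedAddCommGroup G] [InnerProductSpace ℂ G]
    [FiniteDimensional ℂ G] [NormedAddCommGroup H] [InnerProductSpace ℂ H] [FiniteDimensional ℂ H]
    [Fintype ι] (u : OrthonormalBasis ι ℂ H) {g : G} (hg : ‖g‖ = 1) :
    ∃ J : H →L[ℂ] L2 G, ContinuousLinearMap.adjoint J ∘L J = 1 ∧ ∀ X : H →L[ℂ] H,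
      HasSum (fun i => LinearMap.trace ℂ G
        ((entry i i (J ∘L X ∘L ContinuousLinearMap.adjoint J) : G →L[ℂ] G) : G →ₗ[ℂ] G))
        (LinearMap.trace ℂ H (X : H →ₗ[ℂ] H)) := by
  classical
  let n : ι → ℕ := fun i => (Fintype.equivFin ι i : ℕ)
  have hn : Function.Injective n := Fin.val_injective.comp (Fintype.equivFin ι).injective
  let J : H →L[ℂ] L2 G := ∑ j, InnerProductSpace.rankOne ℂ (incl G (n j) g) (u j)
  have hJ : ∀ j, J (u j) = incl G (n j) g := fun j => by
    simp only [J, _root_.sum_apply, InnerProductSpace.rankOne_apply,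
      orthonormal_iff_ite.1 u.orthonormal]
    simp
  have hc : ∀ j, coord G (n j) ∘L J = InnerProductSpace.rankOne ℂ g (u j) := fun j => by
    refine ContinuousLinearMap.coe_injective (u.toBasis.ext fun k => ?_)
    rw [u.coe_toBasis]
    change coord G (n j) (J (u k)) = InnerProductSpace.rankOne ℂ g (u j) (u k)
    rw [hJ, InnerProductSpace.rankOne_apply, orthonormal_iff_ite.1 u.orthonormal]
    by_cases h : j = k
    · subst h; rw [coord_incl_self]; simp
    · rw [coord_incl_of_ne (fun h' => h (hn h'))]; simp [h]
  have hc0 : ∀ i, i ∉ Set.range n → coord G i ∘L J = 0 := fun i hi => by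
    refine ContinuousLinearMap.coe_injective (u.toBasis.ext fun k => ?_)
    rw [u.coe_toBasis]
    change coord G i (J (u k)) = 0
    rw [hJ, coord_incl_of_ne (fun h' => hi ⟨k, h'.symm⟩)]
  have hentry : ∀ X i, entry i i (J ∘L X ∘L ContinuousLinearMap.adjoint J)
      = (coord G i ∘L J) ∘L X ∘L ContinuousLinearMap.adjoint (coord G i ∘L J) := fun X i => by
    rw [ContinuousLinearMap.adjoint_comp, adjoint_coord]
    rfl
  refine ⟨J, ?_, fun X => ?_⟩
  · refine ContinuousLinearMap.coe_injective (u.toBasis.ext fun k => ?_)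
    rw [u.coe_toBasis]
    change ContinuousLinearMap.adjoint J (J (u k)) = u k
    have h : ContinuousLinearMap.adjoint J (incl G (n k) g)
        = ContinuousLinearMap.adjoint (coord G (n k) ∘L J) g := by
      rw [ContinuousLinearMap.adjoint_comp, adjoint_coord]
      rfl
    rw [hJ, h, hc, InnerProductSpace.adjoint_rankOne]
    simp [hg]
  · rw [LinearMap.trace_eq_sum_inner _ u]
    have h1 : ∀ i, i ∉ Set.range n → LinearMap.trace ℂ G
        ((entry i i (J ∘L X ∘L ContinuousLinearMap.adjoint J) : G →L[ℂ] G) : G →ₗ[ℂ] G) = 0 := by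
      intro i hi
      rw [hentry, hc0 i hi]
      simp
    rw [← hn.hasSum_iff h1]
    have h2 : ∀ j, LinearMap.trace ℂ G
        ((entry (n j) (n j) (J ∘L X ∘L ContinuousLinearMap.adjoint J) : G →L[ℂ] G) : G →ₗ[ℂ] G)
        = inner ℂ (u j) (X (u j)) := by
      intro j
      rw [hentry, hc j, InnerProductSpace.adjoint_rankOne, InnerProductSpace.comp_rankOne,
        InnerProductSpace.rankOne_comp_rankOne]
      have h3 := InnerProductSpace.trace_rankOne (𝕜 := ℂ) g g
      rw [inner_self_eq_norm_sq_to_K, hg] at h3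
      simp [h3]
    convert hasSum_fintype (fun j => (inner ℂ (u j) (X (u j)) : ℂ)) using 1
    · ext j
      exact h2 j
    · rfl

variable {X 𝒜 H' H ι ι' : Type*} [Fintype X] [Fintype 𝒜] [Fintype ι] [Fintype ι']
  [NormedAddCommGroup H'] [InnerProductSpace ℂ H'] [FiniteDimensional ℂ H'] [Nontrivial H']
  [NormedAddCommGroup H] [InnerProductSpace ℂ H] [FiniteDimensional ℂ H] [Nontrivial H]

theorem opMat_mapL_one {K κ : Type*} [Fintype κ] [DecidableEq κ] [NormedAddCommGroup K]
    [InnerProductSpace ℂ K] [FiniteDimensional ℂ K] (u' : OrthonormalBasis ι' ℂ H')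
    (b : OrthonormalBasis κ ℂ K) (T : H' →L[ℂ] H') :
    matOf (u'.tensorProduct b) (u'.tensorProduct b) (TensorProduct.mapL T (1 : K →L[ℂ] K))
      = opMat u' T ⊗ₖ (1 : Matrix κ κ ℂ) := by
  ext p q
  rw [matOf, Matrix.of_apply, OrthonormalBasis.tensorProduct_apply',
    OrthonormalBasis.tensorProduct_apply', TensorProduct.mapL_tmul, TensorProduct.inner_tmul,
    one_apply_eq_self, orthonormal_iff_ite.1 b.orthonormal, Matrix.kroneckerMap_apply,
    Matrix.one_apply]
  rfl

set_option maxHeartbeats 1000000 in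
-- `M₀` is `B(ℂ^κ)`, `P = J J*`, `π x = J x J*`, and `W` acts from the `0`-th copy of `H' ⊗ ℂ^κ` to
-- the range of `J`. Since every operator belongs to the amplification here, membership is free.
-- Traces become matrix traces divided by `D = dim (H' ⊗ ℂ^κ)`, and in `τ^∞/τ^∞(P)` the factor `D`
-- cancels.
theorem isVNADilation_of_partialIsometry {κ : Type} [Fintype κ] [DecidableEq κ] [Nonempty κ]
    [DecidableEq ι] [DecidableEq ι']
    (u' : OrthonormalBasis ι' ℂ H') (u : OrthonormalBasis ι ℂ H) (S' : MEStrategy X 𝒜 H')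
    (S : MEStrategy X 𝒜 H) (p : X → ℝ) {W : Matrix ι (ι' × κ) ℂ} (hW : W * Wᴴ * W = W) {ε : ℝ}
    (h1 : ∑ t : X × 𝒜, p t.1 * hs (opMat u' (S'.A t.1 t.2) ⊗ₖ (1 : Matrix κ κ ℂ)
      - Wᴴ * opMat u (S.A t.1 t.2) * W) ≤ ε * Fintype.card (ι' × κ))
    (h2 : Fintype.card ι - hs W ≤ ε * Fintype.card ι)
    (h3 : Fintype.card (ι' × κ) - hs W ≤ ε * Fintype.card (ι' × κ)) :
    IsVNADilation S'.toTracial S.toTracial ε p := by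
  let K := EuclideanSpace ℂ κ
  let b : OrthonormalBasis κ ℂ K := EuclideanSpace.basisFun κ ℂ
  let e := u'.tensorProduct b
  have hι' : Nonempty ι' := u'.toBasis.index_nonempty
  have hι : Nonempty ι := u.toBasis.index_nonempty
  let g : H' ⊗[ℂ] K := e (Classical.arbitrary _)
  obtain ⟨J, hJ, hJt⟩ := exists_embedding u (g := g) (e.norm_eq_one _)
  obtain ⟨W₁, hW₁⟩ := exists_matOf_eq e u W
  have hW₁' : W₁ ∘L ContinuousLinearMap.adjoint W₁ ∘L W₁ = W₁ := by
    apply matOf_injective e u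
    rw [matOf_comp e e, matOf_comp e u, matOf_adjoint, hW₁, ← Matrix.mul_assoc, hW]
  have hJ' : ∀ x, ContinuousLinearMap.adjoint J (J x) = x := fun x => DFunLike.congr_fun hJ x
  refine ⟨K, inferInstance, inferInstance, inferInstance, fullAlgebra K, normalizedTrace K,
    isTracialState_normalizedTrace, ?_⟩
  intro Q τ I
  have hQ : ∀ T, T ∈ Q := mem_tensorAlgebra_of_full
  have mem : ∀ T, T ∈ (amplification Q).toStarSubalgebra := mem_amplification_of_full hQ
  let D : ℂ := Module.finrank ℂ (H' ⊗[ℂ] K)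
  have hD : D = (Fintype.card (ι' × κ) : ℝ) := by
    simp only [D, Module.finrank_eq_card_basis e.toBasis]
    push_cast
    rfl
  have hτ : ∀ T, τ T = D⁻¹ * LinearMap.trace ℂ (H' ⊗[ℂ] K) (T.1 : (H' ⊗[ℂ] K) →ₗ[ℂ] (H' ⊗[ℂ] K)) :=
    tensorTrace_normalizedTrace
  have htrJ : ∀ (Y : H →L[ℂ] H)
      (h : ∀ i, entry i i (J ∘L Y ∘L ContinuousLinearMap.adjoint J) ∈ Q.toStarSubalgebra), HasSum
      (fun i => τ ⟨entry i i (J ∘L Y ∘L ContinuousLinearMap.adjoint J), h i⟩)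
      (D⁻¹ * LinearMap.trace ℂ H (Y : H →ₗ[ℂ] H)) := by
    intro Y h
    simp only [hτ]
    exact (hJt Y).mul_left _
  have htrJ' : ∀ (Y : H →L[ℂ] H) (T : (amplification Q).toStarSubalgebra),
      (T : L2 (H' ⊗[ℂ] K) →L[ℂ] L2 (H' ⊗[ℂ] K)) = J ∘L Y ∘L ContinuousLinearMap.adjoint J →
      traceInf τ T = D⁻¹ * LinearMap.trace ℂ H (Y : H →ₗ[ℂ] H) := by
    rintro Y ⟨T, hT⟩ rfl
    exact (htrJ Y _).tsum_eq
  have htr0 : ∀ (Y : (H' ⊗[ℂ] K) →L[ℂ] (H' ⊗[ℂ] K)) (T : (amplification Q).toStarSubalgebra),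
      (T : L2 (H' ⊗[ℂ] K) →L[ℂ] L2 (H' ⊗[ℂ] K)) = incl _ 0 ∘L Y ∘L coord _ 0 →
      traceInf τ T = D⁻¹ * LinearMap.trace ℂ _ (Y : (H' ⊗[ℂ] K) →ₗ[ℂ] (H' ⊗[ℂ] K)) := by
    rintro Y ⟨T, hT⟩ rfl
    rw [traceInf, tsum_eq_single 0]
    · rw [hτ]
      have : entry 0 0 (incl _ 0 ∘L Y ∘L coord _ 0) = Y := by
        ext v : 1
        change coord _ 0 (incl _ 0 (Y (coord _ 0 (incl _ 0 v)))) = Y v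
        rw [coord_incl_self, coord_incl_self]
      exact congrArg (fun Z : (H' ⊗[ℂ] K) →L[ℂ] (H' ⊗[ℂ] K) =>
        D⁻¹ * LinearMap.trace ℂ _ (Z : (H' ⊗[ℂ] K) →ₗ[ℂ] (H' ⊗[ℂ] K))) this
    · intro i hi
      rw [hτ]
      have : entry i i (incl _ 0 ∘L Y ∘L coord _ 0) = 0 := by
        ext v : 1
        change coord _ i (incl _ 0 (Y (coord _ 0 (incl _ i v)))) = 0
        rw [coord_incl_of_ne hi]
      simp [this]
  have hd : (Fintype.card ι : ℂ) ≠ 0 := by exact_mod_cast Fintype.card_ne_zero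
  have hD0 : D ≠ 0 := by rw [hD]; exact_mod_cast Fintype.card_ne_zero
  have hfin : Module.finrank ℂ H = Fintype.card ι := Module.finrank_eq_card_basis u.toBasis
  let π : S.toTracial.alg.toStarSubalgebra →⋆ₙₐ[ℂ] (amplification Q).toStarSubalgebra :=
    { toFun := fun x => ⟨J ∘L (x : H →L[ℂ] H) ∘L ContinuousLinearMap.adjoint J, mem _⟩
      map_smul' := fun c x => Subtype.ext (by ext1 v; simp)
      map_zero' := Subtype.ext (by ext1 v; simp)
      map_add' := fun x y => Subtype.ext (by ext1 v; simp)
      map_mul' := fun x y => Subtype.ext (by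
        ext1 v
        change J ((x : H →L[ℂ] H) ((y : H →L[ℂ] H) (ContinuousLinearMap.adjoint J v)))
          = J ((x : H →L[ℂ] H) (ContinuousLinearMap.adjoint J
            (J ((y : H →L[ℂ] H) (ContinuousLinearMap.adjoint J v)))))
        rw [hJ'])
      map_star' := fun x => Subtype.ext (by
        change J ∘L (star (x : H →L[ℂ] H)) ∘L ContinuousLinearMap.adjoint J
          = ContinuousLinearMap.adjoint (J ∘L (x : H →L[ℂ] H) ∘L ContinuousLinearMap.adjoint J)
        rw [ContinuousLinearMap.adjoint_comp, ContinuousLinearMap.adjoint_comp,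
          ContinuousLinearMap.adjoint_adjoint]
        rfl) }
  have hπ : ∀ x, (π x : L2 (H' ⊗[ℂ] K) →L[ℂ] L2 (H' ⊗[ℂ] K))
      = J ∘L (x : H →L[ℂ] H) ∘L ContinuousLinearMap.adjoint J := fun _ => rfl
  let P : (amplification Q).toStarSubalgebra := ⟨J ∘L ContinuousLinearMap.adjoint J, mem _⟩
  have hP : traceInf τ P = D⁻¹ * Fintype.card ι := by
    rw [htrJ' 1 P (by ext1 v; rfl)]
    congr 1
    exact (LinearMap.trace_one ℂ H).trans (by rw [hfin])
  let W₂ : (amplification Q).toStarSubalgebra := ⟨J ∘L W₁ ∘L coord _ 0, mem _⟩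
  have hstarW : ((star W₂ : (amplification Q).toStarSubalgebra) :
      L2 (H' ⊗[ℂ] K) →L[ℂ] L2 (H' ⊗[ℂ] K))
      = incl _ 0 ∘L ContinuousLinearMap.adjoint W₁ ∘L ContinuousLinearMap.adjoint J := by
    change ContinuousLinearMap.adjoint (J ∘L W₁ ∘L coord _ 0) = _
    rw [ContinuousLinearMap.adjoint_comp, ContinuousLinearMap.adjoint_comp, adjoint_coord]
    rfl
  refine ⟨P, π, W₂, ⟨?_, ?_⟩, ?_, ?_, ?_, ?_, ?_, ?_, ?_, ?_, ?_⟩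
  · refine Subtype.ext ?_
    ext1 v
    change J (ContinuousLinearMap.adjoint J (J (ContinuousLinearMap.adjoint J v)))
      = J (ContinuousLinearMap.adjoint J v)
    rw [hJ']
  · refine Subtype.ext ?_
    change ContinuousLinearMap.adjoint (J ∘L ContinuousLinearMap.adjoint J) = _
    rw [ContinuousLinearMap.adjoint_comp, ContinuousLinearMap.adjoint_adjoint]
  · exact (htrJ 1 _).summable
  · intro x y hxy
    refine Subtype.ext ?_
    ext1 v
    have h := congrArg (fun T : (amplification Q).toStarSubalgebra =>
      ContinuousLinearMap.adjoint J ((T : L2 (H' ⊗[ℂ] K) →L[ℂ] L2 (H' ⊗[ℂ] K)) (J v))) hxy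
    simpa [hπ, hJ'] using h
  · intro T
    constructor
    · rintro ⟨x, rfl⟩
      refine Subtype.ext ?_
      ext1 v
      change J (ContinuousLinearMap.adjoint J (J (x.1 (ContinuousLinearMap.adjoint J
        (J (ContinuousLinearMap.adjoint J v)))))) = J (x.1 (ContinuousLinearMap.adjoint J v))
      rw [hJ', hJ']
    · intro h
      refine ⟨⟨ContinuousLinearMap.adjoint J ∘L T.1 ∘L J, trivial⟩, ?_⟩
      refine Eq.trans (Subtype.ext ?_) h
      rfl
  · intro x
    rw [htrJ' x.1 _ rfl, hP]
    change (Module.finrank ℂ H : ℂ)⁻¹ * _ = _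
    rw [hfin]
    field_simp
  · refine Subtype.ext ?_
    ext1 v
    change J (W₁ (coord _ 0 ((star W₂).1 (J (W₁ (coord _ 0 v)))))) = J (W₁ (coord _ 0 v))
    rw [hstarW]
    simp only [ContinuousLinearMap.comp_apply, coord_incl_self, hJ']
    exact congrArg J (DFunLike.congr_fun hW₁' _)
  · refine Subtype.ext ?_
    ext1 v
    change J (ContinuousLinearMap.adjoint J (J (W₁ (coord _ 0 (incl _ 0 (coord _ 0 v))))))
      = J (W₁ (coord _ 0 v))
    rw [hJ', coord_incl_self]
  · have key : ∀ x a, (traceInf τ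
          (star (corner Q (tensorElem (S'.toTracial.A x a) 1) - star W₂ * π (S.toTracial.A x a) * W₂) *
            (corner Q (tensorElem (S'.toTracial.A x a) 1) - star W₂ * π (S.toTracial.A x a) * W₂))).re
        = (Fintype.card (ι' × κ) : ℝ)⁻¹ * hs (opMat u' (S'.A x a) ⊗ₖ (1 : Matrix κ κ ℂ)
          - Wᴴ * opMat u (S.A x a) * W) := by
      intro x a
      let Y : (H' ⊗[ℂ] K) →L[ℂ] (H' ⊗[ℂ] K) := TensorProduct.mapL (S'.A x a) 1
        - ContinuousLinearMap.adjoint W₁ ∘L S.A x a ∘L W₁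
      have hY : ((corner Q (tensorElem (S'.toTracial.A x a) 1)
          - star W₂ * π (S.toTracial.A x a) * W₂ : (amplification Q).toStarSubalgebra) :
          L2 (H' ⊗[ℂ] K) →L[ℂ] L2 (H' ⊗[ℂ] K)) = incl _ 0 ∘L Y ∘L coord _ 0 := by
        ext1 v
        change incl _ 0 (TensorProduct.mapL (S'.A x a) 1 (coord _ 0 v))
          - (star W₂).1 (J (S.A x a (ContinuousLinearMap.adjoint J (J (W₁ (coord _ 0 v))))))
          = incl _ 0 (Y (coord _ 0 v))
        rw [hstarW]
        simp only [ContinuousLinearMap.comp_apply, hJ', Y, _root_.sub_apply, map_sub]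
      rw [htr0 (star Y * Y)]
      · rw [trace_star_mul_self e, hD]
        have : matOf e e Y = opMat u' (S'.A x a) ⊗ₖ (1 : Matrix κ κ ℂ)
            - Wᴴ * opMat u (S.A x a) * W := by
          rw [matOf_sub, opMat_mapL_one, matOf_comp e u, matOf_comp e u, matOf_adjoint, hW₁,
            ← Matrix.mul_assoc]
          rfl
        rw [this, ← Complex.ofReal_inv, ← Complex.ofReal_mul, Complex.ofReal_re]
      · change ContinuousLinearMap.adjoint (Subtype.val _) ∘L (Subtype.val _) = _
        rw [hY, ContinuousLinearMap.adjoint_comp, ContinuousLinearMap.adjoint_comp, adjoint_coord,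
          adjoint_incl]
        ext1 v
        change incl _ 0 (ContinuousLinearMap.adjoint Y (coord _ 0 (incl _ 0 (Y (coord _ 0 v)))))
          = incl _ 0 (ContinuousLinearMap.adjoint Y (Y (coord _ 0 v)))
        rw [coord_incl_self]
    have hc : (0 : ℝ) < Fintype.card (ι' × κ) := by exact_mod_cast Fintype.card_pos
    simp only [key]
    rw [Fintype.sum_prod_type] at h1
    have h4 := mul_le_mul_of_nonneg_left h1 (inv_nonneg.2 hc.le)
    refine le_trans (le_of_eq ?_) (h4.trans (le_of_eq ?_))
    · simp only [Finset.mul_sum]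
      refine Finset.sum_congr rfl fun x _ => Finset.sum_congr rfl fun a _ => ?_
      ring
    · field_simp
  · have e1 : traceInf τ (P - W₂ * star W₂) = D⁻¹ * ((Fintype.card ι - hs W : ℝ) : ℂ) := by
      rw [htrJ' (1 - W₁ ∘L ContinuousLinearMap.adjoint W₁)]
      · rw [trace_eq_trace_matOf u, matOf_sub, matOf_one, matOf_comp u e, matOf_adjoint, hW₁,
          Matrix.trace_sub, Matrix.trace_one]
        have : (W * Wᴴ).trace = (hs W : ℂ) := by
          rw [← hs_conjTranspose, ← trace_conjTranspose_mul_self, conjTranspose_conjTranspose]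
        rw [this]
        push_cast
        rfl
      · ext1 v
        change J (ContinuousLinearMap.adjoint J v) - J (W₁ (coord _ 0 ((star W₂).1 v))) = _
        rw [hstarW]
        simp only [ContinuousLinearMap.comp_apply, coord_incl_self, _root_.sub_apply, map_sub]
        rfl
    have hc : (0 : ℝ) < Fintype.card ι := by exact_mod_cast Fintype.card_pos
    rw [e1, hP, mul_div_mul_left _ _ (inv_ne_zero hD0), ← Complex.ofReal_natCast,
      ← Complex.ofReal_div, Complex.ofReal_re, div_le_iff₀ hc]
    exact h2
  · have hc : (0 : ℝ) < Fintype.card (ι' × κ) := by exact_mod_cast Fintype.card_pos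
    rw [htr0 (1 - ContinuousLinearMap.adjoint W₁ ∘L W₁)]
    · rw [trace_eq_trace_matOf e, matOf_sub, matOf_one, matOf_comp e u, matOf_adjoint, hW₁,
        Matrix.trace_sub, Matrix.trace_one, trace_conjTranspose_mul_self, hD,
        ← Complex.ofReal_natCast, ← Complex.ofReal_sub, ← Complex.ofReal_inv, ← Complex.ofReal_mul,
        Complex.ofReal_re, inv_mul_le_iff₀ hc, mul_comm]
      exact h3
    · ext1 v
      change incl _ 0 (coord _ 0 v) - (star W₂).1 (J (W₁ (coord _ 0 v))) = _
      rw [hstarW]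
      simp only [ContinuousLinearMap.comp_apply, hJ', _root_.sub_apply, map_sub]
      rfl

end Construction

/-! ### Local dilations and matrix partial isometries. -/

section Dilation

variable {X 𝒜 H' H ι ι' : Type*} [Fintype X] [Fintype 𝒜] [Fintype ι] [Fintype ι']
  [NormedAddCommGroup H'] [InnerProductSpace ℂ H'] [FiniteDimensional ℂ H'] [Nontrivial H']
  [NormedAddCommGroup H] [InnerProductSpace ℂ H] [FiniteDimensional ℂ H] [Nontrivial H]

theorem IsProbDist.marginalFst {X Y : Type*} [Fintype X] [Fintype Y] {ν : X × Y → ℝ}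
    (hν : IsProbDist ν) : IsProbDist (marginalFst ν) :=
  ⟨fun _ => Finset.sum_nonneg fun _ _ => hν.1 _, by
    rw [← hν.2, Fintype.sum_prod_type]; rfl⟩

theorem mapL_one_one {E F : Type*} [NormedAddCommGroup E] [InnerProductSpace ℂ E]
    [FiniteDimensional ℂ E] [NormedAddCommGroup F] [InnerProductSpace ℂ F] [FiniteDimensional ℂ F]
    (v : E ⊗[ℂ] F) : TensorProduct.mapL (1 : E →L[ℂ] E) (1 : F →L[ℂ] F) v = v := by
  induction v using TensorProduct.induction_on with
  | zero => simp
  | tmul x y => rfl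
  | add x y hx hy => rw [map_add, hx, hy]

/-- Multiplying the squared norms by `d` puts the inequalities of a local dilation into the form of
`exists_partialIsometry_of_close`, with `δ = d ε²` and `c = √(d/d')`. -/
theorem isVNADilation_of_isLocalDilation {ν : X × X → ℝ} (hν : IsProbDist ν)
    {S' : MEStrategy X 𝒜 H'} {S : MEStrategy X 𝒜 H}
    (u' : OrthonormalBasis ι' ℂ H') (u : OrthonormalBasis ι ℂ H) {ε : ℝ}
    (h : IsLocalDilation (S'.toStrategy u') (S.toStrategy u) ε ν) :
    IsVNADilation S'.toTracial S.toTracial (1700 * ε ^ 2) (marginalFst ν) := by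
  classical
  have hι' : Nonempty ι' := u'.toBasis.index_nonempty
  have hι : Nonempty ι := u.toBasis.index_nonempty
  have hp := hν.marginalFst
  have hA := posSemidef_one_sub_weighted u hp S.povm
  have hA' := posSemidef_one_sub_weighted u' hp S'.povm
  have hd : (0 : ℝ) < Fintype.card ι := by exact_mod_cast Fintype.card_pos
  have hd' : (0 : ℝ) < Fintype.card ι' := by exact_mod_cast Fintype.card_pos
  by_cases hε : 1 ≤ 1700 * ε ^ 2
  -- All three quantities are at most `1` for `W = 0`; the sum of squares of the POVM elements is
  -- bounded by the identity.
  · refine isVNADilation_of_partialIsometry (κ := Unit) u' u S' S _ (W := 0) (by simp) ?_ ?_ ?_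
    · have e1 : ∀ t : X × 𝒜, hs (opMat u' (S'.A t.1 t.2) ⊗ₖ (1 : Matrix Unit Unit ℂ)
          - (0 : Matrix ι (ι' × Unit) ℂ)ᴴ * opMat u (S.A t.1 t.2) * (0 : Matrix ι (ι' × Unit) ℂ))
          = hs (opMat u' (S'.A t.1 t.2) * 1) := fun t => by
        rw [Matrix.mul_zero, sub_zero, hs_kronecker, hs_one, Matrix.mul_one]; simp
      simp only [e1]
      refine (sum_hs_mul_le hA' 1).trans ?_
      rw [hs_one, Fintype.card_prod, Fintype.card_unit, mul_one]
      nlinarith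
    · rw [hs_zero]; nlinarith
    · rw [hs_zero, Fintype.card_prod, Fintype.card_unit, mul_one]; nlinarith
  · push Not at hε
    obtain ⟨KA, _, _, _, KB, _, _, _, VA, VB, aux, haux, h0, h1, -⟩ := h
    let b := stdOrthonormalBasis ℂ KA
    let c := stdOrthonormalBasis ℂ KB
    have hn : ∀ (T : H →L[ℂ] H) (T' : H' →L[ℂ] H'),
        hs (tensorMat u u' b VA.toLinearMap * opMat u T * (tensorMat u u' c VB.toLinearMap)ᵀ
          - ((√(Fintype.card ι) / √(Fintype.card ι') : ℝ) : ℂ) • (opMat u' T' ⊗ₖ vecMat b c aux))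
        = Fintype.card ι * ‖TensorProduct.map VA.toLinearMap VB.toLinearMap
            (TensorProduct.mapL T (1 : H →L[ℂ] H) (maxEntangled u))
          - TensorProduct.tensorTensorTensorComm ℂ H' H' KA KB
            (TensorProduct.mapL T' (1 : H' →L[ℂ] H') (maxEntangled u') ⊗ₜ[ℂ] aux)‖ ^ 2 := by
      intro T T'
      have hs0 : (√(Fintype.card ι) : ℂ) ≠ 0 := by exact_mod_cast (Real.sqrt_pos.2 hd).ne'
      rw [norm_dilation_sq u u' b c]
      have e1 : ∀ r : ℝ, (Fintype.card ι : ℝ) * r = ‖((√(Fintype.card ι) : ℝ) : ℂ)‖ ^ 2 * r := by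
        rw [Complex.norm_real, Real.norm_eq_abs, sq_abs, Real.sq_sqrt hd.le]
        exact fun _ => rfl
      rw [e1, ← hs_smul, smul_sub, smul_smul, smul_smul]
      push_cast
      rw [mul_inv_cancel₀ hs0, one_smul, div_eq_mul_inv]
    have h0' := hn 1 1
    rw [mapL_one_one, mapL_one_one, opMat_one, opMat_one, Matrix.mul_one] at h0'
    have hε0 : 0 ≤ ε := (norm_nonneg _).trans h0
    have h1' := Real.sqrt_le_left hε0 |>.1 h1
    have hc : 0 < √(Fintype.card ι : ℝ) / √(Fintype.card ι') := by positivity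
    obtain ⟨κ, _, _, _, W, hW, r1, r2, r3, r4⟩ := exists_partialIsometry_of_close
      (tensorMat_isometry u u' b VA) (tensorMat_isometry u u' c VB)
      (a := vecMat b c aux) (w := fun t : X × 𝒜 => marginalFst ν t.1) (fun t => hp.1 _)
      (A := fun t => opMat u (S.A t.1 t.2)) (A' := fun t => opMat u' (S'.A t.1 t.2))
      (fun t => (posSemidef_opMat u ((S.povm t.1).1 t.2)).isHermitian) hA hA' hc
      (δ := Fintype.card ι * ε ^ 2) (by nlinarith) (by
        rw [h0']
        refine mul_le_mul_of_nonneg_left ?_ hd.le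
        exact pow_le_pow_left₀ (norm_nonneg _) h0 2) (by
        simp only [hn]
        refine le_trans (le_of_eq ?_) (mul_le_mul_of_nonneg_left h1' hd.le)
        rw [Fintype.sum_prod_type]
        simp only [Finset.mul_sum]
        refine Finset.sum_congr rfl fun x _ => Finset.sum_congr rfl fun a _ => ?_
        rw [mul_left_comm]
        rfl)
    have hk : (Fintype.card (ι' × κ) : ℝ) = Fintype.card ι' * Fintype.card κ := by
      rw [Fintype.card_prod]; push_cast; rfl
    -- Since `4δ` is a small part of `d`, the dimension `d` is at most twice that of the compressed
    -- space. So `72δ` is at most `144 ε²` times the latter, well within `1700 ε²`.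
    have r5 : (Fintype.card ι : ℝ) ≤ 2 * (Fintype.card ι' * Fintype.card κ) := by nlinarith
    refine isVNADilation_of_partialIsometry u' u S' S _ hW ?_ ?_ ?_
    · refine r1.trans ?_
      rw [hk]
      nlinarith [mul_le_mul_of_nonneg_left r5 (sq_nonneg ε)]
    · nlinarith
    · rw [hk]
      nlinarith [mul_le_mul_of_nonneg_left r5 (sq_nonneg ε)]

/-- The inclusion of the coordinate space indexed by `κ`. -/
def inlMat (κ η : Type*) [DecidableEq κ] [DecidableEq η] : Matrix (κ ⊕ η) κ ℂ :=
  Matrix.of fun s m => if s = Sum.inl m then 1 else 0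

/-- The inclusion of the coordinate space indexed by `ι` as a complement of `inlMat`. -/
def inrMat {ι' ι : Type*} (κ : Type*) {η : Type*} [DecidableEq κ] [DecidableEq η] [DecidableEq ι']
    (j : ι') (f : ι ≃ η) : Matrix (ι' × (κ ⊕ η)) ι ℂ :=
  Matrix.of fun p i => if p = (j, Sum.inr (f i)) then 1 else 0

theorem inlMat_isometry (κ η : Type*) [Fintype κ] [Fintype η] [DecidableEq κ] [DecidableEq η] :
    (inlMat κ η)ᴴ * inlMat κ η = 1 := by
  ext i j
  simp [inlMat, Matrix.mul_apply, Matrix.one_apply, eq_comm]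

theorem inrMat_isometry (κ : Type*) {η : Type*} [Fintype κ] [Fintype η] [DecidableEq κ]
    [DecidableEq η] [DecidableEq ι'] [DecidableEq ι] (j : ι') (f : ι ≃ η) :
    (inrMat κ j f)ᴴ * inrMat κ j f = 1 := by
  ext i i'
  rw [Matrix.mul_apply, Finset.sum_eq_single (j, Sum.inr (f i))]
  · simp [inrMat, Matrix.one_apply]
  · intro p _ hp
    simp [inrMat, hp]
  · simp

theorem inlMat_inrMat (κ : Type*) {η : Type*} [Fintype κ] [Fintype η] [DecidableEq κ]
    [DecidableEq η] [DecidableEq ι'] [DecidableEq ι] (j : ι') (f : ι ≃ η) :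
    ((1 : Matrix ι' ι' ℂ) ⊗ₖ inlMat κ η)ᴴ * inrMat κ j f = 0 := by
  ext i i'
  rw [Matrix.mul_apply, Finset.sum_eq_zero]
  · rfl
  · rintro ⟨p, s⟩ -
    cases s <;> simp [inrMat, inlMat]

theorem posSemidef_one_sub_kronecker_one {T κ : Type*} [Fintype T] [Fintype κ] [DecidableEq κ]
    [DecidableEq ι'] {w : T → ℝ} {B : T → Matrix ι' ι' ℂ}
    (hB : (1 - ∑ t, (w t : ℂ) • ((B t)ᴴ * B t)).PosSemidef) :
    (1 - ∑ t, (w t : ℂ) • ((B t ⊗ₖ (1 : Matrix κ κ ℂ))ᴴ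
      * (B t ⊗ₖ (1 : Matrix κ κ ℂ)))).PosSemidef := by
  have : 1 - ∑ t, (w t : ℂ) • ((B t ⊗ₖ (1 : Matrix κ κ ℂ))ᴴ * (B t ⊗ₖ (1 : Matrix κ κ ℂ)))
      = (1 - ∑ t, (w t : ℂ) • ((B t)ᴴ * B t)) ⊗ₖ (1 : Matrix κ κ ℂ) := by
    simp only [conjTranspose_kronecker, conjTranspose_one, ← mul_kronecker_mul, Matrix.mul_one]
    ext i j
    by_cases h : i.2 = j.2
    · simp [Matrix.sum_apply, Matrix.one_apply, Prod.ext_iff, h]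
    · simp [Matrix.sum_apply, Matrix.one_apply, Prod.ext_iff, h]
  rw [this]
  exact hB.kronecker PosSemidef.one

/-- The auxiliary spaces are `ℂ^(κ ⊕ η)`: the summand `κ` carries a maximally entangled `aux`, and
the `d` extra dimensions `η` receive the complement of the range of `W`. The isometries are `V` and
its entrywise conjugate, so that `V_A A V_Bᵀ = V A V*`. The alternative `3 / 4 < ε` is kept because
the bounds extracted from a vNA-dilation degenerate there. -/
theorem isLocalDilation_of_partialIsometry {κ : Type} [Fintype κ] [DecidableEq κ] [Nonempty κ]
    [DecidableEq ι] [DecidableEq ι'] {ν : X × X → ℝ} (hν : IsProbDist ν)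
    (hν_symm : ∀ x y, ν (x, y) = ν (y, x)) (S' : MEStrategy X 𝒜 H') (S : MEStrategy X 𝒜 H)
    (u' : OrthonormalBasis ι' ℂ H') (u : OrthonormalBasis ι ℂ H)
    {W : Matrix ι (ι' × κ) ℂ} (hW : W * Wᴴ * W = W) {ε : ℝ} (hε : 0 ≤ ε)
    (h : 3 / 4 < ε ∨ (Fintype.card ι - hs W ≤ ε * Fintype.card ι ∧
      Fintype.card (ι' × κ) - hs W ≤ ε * Fintype.card (ι' × κ) ∧
      ∑ t : X × 𝒜, marginalFst ν t.1 * hs (opMat u' (S'.A t.1 t.2) ⊗ₖ (1 : Matrix κ κ ℂ)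
        - Wᴴ * opMat u (S.A t.1 t.2) * W) ≤ 4 * ε * Fintype.card (ι' × κ))) :
    IsLocalDilation (S'.toStrategy u') (S.toStrategy u) ((4 + √2) * √ε) ν := by
  have hι' : Nonempty ι' := u'.toBasis.index_nonempty
  have hι : Nonempty ι := u.toBasis.index_nonempty
  have hp := hν.marginalFst
  have hA := posSemidef_one_sub_weighted u hp S.povm
  have hA' := posSemidef_one_sub_weighted u' hp S'.povm
  have hsnd : ∀ x, marginalSnd ν x = marginalFst ν x := fun x =>
    Finset.sum_congr rfl fun y _ => hν_symm y x
  let η := Fin (Fintype.card ι)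
  let f : ι ≃ η := Fintype.equivFin ι
  let K := EuclideanSpace ℂ (κ ⊕ η)
  let b : OrthonormalBasis (κ ⊕ η) ℂ K := EuclideanSpace.basisFun (κ ⊕ η) ℂ
  obtain ⟨p₀, hp₀_def⟩ : ∃ p₀ : Matrix (κ ⊕ η) κ ℂ, p₀ = inlMat κ η := ⟨_, rfl⟩
  have hp₀ : p₀ᴴ * p₀ = 1 := by rw [hp₀_def]; exact inlMat_isometry κ η
  obtain ⟨P, hP_def⟩ : ∃ P : Matrix (ι' × (κ ⊕ η)) (ι' × κ) ℂ, P = (1 : Matrix ι' ι' ℂ) ⊗ₖ p₀ :=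
    ⟨_, rfl⟩
  obtain ⟨Q, hQ_def⟩ : ∃ Q : Matrix (ι' × (κ ⊕ η)) ι ℂ, Q = inrMat κ (Classical.arbitrary ι') f :=
    ⟨_, rfl⟩
  have hP : Pᴴ * P = 1 := by
    simp only [hP_def, conjTranspose_kronecker, conjTranspose_one, ← mul_kronecker_mul, Matrix.mul_one,
      hp₀, one_kronecker_one]
  have hQ : Qᴴ * Q = 1 := by rw [hQ_def]; exact inrMat_isometry κ _ f
  have hPQ : Pᴴ * Q = 0 := by rw [hP_def, hQ_def, hp₀_def]; exact inlMat_inrMat κ _ f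
  obtain ⟨V, hV_def⟩ : ∃ V, V = extendIsometry P Q W := ⟨_, rfl⟩
  have hV : Vᴴ * V = 1 := hV_def ▸ extendIsometry_isometry hP hQ hPQ hW
  have hV' : (Vᴴᵀ)ᴴ * Vᴴᵀ = 1 := by
    have : (Vᴴᵀ)ᴴ = Vᵀ := by ext i j; simp
    rw [this, ← Matrix.transpose_mul, hV, Matrix.transpose_one]
  obtain ⟨VA, hVA⟩ := exists_isometry_of_tensorMat u u' b hV
  obtain ⟨VB, hVB⟩ := exists_isometry_of_tensorMat u u' b hV'
  obtain ⟨aux, haux⟩ := exists_vec_of_matrix b b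
    ((((√(Fintype.card κ : ℝ))⁻¹ : ℝ) : ℂ) • (p₀ * p₀ᴴ))
  have haux1 : ‖aux‖ = 1 := by
    have h1 : ‖aux‖ ^ 2 = 1 := by
      have h2 : hs p₀ = Fintype.card κ := by
        rw [← hs_one (n := κ), ← hs_mul_of_isometry hp₀ 1, Matrix.mul_one]
      rw [norm_sq_eq_hs_vecMat b b, haux, hs_smul, hs_mul_of_isometry hp₀, hs_conjTranspose, h2,
        Complex.norm_real, Real.norm_eq_abs, sq_abs, sq_inv_sqrt_card]
    exact (pow_eq_one_iff_of_nonneg (norm_nonneg _) two_ne_zero).1 h1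
  have hn : ∀ (T : H →L[ℂ] H) (T' : H' →L[ℂ] H'),
      ‖TensorProduct.map VA.toLinearMap VB.toLinearMap
          (TensorProduct.mapL T (1 : H →L[ℂ] H) (maxEntangled u))
        - TensorProduct.tensorTensorTensorComm ℂ H' H' K K
          (TensorProduct.mapL T' (1 : H' →L[ℂ] H') (maxEntangled u') ⊗ₜ[ℂ] aux)‖ ^ 2
      = hs ((((√(Fintype.card ι : ℝ))⁻¹ : ℝ) : ℂ) • (V * opMat u T * Vᴴ)
        - (((√(Fintype.card (ι' × κ) : ℝ))⁻¹ : ℝ) : ℂ) •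
          (P * (opMat u' T' ⊗ₖ (1 : Matrix κ κ ℂ)) * Pᴴ)) := by
    intro T T'
    rw [norm_dilation_sq u u' b b, hVA, hVB, Matrix.transpose_transpose, haux]
    congr 2
    have e1 : P * (opMat u' T' ⊗ₖ (1 : Matrix κ κ ℂ)) * Pᴴ = opMat u' T' ⊗ₖ (p₀ * p₀ᴴ) := by
      simp only [hP_def, conjTranspose_kronecker, conjTranspose_one, ← mul_kronecker_mul,
        Matrix.mul_one, Matrix.one_mul]
    rw [e1, kronecker_smul, smul_smul, ← Complex.ofReal_mul, Fintype.card_prod, Nat.cast_mul,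
      Real.sqrt_mul (Nat.cast_nonneg _), mul_inv]
  have hfam : ∀ {T : Type _} [Fintype T] {w : T → ℝ} {A : T → H →L[ℂ] H} {A' : T → H' →L[ℂ] H'},
      (∀ t, 0 ≤ w t) → (∀ t, (opMat u (A t)).IsHermitian) →
      (1 - ∑ t, (w t : ℂ) • ((opMat u (A t))ᴴ * opMat u (A t))).PosSemidef →
      (1 - ∑ t, (w t : ℂ) • ((opMat u' (A' t))ᴴ * opMat u' (A' t))).PosSemidef →
      (3 / 4 < ε ∨ (Fintype.card ι - hs W ≤ ε * Fintype.card ι ∧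
        Fintype.card (ι' × κ) - hs W ≤ ε * Fintype.card (ι' × κ) ∧
        ∑ t, w t * hs (opMat u' (A' t) ⊗ₖ (1 : Matrix κ κ ℂ)
          - Wᴴ * opMat u (A t) * W) ≤ 4 * ε * Fintype.card (ι' × κ))) →
      √(∑ t, w t * ‖TensorProduct.map VA.toLinearMap VB.toLinearMap
          (TensorProduct.mapL (A t) (1 : H →L[ℂ] H) (maxEntangled u))
        - TensorProduct.tensorTensorTensorComm ℂ H' H' K K
          (TensorProduct.mapL (A' t) (1 : H' →L[ℂ] H') (maxEntangled u') ⊗ₜ[ℂ] aux)‖ ^ 2)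
        ≤ (4 + √2) * √ε := by
    intro T _ w A A' hw hAh hA hA' h
    simp only [hn, hV_def]
    have hB := posSemidef_one_sub_kronecker_one (κ := κ) hA'
    change famNorm w (fun t => (((√(Fintype.card ι : ℝ))⁻¹ : ℝ) : ℂ) •
        (extendIsometry P Q W * opMat u (A t) * (extendIsometry P Q W)ᴴ)
      - (((√(Fintype.card (ι' × κ) : ℝ))⁻¹ : ℝ) : ℂ) •
        (P * (opMat u' (A' t) ⊗ₖ (1 : Matrix κ κ ℂ)) * Pᴴ)) ≤ (4 + √2) * √ε
    -- For `ε > 3/4` one has `√ε ≥ 1/2`, so the trivial bound `2` suffices.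
    rcases h with h | ⟨h1, h2, h3⟩
    · refine (famNorm_extendIsometry_le_two hw hP hQ hPQ hW hA hB).trans ?_
      have e1 : 1 / 2 ≤ √ε := Real.le_sqrt_of_sq_le (by linarith)
      have e2 := Real.sqrt_nonneg 2
      nlinarith
    · exact famNorm_extendIsometry_le hw hP hQ hPQ hW hAh hA h1 h2 h3
  have hmain : √(∑ x, marginalFst ν x * ∑ a, ‖TensorProduct.map VA.toLinearMap VB.toLinearMap
          (TensorProduct.mapL (S.A x a) (1 : H →L[ℂ] H) (maxEntangled u))
        - TensorProduct.tensorTensorTensorComm ℂ H' H' K K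
          (TensorProduct.mapL (S'.A x a) (1 : H' →L[ℂ] H') (maxEntangled u') ⊗ₜ[ℂ] aux)‖ ^ 2)
        ≤ (4 + √2) * √ε := by
    have := hfam (T := X × 𝒜) (w := fun t => marginalFst ν t.1) (A := fun t => S.A t.1 t.2)
      (A' := fun t => S'.A t.1 t.2) (fun t => hp.1 _)
      (fun t => (posSemidef_opMat u ((S.povm t.1).1 t.2)).isHermitian) hA hA' h
    rw [Fintype.sum_prod_type] at this
    simpa only [Finset.mul_sum] using this
  refine ⟨K, inferInstance, inferInstance, inferInstance, K, inferInstance, inferInstance,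
    inferInstance, VA, VB, aux, haux1, ?_, hmain, ?_⟩
  -- The estimate on states is the one-element family `A = A' = 1`, for which the required deviation
  -- is `‖1 - W* W‖² = r - ‖W‖²`, with `r` the dimension of the domain of `W`.
  · have h1 := hfam (T := PUnit) (w := fun _ => 1) (A := fun _ => 1) (A' := fun _ => 1)
      (fun _ => zero_le_one) (fun _ => by rw [opMat_one]; exact isHermitian_one)
      (by simpa [opMat_one] using PosSemidef.zero) (by simpa [opMat_one] using PosSemidef.zero)
      (h.imp_right fun ⟨h1, h2, _⟩ => ⟨h1, h2, by
        have e1 : hs (1 - Wᴴ * W) = Fintype.card (ι' × κ) - hs W := by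
          have := hs_one_sub_of_partialIsometry (partialIsometry_conjTranspose hW)
          rwa [conjTranspose_conjTranspose, hs_conjTranspose] at this
        have e2 : (0 : ℝ) ≤ ε * Fintype.card (ι' × κ) := by positivity
        simp only [opMat_one, one_kronecker_one, Matrix.mul_one, Finset.sum_const,
          Finset.card_univ, Fintype.card_punit, one_smul, one_mul, e1]
        linarith⟩)
    simp only [mapL_one_one, one_mul, Finset.sum_const, Finset.card_univ, Fintype.card_punit,
      one_smul] at h1
    rw [Real.sqrt_sq (norm_nonneg _)] at h1
    exact h1
  · refine le_trans (le_of_eq ?_) hmain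
    congr 1
    refine Finset.sum_congr rfl fun x _ => ?_
    rw [hsnd]
    congr 1
    refine Finset.sum_congr rfl fun a _ => ?_
    change ‖TensorProduct.map _ _ (TensorProduct.mapL 1 (transpose u (S.A x a)) (maxEntangled u))
      - TensorProduct.tensorTensorTensorComm ℂ H' H' K K
        (TensorProduct.mapL 1 (transpose u' (S'.A x a)) (maxEntangled u') ⊗ₜ[ℂ] aux)‖ ^ 2 = _
    rw [mapL_one_transpose_maxEntangled, mapL_one_transpose_maxEntangled]

end Dilation

/-! ### Tensor products of a full matrix algebra with a von Neumann algebra -/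

section Slice

variable {F K ι' : Type*} [NormedAddCommGroup F] [InnerProductSpace ℂ F] [FiniteDimensional ℂ F]
  [NormedAddCommGroup K] [InnerProductSpace ℂ K] [FiniteDimensional ℂ K] [Fintype ι']

/-- The map `k ↦ v ⊗ k`. -/
def tmulLeft (K : Type*) [NormedAddCommGroup K] [InnerProductSpace ℂ K] [FiniteDimensional ℂ K]
    (v : F) : K →L[ℂ] F ⊗[ℂ] K :=
  LinearMap.toContinuousLinearMap (TensorProduct.mk ℂ F K v)

/-- The map `x ⊗ k ↦ ⟨v, x⟩ k`. -/
def slice (K : Type*) [NormedAddCommGroup K] [InnerProductSpace ℂ K] [FiniteDimensional ℂ K]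
    (v : F) : F ⊗[ℂ] K →L[ℂ] K :=
  ContinuousLinearMap.adjoint (tmulLeft K v)

theorem tmulLeft_apply (v : F) (k : K) : tmulLeft K v k = v ⊗ₜ[ℂ] k := rfl

theorem slice_tmul (v x : F) (k : K) : slice K v (x ⊗ₜ[ℂ] k) = (inner ℂ v x : ℂ) • k := by
  refine ext_inner_left ℂ fun w => ?_
  rw [slice, ContinuousLinearMap.adjoint_inner_right, tmulLeft_apply, TensorProduct.inner_tmul,
    inner_smul_right]

theorem sum_tmul_slice (u' : OrthonormalBasis ι' ℂ F) (g : F ⊗[ℂ] K) :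
    ∑ i, u' i ⊗ₜ[ℂ] slice K (u' i) g = g := by
  induction g using TensorProduct.induction_on with
  | zero => simp
  | tmul x k =>
    simp only [slice_tmul, TensorProduct.tmul_smul]
    simp only [TensorProduct.smul_tmul', ← TensorProduct.sum_tmul, u'.sum_repr']
  | add x y hx hy => simp only [map_add, TensorProduct.tmul_add, Finset.sum_add_distrib, hx, hy]

theorem mapL_rankOne_one (v w : F) (g : F ⊗[ℂ] K) :
    TensorProduct.mapL (InnerProductSpace.rankOne ℂ v w) (1 : K →L[ℂ] K) g
      = v ⊗ₜ[ℂ] slice K w g := by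
  induction g using TensorProduct.induction_on with
  | zero => simp
  | tmul x k =>
    rw [TensorProduct.mapL_tmul, slice_tmul, InnerProductSpace.rankOne_apply,
      TensorProduct.smul_tmul]
    rfl
  | add x y hx hy => rw [map_add, map_add, hx, hy, TensorProduct.tmul_add]

/-- The block of an operator on `F ⊗ K` between the copies of `K` indexed by `v` and `w`. -/
def block (v w : F) (T : F ⊗[ℂ] K →L[ℂ] F ⊗[ℂ] K) : K →L[ℂ] K :=
  slice K v ∘L T ∘L tmulLeft K w

theorem block_star (v w : F) (T : F ⊗[ℂ] K →L[ℂ] F ⊗[ℂ] K) :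
    block v w (star T) = star (block w v T) := by
  rw [block, block, slice, slice, ContinuousLinearMap.star_eq_adjoint,
    ContinuousLinearMap.star_eq_adjoint, ContinuousLinearMap.adjoint_comp,
    ContinuousLinearMap.adjoint_comp, ContinuousLinearMap.adjoint_adjoint]
  rfl

theorem block_mul (u' : OrthonormalBasis ι' ℂ F) (v w : F) (S T : F ⊗[ℂ] K →L[ℂ] F ⊗[ℂ] K) :
    block v w (S * T) = ∑ i, block v (u' i) S * block (u' i) w T := by
  ext k : 1
  rw [_root_.sum_apply]
  change slice K v (S (T (tmulLeft K w k)))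
    = ∑ i, slice K v (S (u' i ⊗ₜ[ℂ] slice K (u' i) (T (tmulLeft K w k))))
  rw [← map_sum, ← map_sum, sum_tmul_slice]

theorem sum_mapL_block (u' : OrthonormalBasis ι' ℂ F) (T : F ⊗[ℂ] K →L[ℂ] F ⊗[ℂ] K) :
    T = ∑ i, ∑ j, TensorProduct.mapL (InnerProductSpace.rankOne ℂ (u' i) (u' j))
      (block (u' i) (u' j) T) := by
  have h : ∀ (v w : F) (y : K →L[ℂ] K) (g : F ⊗[ℂ] K),
      TensorProduct.mapL (InnerProductSpace.rankOne ℂ v w) y g = v ⊗ₜ[ℂ] y (slice K w g) := by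
    intro v w y g
    induction g using TensorProduct.induction_on with
    | zero => simp
    | tmul x k =>
      rw [TensorProduct.mapL_tmul, slice_tmul, InnerProductSpace.rankOne_apply,
        TensorProduct.smul_tmul, map_smul]
    | add x y hx hy => rw [map_add, map_add, hx, hy, map_add, TensorProduct.tmul_add]
  ext g : 1
  simp only [_root_.sum_apply, h, ← TensorProduct.tmul_sum]
  have h2 : ∀ i, ∑ j, block (u' i) (u' j) T (slice K (u' j) g) = slice K (u' i) (T g) := fun i => by
    change ∑ j, slice K (u' i) (T (u' j ⊗ₜ[ℂ] slice K (u' j) g)) = _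
    rw [← map_sum, ← map_sum, sum_tmul_slice]
  simp only [h2, sum_tmul_slice]

/-- `T` commutes with `1 ⊗ z` for `z` in the commutant of `M₀`, hence each block commutes with `z`;
the double commutant does the rest. -/
theorem block_mem {M : VonNeumannAlgebra F} {M₀ : VonNeumannAlgebra K}
    {T : F ⊗[ℂ] K →L[ℂ] F ⊗[ℂ] K} (hT : T ∈ tensorAlgebra M M₀) (v w : F) : block v w T ∈ M₀ := by
  rw [← SetLike.mem_coe, ← VonNeumannAlgebra.commutant_commutant M₀, SetLike.mem_coe,
    VonNeumannAlgebra.mem_commutant_iff]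
  intro z hz
  have hz0 : ∀ y ∈ M₀, y * z = z * y := VonNeumannAlgebra.mem_commutant_iff.1 hz
  have hmul : ∀ (a c : F →L[ℂ] F) (b d : K →L[ℂ] K), TensorProduct.mapL a b * TensorProduct.mapL c d
      = TensorProduct.mapL (a * c) (b * d) := fun a c b d =>
    ContinuousLinearMap.coe_injective (TensorProduct.ext' fun x y => rfl)
  have hstar : ∀ (x : F →L[ℂ] F) (y : K →L[ℂ] K),
      star (TensorProduct.mapL x y) = TensorProduct.mapL (star x) (star y) := fun x y => by
    rw [ContinuousLinearMap.star_eq_adjoint, TensorProduct.adjoint_mapL,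
      ContinuousLinearMap.star_eq_adjoint, ContinuousLinearMap.star_eq_adjoint]
  have hcomm : TensorProduct.mapL (1 : F →L[ℂ] F) z * T = T * TensorProduct.mapL 1 z := by
    refine mem_generated_comm hT _ ?_
    rw [StarSubalgebra.mem_centralizer_iff]
    rintro _ ⟨x, hx, y, hy, rfl⟩
    rw [hstar, hmul, hmul, hmul, hmul, hz0 y hy, hz0 _ (star_mem hy)]
    simp
  ext k : 1
  change z (slice K v (T (w ⊗ₜ[ℂ] k))) = slice K v (T (w ⊗ₜ[ℂ] z k))
  have h1 : T (w ⊗ₜ[ℂ] z k) = TensorProduct.mapL (1 : F →L[ℂ] F) z (T (w ⊗ₜ[ℂ] k)) :=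
    (DFunLike.congr_fun hcomm (w ⊗ₜ[ℂ] k)).symm
  rw [h1]
  generalize T (w ⊗ₜ[ℂ] k) = g
  induction g using TensorProduct.induction_on with
  | zero => simp
  | tmul x y => rw [TensorProduct.mapL_tmul, slice_tmul, slice_tmul, map_smul]; rfl
  | add x y hx hy => simp only [map_add, hx, hy]

/-- `B(F) ⊗ M₀` consists of matrices over `M₀`, on which the product trace is the average of `τ₀`
over the diagonal. In this form its positivity and faithfulness are inherited from `τ₀`. -/
theorem tensorTrace_eq_sum_block [DecidableEq ι'] (u' : OrthonormalBasis ι' ℂ F)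
    {M₀ : VonNeumannAlgebra K} (τ₀ : M₀.toStarSubalgebra →ₗ[ℂ] ℂ)
    (T : (tensorAlgebra (fullAlgebra F) M₀).toStarSubalgebra) :
    tensorTrace (normalizedTrace F) τ₀ T = (Fintype.card ι' : ℂ)⁻¹ *
      ∑ i, τ₀ ⟨block (u' i) (u' i) T.1, block_mem T.2 _ _⟩ := by
  have h : T = ∑ i, ∑ j, tensorElem (M := fullAlgebra F)
      ⟨InnerProductSpace.rankOne ℂ (u' i) (u' j), trivial⟩
      (⟨block (u' i) (u' j) T.1, block_mem T.2 _ _⟩ : M₀.toStarSubalgebra) := by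
    refine Subtype.ext ?_
    simp only [AddSubmonoidClass.coe_finsetSum]
    exact sum_mapL_block u' T.1
  have htr : ∀ i j, normalizedTrace F ⟨InnerProductSpace.rankOne ℂ (u' i) (u' j), trivial⟩
      = (Fintype.card ι' : ℂ)⁻¹ * if i = j then 1 else 0 := fun i j => by
    change (Module.finrank ℂ F : ℂ)⁻¹ * LinearMap.trace ℂ F _ = _
    rw [InnerProductSpace.trace_rankOne, orthonormal_iff_ite.1 u'.orthonormal,
      Module.finrank_eq_card_basis u'.toBasis]
    simp only [eq_comm]
  conv_lhs => rw [h]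
  simp only [map_sum, tensorTrace_tensorElem, htr, Finset.mul_sum]
  refine Finset.sum_congr rfl fun i _ => ?_
  rw [Finset.sum_eq_single i]
  · simp
  · intro j _ hj
    simp [hj.symm]
  · simp

theorem isTracialState_tensorTrace [Nontrivial F] {M₀ : VonNeumannAlgebra K}
    {τ₀ : M₀.toStarSubalgebra →ₗ[ℂ] ℂ} (h₀ : IsTracialState τ₀) :
    IsTracialState (tensorTrace (normalizedTrace F) τ₀) := by
  classical
  let u' := stdOrthonormalBasis ℂ F
  have hι : Nonempty (Fin (Module.finrank ℂ F)) := u'.toBasis.index_nonempty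
  let B : (tensorAlgebra (fullAlgebra F) M₀).toStarSubalgebra → Fin (Module.finrank ℂ F) →
      Fin (Module.finrank ℂ F) → M₀.toStarSubalgebra := fun T i j =>
    ⟨block (u' i) (u' j) T.1, block_mem T.2 _ _⟩
  have hc : (0 : ℝ) < (Fintype.card (Fin (Module.finrank ℂ F)) : ℝ)⁻¹ :=
    inv_pos.2 (by exact_mod_cast Fintype.card_pos)
  have hcc : (Fintype.card (Fin (Module.finrank ℂ F)) : ℂ)⁻¹
      = (((Fintype.card (Fin (Module.finrank ℂ F)) : ℝ)⁻¹ : ℝ) : ℂ) := by push_cast; rfl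
  have hB : ∀ T, tensorTrace (normalizedTrace F) τ₀ T
      = (((Fintype.card (Fin (Module.finrank ℂ F)) : ℝ)⁻¹ : ℝ) : ℂ) * ∑ i, τ₀ (B T i i) := fun T => by
    rw [← hcc]
    exact tensorTrace_eq_sum_block u' τ₀ T
  have hmul : ∀ S T i j, B (S * T) i j = ∑ k, B S i k * B T k j := fun S T i j =>
    Subtype.ext (by
      simp only [AddSubmonoidClass.coe_finsetSum]
      exact block_mul u' _ _ S.1 T.1)
  have hstar : ∀ T i j, B (star T) i j = star (B T j i) := fun T i j =>
    Subtype.ext (block_star _ _ T.1)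
  have hpos : ∀ T, tensorTrace (normalizedTrace F) τ₀ (star T * T)
      = (((Fintype.card (Fin (Module.finrank ℂ F)) : ℝ)⁻¹ *
        ∑ i, ∑ k, (τ₀ (star (B T k i) * B T k i)).re : ℝ) : ℂ) := fun T => by
    rw [hB]
    simp only [hmul, hstar, map_sum]
    push_cast
    congr 1
    refine Finset.sum_congr rfl fun i _ => Finset.sum_congr rfl fun k _ => ?_
    exact Complex.ext rfl ((h₀.nonneg _).1.trans (Complex.ofReal_im _).symm)
  refine ⟨?_, fun S T => ?_, fun T => ?_, fun T hT => ?_⟩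
  · have h1 : (1 : (tensorAlgebra (fullAlgebra F) M₀).toStarSubalgebra)
        = tensorElem (1 : (fullAlgebra F).toStarSubalgebra) (1 : M₀.toStarSubalgebra) :=
      Subtype.ext (ContinuousLinearMap.ext fun g => (mapL_one_one g).symm)
    rw [h1, tensorTrace_tensorElem, h₀.map_one, isTracialState_normalizedTrace.map_one, mul_one]
  · rw [hB, hB]
    simp only [hmul, map_sum]
    rw [Finset.sum_comm]
    simp only [h₀.map_mul_comm]
  · rw [hpos]
    refine ⟨Complex.ofReal_im _, ?_⟩
    rw [Complex.ofReal_re]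
    exact mul_nonneg hc.le (Finset.sum_nonneg fun i _ => Finset.sum_nonneg fun k _ =>
      (h₀.nonneg _).2)
  · rw [hpos, Complex.ofReal_eq_zero, mul_eq_zero] at hT
    have hT := hT.resolve_left hc.ne'
    rw [Finset.sum_eq_zero_iff_of_nonneg fun i _ => Finset.sum_nonneg fun k _ =>
      (h₀.nonneg _).2] at hT
    have hz : ∀ i k, B T k i = 0 := fun i k => by
      have h1 := hT i (Finset.mem_univ i)
      rw [Finset.sum_eq_zero_iff_of_nonneg fun k _ => (h₀.nonneg _).2] at h1
      exact h₀.faithful _ (Complex.ext (h1 k (Finset.mem_univ k)) (h₀.nonneg _).1)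
    refine Subtype.ext ?_
    rw [sum_mapL_block u' T.1]
    refine Finset.sum_eq_zero fun i _ => Finset.sum_eq_zero fun j _ => ?_
    rw [show block (u' i) (u' j) T.1 = 0 from congrArg Subtype.val (hz j i)]
    refine ContinuousLinearMap.coe_injective (TensorProduct.ext' fun x y => ?_)
    change InnerProductSpace.rankOne ℂ (u' i) (u' j) x ⊗ₜ[ℂ] (0 : K →L[ℂ] K) y = 0
    simp

/-- A nonzero subspace of `F ⊗ K` invariant under all `T ⊗ 1` is `F ⊗ K₁`. -/
theorem exists_orthonormal_of_invariant [Nonempty ι'] (u' : OrthonormalBasis ι' ℂ F)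
    {L : Submodule ℂ (F ⊗[ℂ] K)}
    (hL : ∀ (T : F →L[ℂ] F), ∀ g ∈ L, TensorProduct.mapL T (1 : K →L[ℂ] K) g ∈ L) (hne : L ≠ ⊥) :
    ∃ (n : ℕ) (k : Fin n → K), 0 < n ∧ Orthonormal ℂ k ∧ (∀ j m, u' j ⊗ₜ[ℂ] k m ∈ L) ∧
      ∀ g ∈ L, g = ∑ p : ι' × Fin n, (inner ℂ (u' p.1 ⊗ₜ[ℂ] k p.2) g : ℂ) • u' p.1 ⊗ₜ[ℂ] k p.2 := by
  classical
  let j₀ : ι' := Classical.arbitrary ι'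
  -- The matrix units `|u'_j⟩⟨u'_i| ⊗ 1` carry any slice of a vector of `L` to any position, so the
  -- space of slices does not depend on the chosen index `j₀`.
  let K₁ : Submodule ℂ K := L.comap (TensorProduct.mk ℂ F K (u' j₀))
  let b := stdOrthonormalBasis ℂ K₁
  have hK₁ : ∀ j k, k ∈ K₁ → u' j ⊗ₜ[ℂ] k ∈ L := fun j k hk => by
    have h1 := hL (InnerProductSpace.rankOne ℂ (u' j) (u' j₀)) _ hk
    rw [mapL_rankOne_one] at h1
    change u' j ⊗ₜ[ℂ] slice K (u' j₀) (u' j₀ ⊗ₜ[ℂ] k) ∈ L at h1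
    rwa [slice_tmul, orthonormal_iff_ite.1 u'.orthonormal, if_pos rfl, one_smul] at h1
  have hsl : ∀ j, ∀ g ∈ L, slice K (u' j) g ∈ K₁ := fun j g hg => by
    have h1 := hL (InnerProductSpace.rankOne ℂ (u' j₀) (u' j)) g hg
    rwa [mapL_rankOne_one] at h1
  have hexp : ∀ g ∈ L, g = ∑ p : ι' × Fin (Module.finrank ℂ K₁),
      (inner ℂ (u' p.1 ⊗ₜ[ℂ] (b p.2 : K)) g : ℂ) • u' p.1 ⊗ₜ[ℂ] (b p.2 : K) := fun g hg => by
    rw [Fintype.sum_prod_type]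
    conv_lhs => rw [← sum_tmul_slice u' g]
    refine Finset.sum_congr rfl fun j _ => ?_
    have h1 := b.sum_repr' ⟨slice K (u' j) g, hsl j g hg⟩
    have h2 := congrArg Subtype.val h1
    simp only [AddSubmonoidClass.coe_finsetSum, Submodule.coe_smul, Submodule.coe_inner] at h2
    conv_lhs => rw [← h2]
    rw [TensorProduct.tmul_sum]
    refine Finset.sum_congr rfl fun m _ => ?_
    rw [TensorProduct.tmul_smul, slice, ContinuousLinearMap.adjoint_inner_right, tmulLeft_apply]
  refine ⟨_, fun m => (b m : K), ?_, ?_, fun j m => hK₁ j _ (b m).2, hexp⟩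
  · by_contra h0
    refine hne ((Submodule.eq_bot_iff _).2 fun g hg => ?_)
    rw [hexp g hg]
    refine Finset.sum_eq_zero fun p _ => ?_
    exact absurd p.2.pos (by simpa using h0)
  · exact b.orthonormal.comp_linearIsometry K₁.subtypeₗᵢ

end Slice

/-! ### The trace on the amplification -/

section AmplifiedTrace

variable {G : Type*} [NormedAddCommGroup G] [InnerProductSpace ℂ G] [FiniteDimensional ℂ G]
  {Q : VonNeumannAlgebra G} {τ : Q.toStarSubalgebra →ₗ[ℂ] ℂ}

/-- On a finite-dimensional space `τ` is a finite combination of matrix coefficients, so weak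
convergence of a series is enough to sum its traces. -/
theorem hasSum_of_hasSum_inner (τ : Q.toStarSubalgebra →ₗ[ℂ] ℂ) {F : ℕ → Q.toStarSubalgebra}
    {x : Q.toStarSubalgebra}
    (h : ∀ g g' : G, HasSum (fun i => (inner ℂ g ((F i).1 g') : ℂ)) (inner ℂ g (x.1 g'))) :
    HasSum (fun i => τ (F i)) (τ x) := by
  obtain ⟨f, hf⟩ := exists_extension τ
  let e := stdOrthonormalBasis ℂ G
  have hT : ∀ y : Q.toStarSubalgebra, τ y = ∑ a, ∑ b, (inner ℂ (e a) (y.1 (e b)) : ℂ)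
      * f (InnerProductSpace.rankOne ℂ (e a) (e b) : G →L[ℂ] G) := fun y => by
    have h1 : ((y : G →L[ℂ] G) : G →ₗ[ℂ] G) = ∑ a, ∑ b, (inner ℂ (e a) (y.1 (e b)) : ℂ) •
        ((InnerProductSpace.rankOne ℂ (e a) (e b) : G →L[ℂ] G) : G →ₗ[ℂ] G) := by
      refine e.toBasis.ext fun c => ?_
      rw [e.coe_toBasis]
      simp only [LinearMap.sum_apply, LinearMap.smul_apply, ContinuousLinearMap.coe_coe,
        InnerProductSpace.rankOne_apply, orthonormal_iff_ite.1 e.orthonormal]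
      simp [e.sum_repr']
    rw [← hf, h1]
    simp only [map_sum, map_smul, smul_eq_mul]
  simp only [hT]
  exact hasSum_sum fun a _ => hasSum_sum fun b _ => (h _ _).mul_right _

/-- The functional `τ` evaluated on the compression of an operator to the corner. -/
def cornerTrace (τ : Q.toStarSubalgebra →ₗ[ℂ] ℂ) :
    (amplification Q).toStarSubalgebra →ₗ[ℂ] ℂ where
  toFun T := τ ⟨entry 0 0 T.1, entry_mem_of_mem_amplification T.2 0 0⟩
  map_add' S T := by
    rw [← map_add]
    exact congrArg τ (Subtype.ext (ContinuousLinearMap.ext fun g =>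
      map_add (coord G 0) (S.1 (incl G 0 g)) (T.1 (incl G 0 g))))
  map_smul' c T := by
    rw [← map_smul]
    exact congrArg τ (Subtype.ext (ContinuousLinearMap.ext fun g =>
      map_smul (coord G 0) c (T.1 (incl G 0 g))))

variable {S T : (amplification Q).toStarSubalgebra}

theorem apply_of_mul_corner (h : S * corner Q 1 = S) (g : L2 G) :
    S.1 (incl G 0 (coord G 0 g)) = S.1 g :=
  DFunLike.congr_fun (congrArg Subtype.val h) g

theorem incl_coord_of_corner_mul (h : corner Q 1 * S = S) (g : L2 G) :
    incl G 0 (coord G 0 (S.1 g)) = S.1 g :=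
  DFunLike.congr_fun (congrArg Subtype.val h) g

theorem star_corner_one : star (corner Q 1) = corner Q 1 := by
  refine Subtype.ext ?_
  change ContinuousLinearMap.adjoint (incl G 0 ∘L (1 : G →L[ℂ] G) ∘L coord G 0) = _
  rw [ContinuousLinearMap.adjoint_comp, ContinuousLinearMap.adjoint_comp, adjoint_coord,
    adjoint_incl, ← ContinuousLinearMap.star_eq_adjoint, star_one]
  rfl

theorem corner_mul_corner (x y : Q.toStarSubalgebra) :
    corner Q x * corner Q y = corner Q (x * y) := by
  refine Subtype.ext (ContinuousLinearMap.ext fun g => ?_)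
  change incl G 0 (x.1 (coord G 0 (incl G 0 (y.1 (coord G 0 g))))) = incl G 0 (x.1 (y.1 (coord G 0 g)))
  rw [coord_incl_self]

theorem traceInf_eq_cornerTrace (h : S * corner Q 1 = S) : traceInf τ S = cornerTrace τ S := by
  rw [traceInf, tsum_eq_single 0]
  · rfl
  · intro i hi
    have h0 : entry i i S.1 = 0 := by
      ext g : 1
      change coord G i (S.1 (incl G i g)) = 0
      rw [← apply_of_mul_corner h, coord_incl_of_ne hi.symm, map_zero, map_zero, map_zero]
    have h1 : (⟨entry i i S.1, entry_mem_of_mem_amplification S.2 i i⟩ : Q.toStarSubalgebra) = 0 :=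
      Subtype.ext h0
    rw [h1, map_zero]

theorem traceInf_smul (c : ℂ) : traceInf τ (c • S) = c * traceInf τ S := by
  rw [traceInf, traceInf, ← tsum_mul_left]
  refine tsum_congr fun i => ?_
  rw [← smul_eq_mul, ← map_smul]
  exact congrArg τ (Subtype.ext (ContinuousLinearMap.ext fun g =>
    map_smul (coord G i) c (S.1 (incl G i g))))

/-- Traciality of `τ^∞` in the one case needed. If `s_i` are the entries of the `0`-th column of
`S`, then the left side is `∑ τ(s_i s_i*) = ∑ τ(s_i* s_i)`, and `∑ s_i* s_i` converges weakly to the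
corner entry of `S* S`. -/
theorem traceInf_mul_star (hτ : IsTracialState τ) (h : S * corner Q 1 = S) :
    traceInf τ (S * star S) = cornerTrace τ (star S * S) := by
  let s : ℕ → Q.toStarSubalgebra := fun i => ⟨entry i 0 S.1, entry_mem_of_mem_amplification S.2 i 0⟩
  have hstar : ∀ i, ContinuousLinearMap.adjoint (entry i 0 S.1)
      = coord G 0 ∘L ContinuousLinearMap.adjoint S.1 ∘L incl G i := fun i => by
    rw [entry, ContinuousLinearMap.adjoint_comp, ContinuousLinearMap.adjoint_comp, adjoint_coord,
      adjoint_incl]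
    rfl
  have h1 : ∀ i, τ ⟨entry i i (S * star S).1, entry_mem_of_mem_amplification (S * star S).2 i i⟩
      = τ (star (s i) * s i) := fun i => by
    rw [hτ.map_mul_comm]
    congr 1
    refine Subtype.ext (ContinuousLinearMap.ext fun g => ?_)
    change coord G i (S.1 (ContinuousLinearMap.adjoint S.1 (incl G i g)))
      = coord G i (S.1 (incl G 0 (ContinuousLinearMap.adjoint (entry i 0 S.1) g)))
    rw [hstar]
    change _ = coord G i (S.1 (incl G 0 (coord G 0 (ContinuousLinearMap.adjoint S.1 (incl G i g)))))
    rw [apply_of_mul_corner h]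
  rw [traceInf]
  simp only [h1]
  refine (hasSum_of_hasSum_inner τ fun g g' => ?_).tsum_eq
  have h2 := lp.hasSum_inner (𝕜 := ℂ) (S.1 (incl G 0 g)) (S.1 (incl G 0 g'))
  have h3 : ∀ i, (inner ℂ g ((star (s i) * s i).1 g') : ℂ)
      = inner ℂ (S.1 (incl G 0 g) i) (S.1 (incl G 0 g') i) := fun i => by
    change inner ℂ g (ContinuousLinearMap.adjoint (entry i 0 S.1) (entry i 0 S.1 g')) = _
    rw [ContinuousLinearMap.adjoint_inner_right]
    rfl
  have h4 : (inner ℂ g (entry 0 0 (star S * S).1 g') : ℂ)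
      = inner ℂ (S.1 (incl G 0 g)) (S.1 (incl G 0 g')) := by
    change inner ℂ g (coord G 0 (ContinuousLinearMap.adjoint S.1 (S.1 (incl G 0 g')))) = _
    rw [← inner_incl_left, ContinuousLinearMap.adjoint_inner_right]
  simp only [h3, h4]
  exact h2

theorem cornerTrace_mul_comm (hτ : IsTracialState τ) (h : S * corner Q 1 = S)
    (h' : corner Q 1 * S = S) : cornerTrace τ (S * T) = cornerTrace τ (T * S) := by
  let e : (amplification Q).toStarSubalgebra → Q.toStarSubalgebra := fun T =>
    ⟨entry 0 0 T.1, entry_mem_of_mem_amplification T.2 0 0⟩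
  have h1 : e (S * T) = e S * e T := Subtype.ext (ContinuousLinearMap.ext fun g =>
    congrArg (coord G 0) (apply_of_mul_corner h (T.1 (incl G 0 g))).symm)
  have h2 : e (T * S) = e T * e S := Subtype.ext (ContinuousLinearMap.ext fun g =>
    congrArg (fun z => coord G 0 (T.1 z)) (incl_coord_of_corner_mul h' (incl G 0 g)).symm)
  change τ (e (S * T)) = τ (e (T * S))
  rw [h1, h2, hτ.map_mul_comm]

theorem cornerTrace_star_mul_self (hτ : IsTracialState τ) (h : corner Q 1 * S = S) :
    (cornerTrace τ (star S * S)).im = 0 ∧ 0 ≤ (cornerTrace τ (star S * S)).re := by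
  let s : Q.toStarSubalgebra := ⟨entry 0 0 S.1, entry_mem_of_mem_amplification S.2 0 0⟩
  have hstar : ContinuousLinearMap.adjoint (entry 0 0 S.1)
      = coord G 0 ∘L ContinuousLinearMap.adjoint S.1 ∘L incl G 0 := by
    rw [entry, ContinuousLinearMap.adjoint_comp, ContinuousLinearMap.adjoint_comp, adjoint_coord,
      adjoint_incl]
    rfl
  have h1 : cornerTrace τ (star S * S) = τ (star s * s) := by
    change τ _ = _
    congr 1
    refine Subtype.ext (ContinuousLinearMap.ext fun g => ?_)
    change coord G 0 (ContinuousLinearMap.adjoint S.1 (S.1 (incl G 0 g)))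
      = ContinuousLinearMap.adjoint (entry 0 0 S.1) (coord G 0 (S.1 (incl G 0 g)))
    rw [hstar]
    change _ = coord G 0 (ContinuousLinearMap.adjoint S.1 (incl G 0 (coord G 0 (S.1 (incl G 0 g)))))
    rw [incl_coord_of_corner_mul h]
  rw [h1]
  exact hτ.nonneg s

theorem cornerTrace_corner (x : Q.toStarSubalgebra) : cornerTrace τ (corner Q x) = τ x := by
  refine congrArg τ (Subtype.ext (ContinuousLinearMap.ext fun g => ?_))
  change coord G 0 (incl G 0 (x.1 (coord G 0 (incl G 0 g)))) = x.1 g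
  rw [coord_incl_self, coord_incl_self]

section Units

variable {f : (amplification Q).toStarSubalgebra} {r : Type*} [Fintype r] [DecidableEq r]
  {v : r → (amplification Q).toStarSubalgebra}

theorem cornerTrace_mul_star (hτ : IsTracialState τ) (h : corner Q 1 * S = S) :
    cornerTrace τ (S * star S) = traceInf τ (star S * S) := by
  have h1 := traceInf_mul_star hτ (S := star S)
    (by rw [← star_corner_one, ← star_mul, h])
  rw [star_star] at h1
  exact h1.symm

/-- The projection `f = w* w` has the trace of the projection `w w*`, which lies in the corner `Q`.
-/
theorem traceInf_nonneg_of_unit (hτ : IsTracialState τ) {w : (amplification Q).toStarSubalgebra}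
    (hw : corner Q 1 * w = w) (hwf : w * f = w) (hww : star w * w = f) :
    (traceInf τ f).im = 0 ∧ 0 ≤ (traceInf τ f).re := by
  have h1 : star (w * star w) * (w * star w) = w * star w := by
    rw [star_mul, star_star, mul_assoc, ← mul_assoc (star w), hww, ← mul_assoc, hwf]
  rw [← hww, ← cornerTrace_mul_star hτ hw, ← h1]
  exact cornerTrace_star_mul_self hτ (by rw [← mul_assoc, hw])

/-- The projections `v_l v_l*` are orthogonal and lie under the unit `I` of the corner. With `z`
their sum, `D (I - z) D* ≥ 0`; each `D v_l v_l* D*` has trace `n_l τ^∞(f)`, and `τ(D D*) = τ(D* D)`.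
-/
theorem traceInf_mul_sum_le (hτ : IsTracialState τ) (hv : ∀ l, corner Q 1 * v l = v l)
    (hvf : ∀ l, v l * f = v l) (hvv : ∀ l m, star (v l) * v m = if l = m then f else 0)
    {D : (amplification Q).toStarSubalgebra} (hD : corner Q 1 * D = D) (hD' : D * corner Q 1 = D)
    {n : r → ℝ} (hn : ∀ l, star (D * v l) * (D * v l) = (n l : ℂ) • f) :
    (traceInf τ f).re * ∑ l, n l ≤ (cornerTrace τ (star D * D)).re := by
  have hII : corner Q 1 * corner Q 1 = corner Q 1 := by rw [corner_mul_corner, one_mul]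
  obtain ⟨z, hz⟩ : ∃ z, z = ∑ l, v l * star (v l) := ⟨_, rfl⟩
  have hzs : star z = z := by simp [hz]
  have hIz : corner Q 1 * z = z := by
    rw [hz, Finset.mul_sum]
    exact Finset.sum_congr rfl fun l _ => by rw [← mul_assoc, hv]
  have hzI : z * corner Q 1 = z := by
    have := congrArg star hIz
    rwa [star_mul, hzs, star_corner_one] at this
  have hzz : z * z = z := by
    conv_lhs => rw [hz, Finset.sum_mul]
    conv_rhs => rw [hz]
    refine Finset.sum_congr rfl fun l _ => ?_
    rw [Finset.mul_sum, Finset.sum_eq_single l]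
    · rw [mul_assoc, ← mul_assoc (star (v l)), hvv, if_pos rfl, ← mul_assoc, hvf]
    · intro m _ hm
      rw [mul_assoc, ← mul_assoc (star (v l)), hvv, if_neg hm.symm, zero_mul, mul_zero]
    · simp
  have h1 : star ((corner Q 1 - z) * star D) * ((corner Q 1 - z) * star D)
      = D * star D - ∑ l, (D * v l) * star (D * v l) := by
    have h2 : (corner Q 1 - z) * (corner Q 1 - z) = corner Q 1 - z := by
      rw [mul_sub, sub_mul, sub_mul, hII, hzI, hIz, hzz, sub_self, sub_zero]
    rw [star_mul, star_star, star_sub, star_corner_one, hzs, mul_assoc, ← mul_assoc (_ - z), h2,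
      sub_mul, mul_sub, ← mul_assoc D, hD', hz, Finset.sum_mul, Finset.mul_sum]
    congr 1
    refine Finset.sum_congr rfl fun l _ => ?_
    simp only [star_mul, mul_assoc]
  have h3 := (cornerTrace_star_mul_self hτ (S := (corner Q 1 - z) * star D)
    (by rw [← mul_assoc, mul_sub, hII, hIz])).2
  rw [h1, map_sub, map_sum] at h3
  have h4 : ∀ l, cornerTrace τ ((D * v l) * star (D * v l)) = (n l : ℂ) * traceInf τ f := fun l => by
    rw [cornerTrace_mul_star hτ (by rw [← mul_assoc, hD]), hn, traceInf_smul]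
  simp only [h4] at h3
  rw [← cornerTrace_mul_comm hτ hD' hD, Finset.mul_sum]
  rw [Complex.sub_re, Complex.re_sum, sub_nonneg] at h3
  refine le_trans (le_of_eq (Finset.sum_congr rfl fun l _ => ?_)) h3
  rw [Complex.re_ofReal_mul, mul_comm]

end Units

end AmplifiedTrace

/-! ### Extracting a matrix from a partial isometry of the amplification -/

section Extraction

variable {G H ι : Type*} [NormedAddCommGroup G] [InnerProductSpace ℂ G] [FiniteDimensional ℂ G]
  [NormedAddCommGroup H] [InnerProductSpace ℂ H] [FiniteDimensional ℂ H] [Fintype ι]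
  {Q : VonNeumannAlgebra G} {τ : Q.toStarSubalgebra →ₗ[ℂ] ℂ}
  {ψ : (H →L[ℂ] H) →⋆ₙₐ[ℂ] (amplification Q).toStarSubalgebra} {h : H} {ξ : L2 G}

theorem rankOne_mul_rankOne (a b c d : H) :
    InnerProductSpace.rankOne ℂ a b * InnerProductSpace.rankOne ℂ c d
      = (inner ℂ b c : ℂ) • (InnerProductSpace.rankOne ℂ a d : H →L[ℂ] H) :=
  InnerProductSpace.rankOne_comp_rankOne a b c d

theorem star_rankOne (a b : H) : star (InnerProductSpace.rankOne ℂ a b : H →L[ℂ] H)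
    = InnerProductSpace.rankOne ℂ b a :=
  InnerProductSpace.adjoint_rankOne a b

theorem inner_apply_apply (S T : (amplification Q).toStarSubalgebra) (a b : L2 G) :
    (inner ℂ (S.1 a) (T.1 b) : ℂ) = inner ℂ a ((star S * T).1 b) :=
  (ContinuousLinearMap.adjoint_inner_right S.1 a (T.1 b)).symm

/-- The vector `ξ` is a unit vector in the range of the projection `ψ |h⟩⟨h|`, which is minimal. -/
structure IsMinimalVector (ψ : (H →L[ℂ] H) →⋆ₙₐ[ℂ] (amplification Q).toStarSubalgebra) (h : H)
    (ξ : L2 G) : Prop where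
  norm_left : ‖h‖ = 1
  apply_self : (ψ (InnerProductSpace.rankOne ℂ h h)).1 ξ = ξ
  star_mul_eq : ∀ S T : (amplification Q).toStarSubalgebra,
    S * ψ (InnerProductSpace.rankOne ℂ h h) = S → T * ψ (InnerProductSpace.rankOne ℂ h h) = T →
    star S * T = (inner ℂ (S.1 ξ) (T.1 ξ) : ℂ) • ψ (InnerProductSpace.rankOne ℂ h h)
  norm_right : ‖ξ‖ = 1

/-- For `e = |h⟩⟨h|` and `f = ψ e`, the algebra `f Q^∞ f` lies in the corner `ψ(B(H))` and equals
`ψ(e B(H) e) = ℂ f`. So `S* T` is a multiple of `f` when `S`, `T` lie in `Q^∞ f`, and evaluating at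
a unit vector of the range of `f` identifies the scalar. -/
theorem exists_isMinimalVector (hψ : Function.Injective ψ)
    (hrange : ∀ T, ψ 1 * T * ψ 1 = T → ∃ x, ψ x = T) (hh : ‖h‖ = 1) :
    ∃ ξ, IsMinimalVector ψ h ξ := by
  obtain ⟨e, he⟩ : ∃ e : H →L[ℂ] H, e = InnerProductSpace.rankOne ℂ h h := ⟨_, rfl⟩
  have hhh : (inner ℂ h h : ℂ) = 1 := by rw [inner_self_eq_norm_sq_to_K, hh]; simp
  have hee : e * e = e := by rw [he, rankOne_mul_rankOne, hhh, one_smul]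
  have hes : star e = e := by rw [he, star_rankOne]
  have hff : ψ e * ψ e = ψ e := by rw [← map_mul, hee]
  have hfs : star (ψ e) = ψ e := by rw [← map_star, hes]
  have he0 : e ≠ 0 := by
    rw [he, Ne, InnerProductSpace.rankOne_eq_zero, or_self]
    rintro rfl
    simp at hh
  have hf0 : (ψ e).1 ≠ 0 := fun h0 => he0 (hψ ((Subtype.ext h0).trans (map_zero ψ).symm))
  obtain ⟨v, hv⟩ : ∃ v, (ψ e).1 v ≠ 0 := by
    by_contra! h0
    exact hf0 (ContinuousLinearMap.ext h0)
  have hffv : ∀ w, (ψ e).1 ((ψ e).1 w) = (ψ e).1 w := fun w =>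
    DFunLike.congr_fun (congrArg Subtype.val hff) w
  have hξ : (ψ e).1 (((‖(ψ e).1 v‖⁻¹ : ℝ) : ℂ) • (ψ e).1 v)
      = ((‖(ψ e).1 v‖⁻¹ : ℝ) : ℂ) • (ψ e).1 v := by
    rw [map_smul, hffv]
  have hξ1 : ‖((‖(ψ e).1 v‖⁻¹ : ℝ) : ℂ) • (ψ e).1 v‖ = 1 := by
    rw [norm_smul, Complex.norm_real, norm_inv, norm_norm, inv_mul_cancel₀ (norm_ne_zero_iff.2 hv)]
  generalize ((‖(ψ e).1 v‖⁻¹ : ℝ) : ℂ) • (ψ e).1 v = ξ at hξ hξ1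
  refine ⟨ξ, hh, he ▸ hξ, ?_, hξ1⟩
  rw [← he]
  intro S T hS hT
  have hST : star S * T = ψ e * (star S * T) * ψ e := by
    rw [mul_assoc, mul_assoc, hT, ← mul_assoc]
    conv_lhs => rw [← hS, star_mul, hfs]
  obtain ⟨x, hx⟩ := hrange (star S * T) (by
    rw [hST]
    simp only [← mul_assoc, ← map_mul, one_mul]
    simp only [mul_assoc, ← map_mul, mul_one])
  have h1 : star S * T = (inner ℂ h (x h) : ℂ) • ψ e := by
    rw [hST, ← hx, ← map_mul, ← map_mul, ← map_smul]
    congr 1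
    rw [he]
    refine ContinuousLinearMap.ext fun w => ?_
    change inner ℂ h (x (inner ℂ h w • h)) • h = inner ℂ h (x h) • inner ℂ h w • h
    rw [map_smul, inner_smul_right, smul_smul, mul_comm]
  have h2 : (inner ℂ (S.1 ξ) (T.1 ξ) : ℂ) = inner ℂ h (x h) := by
    rw [inner_apply_apply, h1]
    change inner ℂ ξ (inner ℂ h (x h) • (ψ e).1 ξ) = _
    rw [hξ, inner_smul_right, inner_self_eq_norm_sq_to_K, hξ1]
    simp
  rw [h1, h2]

/-- The vectors of `G` that are of the form `T ξ`, when embedded in `ℓ²(ℕ; G)` as `v ⊗ e_0`. -/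
def orbitSpace (Q : VonNeumannAlgebra G) (ξ : L2 G) : Submodule ℂ G where
  carrier := {g | ∃ T : (amplification Q).toStarSubalgebra, T.1 ξ = incl G 0 g}
  add_mem' := by
    rintro a b ⟨S, hS⟩ ⟨T, hT⟩
    refine ⟨S + T, ?_⟩
    rw [map_add, ← hS, ← hT]
    rfl
  zero_mem' := ⟨0, by rw [map_zero]; rfl⟩
  smul_mem' := by
    rintro c a ⟨T, hT⟩
    refine ⟨c • T, ?_⟩
    rw [map_smul, ← hT]
    rfl

theorem apply_mem_orbitSpace (x : Q.toStarSubalgebra) {g : G} (hg : g ∈ orbitSpace Q ξ) :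
    x.1 g ∈ orbitSpace Q ξ := by
  obtain ⟨T, hT⟩ := hg
  refine ⟨corner Q x * T, ?_⟩
  change incl G 0 (x.1 (coord G 0 (T.1 ξ))) = _
  rw [hT, coord_incl_self]

theorem coord_mem_orbitSpace (T : (amplification Q).toStarSubalgebra) :
    coord G 0 (T.1 ξ) ∈ orbitSpace Q ξ :=
  ⟨corner Q 1 * T, rfl⟩

/-- The amplification contains the shifts between copies of `G`, so each coordinate of `ξ` can be
moved to position `0`. -/
theorem orbitSpace_ne_bot (hξ : ξ ≠ 0) : orbitSpace Q ξ ≠ ⊥ := by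
  intro h0
  refine hξ (ext_L2 fun i => ?_)
  have h1 : coord G i ξ ∈ orbitSpace Q ξ :=
    ⟨⟨incl G 0 ∘L (1 : G →L[ℂ] G) ∘L coord G i, shift_mem_amplification (one_mem _) 0 i⟩, rfl⟩
  rw [h0, Submodule.mem_bot] at h1
  rw [h1, map_zero]

namespace IsMinimalVector

/-- The isometry `g ↦ ψ |g⟩⟨h| ξ` that intertwines the identity representation and `ψ`. -/
def vec (ψ : (H →L[ℂ] H) →⋆ₙₐ[ℂ] (amplification Q).toStarSubalgebra) (h : H) (ξ : L2 G) (g : H) :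
    L2 G :=
  (ψ (InnerProductSpace.rankOne ℂ g h)).1 ξ

theorem rankOne_mul_self (hm : IsMinimalVector ψ h ξ) (g : H) :
    ψ (InnerProductSpace.rankOne ℂ g h) * ψ (InnerProductSpace.rankOne ℂ h h)
      = ψ (InnerProductSpace.rankOne ℂ g h) := by
  rw [← map_mul, rankOne_mul_rankOne, inner_self_eq_norm_sq_to_K, hm.norm_left]
  simp

theorem inner_vec (hm : IsMinimalVector ψ h ξ) (g g' : H) :
    (inner ℂ (vec ψ h ξ g) (vec ψ h ξ g') : ℂ) = inner ℂ g g' := by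
  rw [vec, vec, inner_apply_apply, ← map_star, ← map_mul, star_rankOne, rankOne_mul_rankOne,
    map_smul]
  change inner ℂ ξ (inner ℂ g g' • (ψ (InnerProductSpace.rankOne ℂ h h)).1 ξ) = _
  rw [hm.apply_self, inner_smul_right, inner_self_eq_norm_sq_to_K, hm.norm_right]
  simp

theorem apply_vec (x : H →L[ℂ] H) (g : H) : (ψ x).1 (vec ψ h ξ g) = vec ψ h ξ (x g) := by
  have h1 : ψ x * ψ (InnerProductSpace.rankOne ℂ g h) = ψ (InnerProductSpace.rankOne ℂ (x g) h) := by
    rw [← map_mul]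
    congr 1
    exact InnerProductSpace.comp_rankOne g h x
  exact DFunLike.congr_fun (congrArg Subtype.val h1) ξ

/-- Insert `1 = ∑ |u_i⟩⟨h| (|u_i⟩⟨h|)*` to the left of `T`; minimality turns `ψ(|u_i⟩⟨h|)* T` into a
scalar multiple of `f`. Thus `P Q^∞ f ξ` is precisely the copy of `H` spanned by the vectors `vec`.
-/
theorem eq_sum_vec (hm : IsMinimalVector ψ h ξ) (u : OrthonormalBasis ι ℂ H)
    {T : (amplification Q).toStarSubalgebra} (hT : ψ 1 * T = T)
    (hT' : T * ψ (InnerProductSpace.rankOne ℂ h h) = T) :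
    T.1 ξ = ∑ i, (inner ℂ (vec ψ h ξ (u i)) (T.1 ξ) : ℂ) • vec ψ h ξ (u i) := by
  have h1 : (1 : H →L[ℂ] H) = ∑ i, InnerProductSpace.rankOne ℂ (u i) h
      * star (InnerProductSpace.rankOne ℂ (u i) h : H →L[ℂ] H) := by
    refine ContinuousLinearMap.ext fun w => ?_
    simp only [star_rankOne, rankOne_mul_rankOne, inner_self_eq_norm_sq_to_K, hm.norm_left]
    simp [u.sum_repr']
  have h2 : T = ∑ i, (inner ℂ (vec ψ h ξ (u i)) (T.1 ξ) : ℂ)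
      • ψ (InnerProductSpace.rankOne ℂ (u i) h) := by
    conv_lhs => rw [← hT, h1, map_sum, Finset.sum_mul]
    refine Finset.sum_congr rfl fun i _ => ?_
    rw [map_mul, map_star, mul_assoc, hm.star_mul_eq _ _ (hm.rankOne_mul_self _) hT', mul_smul_comm,
      hm.rankOne_mul_self]
    rfl
  conv_lhs => rw [h2]
  rw [AddSubmonoidClass.coe_finsetSum, _root_.sum_apply]
  rfl

end IsMinimalVector

end Extraction

/-! ### The extracted matrix and its traces. -/

section Extraction

variable {G H ι r : Type*} [NormedAddCommGroup G] [InnerProductSpace ℂ G] [FiniteDimensional ℂ G]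
  [NormedAddCommGroup H] [InnerProductSpace ℂ H] [FiniteDimensional ℂ H] [Fintype ι]
  [Fintype r] [DecidableEq r]
  {Q : VonNeumannAlgebra G} {τ : Q.toStarSubalgebra →ₗ[ℂ] ℂ}
  {ψ : (H →L[ℂ] H) →⋆ₙₐ[ℂ] (amplification Q).toStarSubalgebra} {h : H} {ξ : L2 G}
  {W : (amplification Q).toStarSubalgebra} {η : r → G}

namespace IsMinimalVector

/-- The matrix of `W` between the vectors `η` and an orthonormal basis of `H`. -/
def mat (ψ : (H →L[ℂ] H) →⋆ₙₐ[ℂ] (amplification Q).toStarSubalgebra) (h : H) (ξ : L2 G)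
    (W : (amplification Q).toStarSubalgebra) (u : OrthonormalBasis ι ℂ H) (η : r → G) :
    Matrix ι r ℂ :=
  Matrix.of fun i l => inner ℂ (vec ψ h ξ (u i)) (W.1 (incl G 0 (η l)))

/-- The operators chosen for an orthonormal family satisfy `v_l* v_m = δ_lm f` by minimality, so
they are partial isometries with orthogonal ranges under the unit of the corner. -/
theorem exists_unit (hm : IsMinimalVector ψ h ξ) {g : G} (hg : g ∈ orbitSpace Q ξ) :
    ∃ v : (amplification Q).toStarSubalgebra, corner Q 1 * v = v ∧
      v * ψ (InnerProductSpace.rankOne ℂ h h) = v ∧ v.1 ξ = incl G 0 g := by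
  obtain ⟨T, hT⟩ := hg
  have h1 := hm.rankOne_mul_self h
  refine ⟨corner Q 1 * T * ψ (InnerProductSpace.rankOne ℂ h h), ?_, ?_, ?_⟩
  · rw [← mul_assoc, ← mul_assoc, corner_mul_corner, one_mul]
  · rw [mul_assoc, h1]
  · change incl G 0 (coord G 0 (T.1 ((ψ (InnerProductSpace.rankOne ℂ h h)).1 ξ))) = _
    rw [hm.apply_self, hT, coord_incl_self]

theorem apply_incl_eq_sum (hm : IsMinimalVector ψ h ξ) (u : OrthonormalBasis ι ℂ H)
    (hW : ψ 1 * W = W) (hη : ∀ l, η l ∈ orbitSpace Q ξ) (l : r) :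
    W.1 (incl G 0 (η l)) = ∑ i, mat ψ h ξ W u η i l • vec ψ h ξ (u i) := by
  obtain ⟨v, -, hv, hvξ⟩ := hm.exists_unit (hη l)
  have h1 := hm.eq_sum_vec u (T := W * v) (by rw [← mul_assoc, hW]) (by rw [mul_assoc, hv])
  have h2 : (W * v).1 ξ = W.1 (incl G 0 (η l)) := by
    rw [← hvξ]
    rfl
  rw [h2] at h1
  exact h1

/-- `W*` sends the copy of `H` back into the orbit space, which `η` spans. So the matrix of `W*` is
the conjugate transpose of that of `W`, and products involving `W` and `W*` are computed by matrix
products without loss. -/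
theorem star_apply_vec (u : OrthonormalBasis ι ℂ H) (hW : W * corner Q 1 = W)
    (hspan : ∀ g ∈ orbitSpace Q ξ, g = ∑ l, (inner ℂ (η l) g : ℂ) • η l) (i : ι) :
    (star W).1 (vec ψ h ξ (u i))
      = ∑ l, (starRingEnd ℂ) (mat ψ h ξ W u η i l) • incl G 0 (η l) := by
  have hW' : corner Q 1 * star W = star W := by
    rw [← star_corner_one, ← star_mul, hW]
  have h1 : coord G 0 ((star W).1 (vec ψ h ξ (u i)))
      = ∑ l, (inner ℂ (η l) (coord G 0 ((star W).1 (vec ψ h ξ (u i)))) : ℂ) • η l :=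
    hspan _ (coord_mem_orbitSpace (star W * ψ (InnerProductSpace.rankOne ℂ (u i) h)))
  rw [← incl_coord_of_corner_mul hW', h1, map_sum]
  refine Finset.sum_congr rfl fun l _ => ?_
  rw [map_smul, ← inner_incl_left]
  congr 1
  change inner ℂ (incl G 0 (η l)) (ContinuousLinearMap.adjoint W.1 (vec ψ h ξ (u i))) = _
  rw [ContinuousLinearMap.adjoint_inner_right, ← inner_conj_symm]
  rfl

theorem mat_mul_conjTranspose (u : OrthonormalBasis ι ℂ H) (hW : W * corner Q 1 = W)
    (hspan : ∀ g ∈ orbitSpace Q ξ, g = ∑ l, (inner ℂ (η l) g : ℂ) • η l) (i j : ι) :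
    (mat ψ h ξ W u η * (mat ψ h ξ W u η)ᴴ) i j
      = inner ℂ (vec ψ h ξ (u i)) (W.1 ((star W).1 (vec ψ h ξ (u j)))) := by
  rw [star_apply_vec u hW hspan, map_sum, inner_sum, Matrix.mul_apply]
  refine Finset.sum_congr rfl fun l _ => ?_
  rw [map_smul, inner_smul_right, mul_comm]
  rfl

theorem mat_partialIsometry (hm : IsMinimalVector ψ h ξ) (u : OrthonormalBasis ι ℂ H)
    (hW : W * corner Q 1 = W) (hW' : ψ 1 * W = W) (hWW : W * star W * W = W)
    (hη : ∀ l, η l ∈ orbitSpace Q ξ)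
    (hspan : ∀ g ∈ orbitSpace Q ξ, g = ∑ l, (inner ℂ (η l) g : ℂ) • η l) :
    mat ψ h ξ W u η * (mat ψ h ξ W u η)ᴴ * mat ψ h ξ W u η = mat ψ h ξ W u η := by
  ext i l
  have h1 : W.1 ((star W).1 (W.1 (incl G 0 (η l)))) = W.1 (incl G 0 (η l)) :=
    DFunLike.congr_fun (congrArg Subtype.val hWW) _
  rw [Matrix.mul_apply]
  simp only [mat_mul_conjTranspose u hW hspan]
  conv_rhs => rw [mat, Matrix.of_apply, ← h1, hm.apply_incl_eq_sum u hW' hη l]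
  simp only [map_sum, map_smul, inner_sum, inner_smul_right]
  exact Finset.sum_congr rfl fun j _ => mul_comm _ _

theorem opMat_eq_mat_mul (hm : IsMinimalVector ψ h ξ) (u : OrthonormalBasis ι ℂ H)
    (hW : W * corner Q 1 = W)
    (hspan : ∀ g ∈ orbitSpace Q ξ, g = ∑ l, (inner ℂ (η l) g : ℂ) • η l)
    {y : H →L[ℂ] H} (hy : ψ y = W * star W) :
    opMat u y = mat ψ h ξ W u η * (mat ψ h ξ W u η)ᴴ := by
  ext i j
  rw [mat_mul_conjTranspose u hW hspan, opMat, Matrix.of_apply, ← hm.inner_vec, ← apply_vec, hy]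
  rfl

theorem inner_apply_sub (hm : IsMinimalVector ψ h ξ) (u : OrthonormalBasis ι ℂ H)
    (hW' : ψ 1 * W = W) (hη : ∀ l, η l ∈ orbitSpace Q ξ) (x : Q.toStarSubalgebra) (A : H →L[ℂ] H)
    (p q : r) :
    (inner ℂ (incl G 0 (η p)) ((corner Q x - star W * ψ A * W).1 (incl G 0 (η q))) : ℂ)
      = (Matrix.of (fun p q => (inner ℂ (η p) (x.1 (η q)) : ℂ))
        - (mat ψ h ξ W u η)ᴴ * opMat u A * mat ψ h ξ W u η) p q := by
  change inner ℂ (incl G 0 (η p)) (incl G 0 (x.1 (coord G 0 (incl G 0 (η q))))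
    - ContinuousLinearMap.adjoint W.1 ((ψ A).1 (W.1 (incl G 0 (η q))))) = _
  rw [inner_sub_right, coord_incl_self, inner_incl_left, coord_incl_self,
    ContinuousLinearMap.adjoint_inner_right, hm.apply_incl_eq_sum u hW' hη p,
    hm.apply_incl_eq_sum u hW' hη q, map_sum, Matrix.sub_apply, Matrix.of_apply]
  congr 1
  rw [inner_sum, Matrix.mul_apply]
  refine Finset.sum_congr rfl fun j _ => ?_
  rw [map_smul, apply_vec, inner_smul_right, mul_comm, sum_inner, Matrix.mul_apply]
  congr 1
  refine Finset.sum_congr rfl fun i _ => ?_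
  rw [inner_smul_left, hm.inner_vec]
  rfl

set_option maxHeartbeats 1000000 in
/-- The quantities in the definition of a vNA-dilation, in terms of the extracted matrix. -/
theorem exists_trace_bounds [DecidableEq ι] [Nonempty r] (hm : IsMinimalVector ψ h ξ)
    (hτ : IsTracialState τ)
    (hrange : ∀ T, ψ 1 * T * ψ 1 = T → ∃ x, ψ x = T) (u : OrthonormalBasis ι ℂ H)
    (htr : ∀ x, (Module.finrank ℂ H : ℂ)⁻¹ * LinearMap.trace ℂ H ((x : H →L[ℂ] H) : H →ₗ[ℂ] H)
      = traceInf τ (ψ x) / traceInf τ (ψ 1))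
    (hW : W * corner Q 1 = W) (hW' : ψ 1 * W = W)
    (hη : ∀ l, η l ∈ orbitSpace Q ξ) (hη' : Orthonormal ℂ η)
    (hspan : ∀ g ∈ orbitSpace Q ξ, g = ∑ l, (inner ℂ (η l) g : ℂ) • η l) :
    ∃ C : ℝ, 0 ≤ C ∧ C * Fintype.card r ≤ 1 ∧
      (traceInf τ (corner Q 1 - star W * W)).re = 1 - C * hs (mat ψ h ξ W u η) ∧
      (traceInf τ (ψ 1 - W * star W) / traceInf τ (ψ 1)).re
        = (Fintype.card ι - hs (mat ψ h ξ W u η)) / Fintype.card ι ∧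
      ∀ (x : Q.toStarSubalgebra) (A : H →L[ℂ] H),
        C * hs (Matrix.of (fun p q => (inner ℂ (η p) (x.1 (η q)) : ℂ))
          - (mat ψ h ξ W u η)ᴴ * opMat u A * mat ψ h ξ W u η)
        ≤ (traceInf τ (star (corner Q x - star W * ψ A * W)
          * (corner Q x - star W * ψ A * W))).re := by
  obtain ⟨f, hf⟩ : ∃ f, f = ψ (InnerProductSpace.rankOne ℂ h h) := ⟨_, rfl⟩
  choose v hv1 hv2 hv3 using fun l => hm.exists_unit (hη l)
  have hInc : ∀ l m, (inner ℂ (incl G 0 (η l)) (incl G 0 (η m)) : ℂ) = if l = m then 1 else 0 :=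
    fun l m => by rw [inner_incl_left, coord_incl_self, orthonormal_iff_ite.1 hη']
  have hvv : ∀ l m, star (v l) * v m = if l = m then f else 0 := fun l m => by
    rw [hm.star_mul_eq _ _ (hv2 l) (hv2 m), hv3, hv3, hInc, hf]
    split_ifs <;> simp
  have hvf : ∀ l, v l * f = v l := fun l => by rw [hf, hv2]
  have hII : corner Q 1 * corner Q 1 = corner Q 1 := by rw [corner_mul_corner, one_mul]
  let l₀ : r := Classical.arbitrary r
  obtain ⟨hC1, hC0⟩ := traceInf_nonneg_of_unit hτ (hv1 l₀) (hvf l₀) (by rw [hvv, if_pos rfl])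
  -- `C` is the trace of the minimal projection: the conversion factor between `τ^∞` and matrix
  -- traces.
  obtain ⟨C, hC⟩ : ∃ C, C = (traceInf τ f).re := ⟨_, rfl⟩
  have hCf : traceInf τ f = C := Complex.ext (by simp [hC]) (by simp [hC1])
  rw [← hC] at hC0
  have hd : (Fintype.card ι : ℂ) ≠ 0 := by
    have : Nonempty ι := by
      by_contra h0
      rw [not_nonempty_iff] at h0
      have h1 := u.sum_repr' h
      rw [Finset.univ_eq_empty, Finset.sum_empty] at h1
      have h2 := hm.norm_left
      rw [← h1, norm_zero] at h2
      exact zero_ne_one h2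
    exact_mod_cast Fintype.card_ne_zero
  have hfin : Module.finrank ℂ H = Fintype.card ι := Module.finrank_eq_card_basis u.toBasis
  rw [hfin] at htr
  -- `htr` at `|h⟩⟨h|` reads `1/d = C / τ^∞(P)`.
  have hP : traceInf τ (ψ 1) = Fintype.card ι * C := by
    have h1 := htr (InnerProductSpace.rankOne ℂ h h)
    rw [InnerProductSpace.trace_rankOne, inner_self_eq_norm_sq_to_K, hm.norm_left, ← hf, hCf] at h1
    have h2 : traceInf τ (ψ 1) ≠ 0 := by
      intro h0
      rw [h0, div_zero] at h1
      simp [hd] at h1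
    field_simp at h1
    simpa using h1
  -- Division by zero gives `0`, so a vanishing `τ^∞(P)` would contradict `htr` at the identity.
  have hP0 : traceInf τ (ψ 1) ≠ 0 := by
    intro h0
    have h1 := htr 1
    rw [h0, div_zero] at h1
    have h2 := LinearMap.trace_one ℂ H
    rw [hfin] at h2
    rw [show ((1 : H →L[ℂ] H) : H →ₗ[ℂ] H) = 1 from rfl, h2] at h1
    simp [hd] at h1
  obtain ⟨y, hy⟩ := hrange (W * star W) (by
    have h1 : star W * ψ 1 = star W := by
      have := congrArg star hW'
      rwa [star_mul, ← map_star, star_one] at this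
    rw [← mul_assoc, hW', mul_assoc, h1])
  have htry : LinearMap.trace ℂ H (y : H →ₗ[ℂ] H) = (hs (mat ψ h ξ W u η) : ℂ) := by
    rw [trace_eq_trace_matOf u]
    change (opMat u y).trace = _
    rw [hm.opMat_eq_mat_mul u hW hspan hy, ← hs_conjTranspose, ← trace_conjTranspose_mul_self,
      conjTranspose_conjTranspose]
  refine ⟨C, hC0, ?_, ?_, ?_, fun x A => ?_⟩
  -- For `D = I` this says that the orthogonal copies of `f` indexed by `r` fit into the unit, whose
  -- trace is `1`.
  · have h1 := traceInf_mul_sum_le hτ hv1 hvf hvv (D := corner Q 1) hII hII (n := fun _ => 1)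
      (fun l => by rw [hv1, hvv, if_pos rfl]; simp)
    rw [star_corner_one, hII, cornerTrace_corner, hτ.map_one, hCf] at h1
    simpa using h1
  · rw [traceInf_eq_cornerTrace (by rw [sub_mul, hII, mul_assoc, hW]), map_sub, cornerTrace_corner,
      hτ.map_one, ← traceInf_mul_star hτ hW, ← hy]
    have h1 := htr y
    rw [htry, eq_div_iff hP0, hP] at h1
    rw [← h1]
    have h2 : (Fintype.card ι : ℂ)⁻¹ * (hs (mat ψ h ξ W u η) : ℂ) * (Fintype.card ι * C)
        = ((C * hs (mat ψ h ξ W u η) : ℝ) : ℂ) := by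
      push_cast
      field_simp
    rw [h2, Complex.sub_re, Complex.one_re, Complex.ofReal_re]
  · have h1 := htr (1 - y)
    rw [map_sub, hy, ContinuousLinearMap.toLinearMap_sub, map_sub, htry] at h1
    rw [← h1, show ((1 : H →L[ℂ] H) : H →ₗ[ℂ] H) = 1 from rfl, LinearMap.trace_one, hfin]
    have h2 : (Fintype.card ι : ℂ)⁻¹ * (Fintype.card ι - (hs (mat ψ h ξ W u η) : ℂ))
        = (((Fintype.card ι - hs (mat ψ h ξ W u η)) / Fintype.card ι : ℝ) : ℂ) := by
      push_cast
      field_simp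
    rw [h2, Complex.ofReal_re]
  · obtain ⟨D, hD⟩ : ∃ D, D = corner Q x - star W * ψ A * W := ⟨_, rfl⟩
    have hW'' : corner Q 1 * star W = star W := by rw [← star_corner_one, ← star_mul, hW]
    have hID : corner Q 1 * D = D := by
      rw [hD, mul_sub, corner_mul_corner 1 x, one_mul, ← mul_assoc, ← mul_assoc, hW'']
    have hDI : D * corner Q 1 = D := by
      rw [hD, sub_mul, corner_mul_corner x 1, mul_one, mul_assoc, hW]
    rw [← hD, traceInf_eq_cornerTrace (by rw [mul_assoc, hDI])]
    have h1 := traceInf_mul_sum_le hτ hv1 hvf hvv hID hDI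
      (n := fun l => ‖D.1 (incl G 0 (η l))‖ ^ 2) (fun l => by
        rw [hm.star_mul_eq (D * v l) (D * v l) (by rw [mul_assoc, hv2]) (by rw [mul_assoc, hv2]), hf]
        congr 1
        change inner ℂ (D.1 ((v l).1 ξ)) (D.1 ((v l).1 ξ)) = _
        rw [hv3, inner_self_eq_norm_sq_to_K]
        push_cast
        rfl)
    rw [← hC] at h1
    refine le_trans (mul_le_mul_of_nonneg_left ?_ hC0) h1
    rw [hs, Finset.sum_comm]
    refine Finset.sum_le_sum fun q _ => ?_
    have hO : Orthonormal ℂ fun p => incl G 0 (η p) := orthonormal_iff_ite.2 hInc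
    -- Bessel's inequality for the column indexed by `q`.
    refine le_trans (le_of_eq ?_) (hO.sum_inner_products_le (D.1 (incl G 0 (η q)))
      (s := Finset.univ))
    refine Finset.sum_congr rfl fun p _ => ?_
    rw [hD, hm.inner_apply_sub u hW' hη]

end IsMinimalVector

end Extraction

/-! ### From vNA-dilations to local dilations. -/

section LocalDilationOfVNA

/-- Every operator is in the von Neumann algebra of all operators. -/
def toFull (H : Type*) [NormedAddCommGroup H] [InnerProductSpace ℂ H] [FiniteDimensional ℂ H] :
    (H →L[ℂ] H) →⋆ₙₐ[ℂ] (fullAlgebra H).toStarSubalgebra where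
  toFun x := ⟨x, trivial⟩
  map_smul' _ _ := rfl
  map_zero' := rfl
  map_add' _ _ := rfl
  map_mul' _ _ := rfl
  map_star' _ := rfl

variable {X 𝒜 H' H ι ι' : Type*} [Fintype X] [Fintype 𝒜] [Fintype ι] [Fintype ι']
  [NormedAddCommGroup H'] [InnerProductSpace ℂ H'] [FiniteDimensional ℂ H'] [Nontrivial H']
  [NormedAddCommGroup H] [InnerProductSpace ℂ H] [FiniteDimensional ℂ H] [Nontrivial H]

theorem mul_eq_of_compression {R : Type*} [Semigroup R] {P W I : R} (hP : P * P = P)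
    (hI : I * I = I) (hW : P * W * I = W) : P * W = W ∧ W * I = W := by
  constructor
  · conv_lhs => rw [← hW]
    rw [← mul_assoc, ← mul_assoc, hP, hW]
  · conv_lhs => rw [← hW]
    rw [mul_assoc, hI, hW]

/-- `P` is the unit of the corner `P S P`, which is the range of `ψ`; so the non-unital homomorphism
`ψ` sends `1` to it. -/
theorem map_one_eq_of_range {R S : Type*} [Semiring R] [Semiring S] [Algebra ℂ R] [Algebra ℂ S]
    [Star R] [Star S] {ψ : R →⋆ₙₐ[ℂ] S} {P : S} (hP : P * P = P)
    (hrange : ∀ T, (∃ x, ψ x = T) ↔ P * T * P = T) : ψ 1 = P := by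
  obtain ⟨y, hy⟩ := (hrange P).2 (by rw [hP, hP])
  have h1 : P * ψ 1 * P = ψ 1 := (hrange (ψ 1)).1 ⟨1, rfl⟩
  have h2 : P * ψ 1 = P := by rw [← hy, ← map_mul, mul_one]
  rw [← h1, h2, hP]

set_option maxHeartbeats 1000000 in
-- The orbit space is invariant under `B(H') ⊗ 1`, hence it has a basis of products `u'_j ⊗ k_m`. In
-- this basis `A' ⊗ 1` is a Kronecker product, and `exists_trace_bounds` applies. Only `C · dim ≤ 1`
-- is available, since the orbit space may miss part of `H' ⊗ K`.
theorem exists_partialIsometry_of_compression [DecidableEq ι] [DecidableEq ι']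
    {K : Type*} [NormedAddCommGroup K] [InnerProductSpace ℂ K] [FiniteDimensional ℂ K]
    (u' : OrthonormalBasis ι' ℂ H') (u : OrthonormalBasis ι ℂ H) {ε : ℝ} {p : X → ℝ}
    (hp : ∀ x, 0 ≤ p x) {M₀ : VonNeumannAlgebra K} {τ₀ : M₀.toStarSubalgebra →ₗ[ℂ] ℂ}
    (hτ₀ : IsTracialState τ₀) {A' : X → 𝒜 → (H' →L[ℂ] H')} {A : X → 𝒜 → (H →L[ℂ] H)}
    {P W : (amplification (tensorAlgebra (fullAlgebra H') M₀)).toStarSubalgebra}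
    {ψ : (H →L[ℂ] H) →⋆ₙₐ[ℂ]
      (amplification (tensorAlgebra (fullAlgebra H') M₀)).toStarSubalgebra}
    (hP : P * P = P) (hψ : Function.Injective ψ)
    (hrange : ∀ T, (∃ x, ψ x = T) ↔ P * T * P = T)
    (htr : ∀ x, (Module.finrank ℂ H : ℂ)⁻¹ * LinearMap.trace ℂ H ((x : H →L[ℂ] H) : H →ₗ[ℂ] H)
      = traceInf (tensorTrace (normalizedTrace H') τ₀) (ψ x)
        / traceInf (tensorTrace (normalizedTrace H') τ₀) P)
    (hWW : W * star W * W = W) (hPW : P * W * corner (tensorAlgebra (fullAlgebra H') M₀) 1 = W)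
    (h1 : ∑ x, p x * ∑ a, (traceInf (tensorTrace (normalizedTrace H') τ₀)
      (star (corner _ (tensorElem (toFull H' (A' x a)) 1) - star W * ψ (A x a) * W) *
        (corner _ (tensorElem (toFull H' (A' x a)) 1) - star W * ψ (A x a) * W))).re ≤ ε)
    (h2 : (traceInf (tensorTrace (normalizedTrace H') τ₀) (P - W * star W)
      / traceInf (tensorTrace (normalizedTrace H') τ₀) P).re ≤ ε)
    (h3 : (traceInf (tensorTrace (normalizedTrace H') τ₀) (corner _ 1 - star W * W)).re ≤ ε) :
    ∃ (n : ℕ) (C : ℝ) (W : Matrix ι (ι' × Fin n) ℂ), 0 < n ∧ W * Wᴴ * W = W ∧ 0 ≤ C ∧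
      C * Fintype.card (ι' × Fin n) ≤ 1 ∧ 1 - C * hs W ≤ ε ∧
      (Fintype.card ι - hs W) / Fintype.card ι ≤ ε ∧
      C * ∑ t : X × 𝒜, p t.1 * hs (opMat u' (A' t.1 t.2) ⊗ₖ (1 : Matrix (Fin n) (Fin n) ℂ)
        - Wᴴ * opMat u (A t.1 t.2) * W) ≤ ε := by
  have hτ := isTracialState_tensorTrace (F := H') hτ₀
  have hι' : Nonempty ι' := u'.toBasis.index_nonempty
  have hι : Nonempty ι := u.toBasis.index_nonempty
  obtain rfl := map_one_eq_of_range hP hrange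
  obtain ⟨hPW', hWI⟩ := mul_eq_of_compression hP
    (by rw [corner_mul_corner, one_mul]) hPW
  have hrange' : ∀ T, ψ 1 * T * ψ 1 = T → ∃ x, ψ x = T := fun T => (hrange T).2
  obtain ⟨ξ, hm⟩ := exists_isMinimalVector (ψ := ψ) hψ hrange'
    (u.norm_eq_one (Classical.arbitrary ι))
  have hξ0 : ξ ≠ 0 := by
    rintro rfl
    have := hm.norm_right
    simp at this
  obtain ⟨n, k, hn, hk, hkL, hspan⟩ := exists_orthonormal_of_invariant u'
    (L := orbitSpace (tensorAlgebra (fullAlgebra H') M₀) ξ)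
    (fun T g hg => apply_mem_orbitSpace (tensorElem (toFull H' T) 1) hg)
    (orbitSpace_ne_bot hξ0)
  have : Nonempty (Fin n) := ⟨⟨0, hn⟩⟩
  let η : ι' × Fin n → H' ⊗[ℂ] K := fun p => u' p.1 ⊗ₜ[ℂ] k p.2
  have hη : Orthonormal ℂ η := orthonormal_iff_ite.2 fun p q => by
    rw [TensorProduct.inner_tmul, orthonormal_iff_ite.1 u'.orthonormal, orthonormal_iff_ite.1 hk]
    by_cases h4 : p.1 = q.1 <;> simp [Prod.ext_iff, h4]
  have hηL : ∀ l, η l ∈ orbitSpace (tensorAlgebra (fullAlgebra H') M₀) ξ := fun l => hkL _ _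
  obtain ⟨C, hC0, hC1, hC2, hC3, hC4⟩ := hm.exists_trace_bounds hτ hrange' u
    htr hWI hPW' hηL hη hspan
  refine ⟨n, C, IsMinimalVector.mat ψ _ ξ W u η, hn,
    hm.mat_partialIsometry u hWI hPW' hWW hηL hspan, hC0, hC1, hC2.symm.le.trans h3,
    hC3.symm.le.trans h2, le_trans ?_ h1⟩
  have hsum : ∀ F : X × 𝒜 → ℝ, C * ∑ t : X × 𝒜, p t.1 * F t
      = ∑ x, p x * ∑ a, C * F (x, a) := fun F => by
    simp only [Fintype.sum_prod_type, Finset.mul_sum]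
    exact Finset.sum_congr rfl fun x _ => Finset.sum_congr rfl fun a _ => mul_left_comm _ _ _
  rw [hsum]
  refine Finset.sum_le_sum fun x _ => mul_le_mul_of_nonneg_left
    (Finset.sum_le_sum fun a _ => ?_) (hp x)
  refine le_trans (le_of_eq ?_)
    (hC4 (tensorElem (toFull H' (A' x a)) 1) (A x a))
  have h4 : Matrix.of (fun p q => (inner ℂ (η p) (TensorProduct.mapL (A' x a)
      (1 : K →L[ℂ] K) (η q)) : ℂ)) = opMat u' (A' x a) ⊗ₖ (1 : Matrix (Fin n) (Fin n) ℂ) := by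
    ext p q
    rw [Matrix.of_apply, TensorProduct.mapL_tmul, TensorProduct.inner_tmul, one_apply_eq_self,
      orthonormal_iff_ite.1 hk, Matrix.kroneckerMap_apply, Matrix.one_apply]
    rfl
  rw [← h4]
  rfl

theorem exists_partialIsometry_of_isVNADilation [DecidableEq ι] [DecidableEq ι']
    {S' : MEStrategy X 𝒜 H'} {S : MEStrategy X 𝒜 H}
    (u' : OrthonormalBasis ι' ℂ H') (u : OrthonormalBasis ι ℂ H) {ε : ℝ} {p : X → ℝ}
    (hp : ∀ x, 0 ≤ p x) (h : IsVNADilation S'.toTracial S.toTracial ε p) :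
    ∃ (n : ℕ) (C : ℝ) (W : Matrix ι (ι' × Fin n) ℂ), 0 < n ∧ W * Wᴴ * W = W ∧ 0 ≤ C ∧
      C * Fintype.card (ι' × Fin n) ≤ 1 ∧ 1 - C * hs W ≤ ε ∧
      (Fintype.card ι - hs W) / Fintype.card ι ≤ ε ∧
      C * ∑ t : X × 𝒜, p t.1 * hs (opMat u' (S'.A t.1 t.2) ⊗ₖ (1 : Matrix (Fin n) (Fin n) ℂ)
        - Wᴴ * opMat u (S.A t.1 t.2) * W) ≤ ε := by
  obtain ⟨K, _, _, _, M₀, τ₀, hτ₀, h⟩ := h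
  obtain ⟨P, π, W, hP, -, hinj, hrange, htr, hWW, hPW, h1, h2, h3⟩ := h
  refine exists_partialIsometry_of_compression (A' := S'.A) (A := S.A)
    (ψ := NonUnitalStarAlgHom.comp π (toFull H)) u' u hp hτ₀ hP.1 ?_ ?_ ?_ hWW hPW h1 h2 h3
  · exact fun x y hxy => congrArg Subtype.val (hinj hxy)
  · refine fun T => Iff.trans ⟨?_, ?_⟩ (hrange T)
    · rintro ⟨x, hx⟩
      exact ⟨toFull H x, hx⟩
    · rintro ⟨x, hx⟩
      exact ⟨x.1, hx⟩
  · exact fun x => htr (toFull H x)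

theorem isLocalDilation_of_isVNADilation {ν : X × X → ℝ} (hν : IsProbDist ν)
    (hν_symm : ∀ x y, ν (x, y) = ν (y, x)) {S' : MEStrategy X 𝒜 H'} {S : MEStrategy X 𝒜 H}
    (u' : OrthonormalBasis ι' ℂ H') (u : OrthonormalBasis ι ℂ H) {ε : ℝ} (hε : 0 ≤ ε)
    (h : IsVNADilation S'.toTracial S.toTracial ε (marginalFst ν)) :
    IsLocalDilation (S'.toStrategy u') (S.toStrategy u) ((4 + √2) * √ε) ν := by
  classical
  have hp := hν.marginalFst
  obtain ⟨n, C, W, hn, hW, hC0, hC1, h1, h2, h3⟩ :=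
    exists_partialIsometry_of_isVNADilation u' u hp.1 h
  have : Nonempty (Fin n) := ⟨⟨0, hn⟩⟩
  have hι : Nonempty ι := u.toBasis.index_nonempty
  have hd : (0 : ℝ) < Fintype.card ι := by exact_mod_cast Fintype.card_pos
  refine isLocalDilation_of_partialIsometry hν hν_symm S' S u' u hW hε
    (or_iff_not_imp_left.2 fun hε' => ⟨(div_le_iff₀ hd).1 h2, ?_, ?_⟩)
  · push Not at hε'
    have h4 : 0 < C := by
      by_contra h0
      have : C = 0 := le_antisymm (not_lt.1 h0) hC0
      rw [this] at h1
      linarith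
    -- `C (1 - ε) r ≤ 1 - ε ≤ C ‖W‖²`, with `r` the dimension of `H' ⊗ ℂ^n`; cancel `C > 0`.
    have h5 : C * ((1 - ε) * Fintype.card (ι' × Fin n)) ≤ C * hs W := by nlinarith
    have := le_of_mul_le_mul_left h5 h4
    linarith
  · push Not at hε'
    have h4 : hs W ≤ Fintype.card (ι' × Fin n) := by
      have := hs_le_card_of_partialIsometry (partialIsometry_conjTranspose hW)
      rwa [hs_conjTranspose] at this
    have h5 := mul_le_mul_of_nonneg_left h4 hC0
    generalize hs W = r at *
    generalize (∑ t : X × 𝒜, _ : ℝ) = σ at *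
    have h6 : (0 : ℝ) ≤ Fintype.card (ι' × Fin n) := Nat.cast_nonneg _
    rcases le_or_gt σ 0 with h7 | h7
    · exact h7.trans (by positivity)
    -- For `ε ≤ 3/4`, `C` times the dimension is at least `C ‖W‖² ≥ 1 - ε ≥ 1/4`; dividing by it
    -- gives the factor `4`.
    · nlinarith [mul_le_mul_of_nonneg_right h3 h6]

end LocalDilationOfVNA

end SelfTesting

end

theorem mainTheorem6 {X 𝒜 H' H : Type*} [Fintype X] [Fintype 𝒜]
    [NormedAddCommGroup H'] [InnerProductSpace ℂ H'] [FiniteDimensional ℂ H'] [Nontrivial H']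
    [NormedAddCommGroup H] [InnerProductSpace ℂ H] [FiniteDimensional ℂ H] [Nontrivial H]
    (ν : X × X → ℝ) (hν : SelfTesting.IsProbDist ν) (hν_symm : ∀ x y, ν (x, y) = ν (y, x))
    (S' : SelfTesting.MEStrategy X 𝒜 H') (S : SelfTesting.MEStrategy X 𝒜 H)
    {ι' ι : Type*} [Fintype ι'] [Fintype ι]
    (u' : OrthonormalBasis ι' ℂ H') (u : OrthonormalBasis ι ℂ H)
    (ε : ℝ) (hε : 0 ≤ ε) :
    (SelfTesting.IsLocalDilation (S'.toStrategy u') (S.toStrategy u) ε ν →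
      SelfTesting.IsVNADilation S'.toTracial S.toTracial (1700 * ε ^ 2)
        (SelfTesting.marginalFst ν)) ∧
    (SelfTesting.IsVNADilation S'.toTracial S.toTracial ε (SelfTesting.marginalFst ν) →
      SelfTesting.IsLocalDilation (S'.toStrategy u') (S.toStrategy u) ((4 + √2) * √ε) ν) := by
  exact ⟨SelfTesting.isVNADilation_of_isLocalDilation hν u' u,
    SelfTesting.isLocalDilation_of_isVNADilation hν hν_symm u' u hε⟩
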